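/- All manifolds are smooth, finite-dimensional, Hausdorff and second countable. **Adjustments.** Let $\mathscr{G} \rightrightarrows M$ be a Lie groupoid with source $\mathsf{s}$, target $\mathsf{t}$, Lie algebroid $\mathfrak{g} = \mathsf{1}^*\ker d\mathsf{t}$ and anchor $\rho = d\mathsf{s}|_{\mathfrak{g}}$. A *Cartan connection* is a smooth distribution $\mathcal{H} \subseteq T\mathscr{G}$ that is complementary to $\ker d\mathsf{t}$ and such that $\mathcal{H} \rightrightarrows TM$ is a subgroupoid of the tangent groupoid $T\mathscr{G} \rightrightarrows TM$. It induces the connection $\nabla_V \nu = [V^{\mathrm{hor}}, \nu^{l}]|_M$ on $\mathfrak{g}$, where $V^{\mathrm{hor}}$ is the horizontal lift with respect to $\mathsf t$ and $\nu^l$ is the left-invariant vector field of $\nu$, and the basic connections $\nabla^{\mathrm{bas}}_\nu \mu = \nabla_{\rho(\mu)}\nu + [\nu,\mu]$ on $\mathfrak{g}$ and $\nabla^{\mathrm{bas}}_\nu V = \rho(\nabla_V \nu) + [\rho(\nu), V]$ on $TM$. An *adjustment* of $\mathscr{G}$ is a Cartan connection with vanishing basic curvature, that is, $$\nabla_V[\nu,\mu]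 - [\nabla_V\nu,\mu] - [\nu,\nabla_V\mu] - \nabla_{\nabla^{\mathrm{bas}}_\mu V}\nu + \nabla_{\nabla^{\mathrm{bas}}_\nu V}\mu = 0 .$$ It is *flat* if $R_\nabla = 0$. Together with $\zeta \in \Omega^2(M,\mathfrak{g})$ it is a *covariant adjustment* if $R_\nabla(V,W)\nu + (\nabla^{\mathrm{bas}}_\nu \zeta)(V,W) = 0$ for all $V, W, \nu$, and a *strict* one if moreover $$(d^\nabla\zeta)(V_1,V_2,V_3) = \zeta(V_1,\rho(\zeta(V_2,V_3))) + \zeta(V_2,\rho(\zeta(V_3,V_1))) + \zeta(V_3,\rho(\zeta(V_1,V_2))) .$$ **Setting.** Let $\mathsf{H}$ be a Lie group that acts smoothly from the left on $\mathbb{R}^d$ with $0$ as a fixed point, let $P \to M$ be a principal $\mathsf{H}$-bundle, let $\mathscr{T} = (P \times \mathbb{R}^d)/\mathsf{H}$ be the associated bundle, and let $j : M \to \mathscr{T}$, $\pi(p) \mapsto [p,0]$, be its zero section. The Atiyah groupoid $(P \times P)/\mathsf{H} \rightrightarrows M$, with target $[p,q] \mapsto \pi(p)$, source $[p,q] \mapsto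 \pi(q)$ and composition $[p,q]\circ[q,r] = [p,r]$, acts on $\mathscr{T}$ by $[p,q]\cdot[q,y] = [p,y]$. Let $\mathscr{K} = \mathscr{T}\times_M (P\times P)/\mathsf{H} \rightrightarrows \mathscr{T}$ be the action groupoid of the induced right action $n \triangleleft g = g^{-1}\cdot n$, with target $(n,g)\mapsto n$ and source $(n,g) \mapsto n \triangleleft g$. Let $\mathscr{P}\mathsf{air}(M) = (M \times M \rightrightarrows M)$ be the pair groupoid, with target $(m_2,m_1) \mapsto m_2$ and source $(m_2,m_1)\mapsto m_1$. **Proposition.** Suppose that $P$ is trivial, with a trivialization $P \cong M \times \mathsf{H}$ and the corresponding section $s$, and that $\mathscr{P}\mathsf{air}(M)$ has an adjustment $\mathcal{H}^M$. Then: 1. $\mathscr{K}$ is a Lie groupoid, and the map $$\iota : \mathsf{H} \times \mathscr{P}\mathsf{air}(M) \to \mathscr{K}, \qquad (h, m_2, m_1) \mapsto \big(j(m_2), [s(m_2) h, s(m_1)]\big),$$ over $j$ is an isomorphism of Lie groupoids onto the restriction $\mathscr{K}|_M$ of $\mathscr{K}$ to the embedded submanifold $j(M) \cong M$. 2. There is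 a form $\zeta^M$ for which $(\mathcal{H}^M, \zeta^M)$ is a strict covariant adjustment of $\mathscr{P}\mathsf{air}(M)$. 3. For each such $\zeta^M$, the pair $(0_{\mathsf{H}} \oplus \mathcal{H}^M,\ 0 \oplus \zeta^M)$ is a strict covariant adjustment of $\mathsf{H} \times \mathscr{P}\mathsf{air}(M)$ (the *canonical* one), and it is flat if and only if $\mathcal{H}^M$ is flat. 4. For each such $\zeta^M$, there is a strict covariant adjustment $(\mathcal{H}^{\mathscr{K}}, \zeta^{\mathscr{K}})$ of $\mathscr{K}$ that restricts along $(\iota, j)$ to the canonical one, that is, $(d\iota)^{-1}(\mathcal{H}^{\mathscr{K}}) = 0_{\mathsf{H}} \oplus \mathcal{H}^M$ and $\zeta^{\mathscr{K}}(dj(v), dj(w)) = d\iota\big(0, \zeta^M(v,w)\big)$ for all $v, w \in TM$; and it is flat if and only if $\mathcal{H}^M$ is flat. -/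

import Mathlib

open scoped Manifold ContDiff Topology
noncomputable section

/-- A groupoid `G ⇉ M`, with the composition defined on composable pairs, `src g = tgt h`. -/
structure Gpd (G M : Type*) where
  src : G → M
  tgt : G → M
  unit : M → G
  mul : ∀ g h : G, src g = tgt h → G
  inv : G → G
  src_unit : ∀ x, src (unit x) = x
  tgt_unit : ∀ x, tgt (unit x) = x
  src_mul : ∀ g h c, src (mul g h c) = src h
  tgt_mul : ∀ g h c, tgt (mul g h c) = tgt g
  src_inv : ∀ g, src (inv g) = tgt g
  tgt_inv : ∀ g, tgt (inv g) = src g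
  unit_mul : ∀ g c, mul (unit (tgt g)) g c = g
  mul_unit : ∀ g c, mul g (unit (src g)) c = g
  mul_inv : ∀ g c, mul g (inv g) c = unit (tgt g)
  inv_mul : ∀ g c, mul (inv g) g c = unit (src g)
  mul_assoc : ∀ g h k c₁ c₂ c₃ c₄, mul (mul g h c₁) k c₂ = mul g (mul h k c₃) c₄

namespace Gpd

section Smooth

variable {EG HG EM HM : Type*} [NormedAddCommGroup EG] [NormedSpace ℝ EG]
  [NormedAddCommGroup EM] [NormedSpace ℝ EM] [TopologicalSpace HG] [TopologicalSpace HM]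
  (IG : ModelWithCorners ℝ EG HG) (IM : ModelWithCorners ℝ EM HM)
  {G M : Type*} [TopologicalSpace G] [ChartedSpace HG G] [TopologicalSpace M] [ChartedSpace HM M]

/-- The set `G ×_M G` of composable pairs. -/
def composable {G M : Type*} (𝒢 : Gpd G M) : Set (G × G) := {x | 𝒢.src x.1 = 𝒢.tgt x.2}

open Classical in
/-- The composition, extended arbitrarily outside the composable pairs. -/
def mulExt {G M : Type*} (𝒢 : Gpd G M) (x : G × G) : G :=
  if c : 𝒢.src x.1 = 𝒢.tgt x.2 then 𝒢.mul x.1 x.2 c else x.1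

/-- `G ⇉ M` is a Lie groupoid: source and target are (surjective) submersions and all structure
maps are smooth. Smoothness of the composition on the submanifold `G ×_M G ⊆ G × G` is
smoothness along this subset. -/
structure IsLieGroupoid (𝒢 : Gpd G M) : Prop where
  smooth_src : ContMDiff IG IM ∞ 𝒢.src
  smooth_tgt : ContMDiff IG IM ∞ 𝒢.tgt
  smooth_unit : ContMDiff IM IG ∞ 𝒢.unit
  smooth_inv : ContMDiff IG IG ∞ 𝒢.inv
  submersion_src : ∀ g, Function.Surjective (mfderiv IG IM 𝒢.src g)
  submersion_tgt : ∀ g, Function.Surjective (mfderiv IG IM 𝒢.tgt g)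
  smooth_mul : ContMDiffOn (IG.prod IG) IG ∞ 𝒢.mulExt 𝒢.composable

/-- Composition in the tangent groupoid `TG ⇉ TM`: the differential of the composition of `𝒢` at
a composable pair `(g, h)`, applied to `(v, w)` with `d src v = d tgt w`. (Such `(v, w)` are
tangent to the set of composable pairs, so that the derivative along this set is determined.) -/
def tangentMul (𝒢 : Gpd G M) (g h : G) (v : TangentSpace IG g) (w : TangentSpace IG h) :
    TangentSpace IG (𝒢.mulExt (g, h)) :=
  mfderivWithin (IG.prod IG) IG 𝒢.mulExt 𝒢.composable (g, h) (v, w)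

section Connection

variable [IsManifold IG ∞ G] [IsManifold IM ∞ M]

/-- Smoothness of a vector field. -/
def IsSmoothVF (V : ∀ x : M, TangentSpace IM x) : Prop :=
  ContMDiff IM IM.tangent ∞ (fun x => (⟨x, V x⟩ : TangentBundle IM M))

/-- Smooth sections of the Lie algebroid `𝔤 = unit^* ker (d tgt)` of `𝒢`. -/
structure IsSection (𝒢 : Gpd G M) (ν : ∀ x : M, TangentSpace IG (𝒢.unit x)) : Prop where
  smooth : ContMDiff IM IG.tangent ∞ (fun x => (⟨𝒢.unit x, ν x⟩ : TangentBundle IG G))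
  vertical : ∀ x, mfderiv IG IM 𝒢.tgt (𝒢.unit x) (ν x) = 0

/-- A Cartan connection: a smooth distribution `D` on `G`, complementary to `ker (d tgt)`, such
that `D ⇉ TM` is a subgroupoid of the tangent groupoid `TG ⇉ TM`. -/
structure IsCartanConnection (𝒢 : Gpd G M) (D : ∀ g : G, Submodule ℝ (TangentSpace IG g)) :
    Prop where
  smooth : ∀ g, ∀ v ∈ D g, ∃ U : Set G, IsOpen U ∧ g ∈ U ∧ ∃ X : ∀ g : G, TangentSpace IG g,
    ContMDiffOn IG IG.tangent ∞ (fun g => (⟨g, X g⟩ : TangentBundle IG G)) U ∧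
      X g = v ∧ ∀ g' ∈ U, X g' ∈ D g'
  compl : ∀ g, IsCompl (D g) (LinearMap.ker (mfderiv IG IM 𝒢.tgt g).toLinearMap)
  unit_mem : ∀ x (v : TangentSpace IM x), mfderiv IM IG 𝒢.unit x v ∈ D (𝒢.unit x)
  inv_mem : ∀ g, ∀ v ∈ D g, mfderiv IG IG 𝒢.inv g v ∈ D (𝒢.inv g)
  mul_mem : ∀ g h, 𝒢.src g = 𝒢.tgt h → ∀ v ∈ D g, ∀ w ∈ D h,
    (mfderiv IG IM 𝒢.src g v : EM) = (mfderiv IG IM 𝒢.tgt h w : EM) →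
      𝒢.tangentMul IG g h v w ∈ D (𝒢.mulExt (g, h))

open Classical in
/-- The horizontal lift of a vector field `V` on `M`: the vector field on `G` with values in `D`
that is mapped to `V` by `d tgt`. -/
def hor (𝒢 : Gpd G M) (D : ∀ g : G, Submodule ℝ (TangentSpace IG g))
    (V : ∀ x : M, TangentSpace IM x) (g : G) : TangentSpace IG g :=
  if h : ∃ w ∈ D g, mfderiv IG IM 𝒢.tgt g w = V (𝒢.tgt g) then h.choose else 0

/-- The left-invariant vector field on `G` of a section `ν` of the Lie algebroid; its value at `g`
is the differential of the left translation by `g`, which is defined on the fibre of `tgt` over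
`src g`, applied to `ν (src g)`. -/
def leftInv (𝒢 : Gpd G M) (ν : ∀ x : M, TangentSpace IG (𝒢.unit x)) (g : G) :
    TangentSpace IG g :=
  mfderivWithin IG IG (fun h => 𝒢.mulExt (g, h)) {h | 𝒢.tgt h = 𝒢.src g} (𝒢.unit (𝒢.src g))
    (ν (𝒢.src g))

/-- The Lie bracket of sections of the Lie algebroid. -/
def bracket (𝒢 : Gpd G M) (ν μ : ∀ x : M, TangentSpace IG (𝒢.unit x)) (x : M) :
    TangentSpace IG (𝒢.unit x) :=
  VectorField.mlieBracket IG (𝒢.leftInv IG ν) (𝒢.leftInv IG μ) (𝒢.unit x)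

/-- The anchor of the Lie algebroid. -/
def anchor (𝒢 : Gpd G M) (ν : ∀ x : M, TangentSpace IG (𝒢.unit x)) (x : M) :
    TangentSpace IM x :=
  mfderiv IG IM 𝒢.src (𝒢.unit x) (ν x)

/-- The connection `∇_V ν = [hor V, ν_l]|_M` on the Lie algebroid induced by `D`. -/
def nabla (𝒢 : Gpd G M) (D : ∀ g : G, Submodule ℝ (TangentSpace IG g))
    (V : ∀ x : M, TangentSpace IM x) (ν : ∀ x : M, TangentSpace IG (𝒢.unit x)) (x : M) :
    TangentSpace IG (𝒢.unit x) :=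
  VectorField.mlieBracket IG (𝒢.hor IG IM D V) (𝒢.leftInv IG ν) (𝒢.unit x)

/-- The curvature `R_∇(V, W) ν` of the induced connection. -/
def curvature (𝒢 : Gpd G M) (D : ∀ g : G, Submodule ℝ (TangentSpace IG g))
    (V W : ∀ x : M, TangentSpace IM x) (ν : ∀ x : M, TangentSpace IG (𝒢.unit x)) :
    ∀ x : M, TangentSpace IG (𝒢.unit x) :=
  𝒢.nabla IG IM D V (𝒢.nabla IG IM D W ν) - 𝒢.nabla IG IM D W (𝒢.nabla IG IM D V ν)
    - 𝒢.nabla IG IM D (VectorField.mlieBracket IM V W) ν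

/-- The basic connection `∇^bas_ν μ = ∇_{ρ(μ)} ν + [ν, μ]` on the Lie algebroid. -/
def basic (𝒢 : Gpd G M) (D : ∀ g : G, Submodule ℝ (TangentSpace IG g))
    (ν μ : ∀ x : M, TangentSpace IG (𝒢.unit x)) : ∀ x : M, TangentSpace IG (𝒢.unit x) :=
  𝒢.nabla IG IM D (𝒢.anchor IG IM μ) ν + 𝒢.bracket IG ν μ

/-- The basic connection `∇^bas_ν V = ρ(∇_V ν) + [ρ(ν), V]` on the tangent bundle. -/
def basicT (𝒢 : Gpd G M) (D : ∀ g : G, Submodule ℝ (TangentSpace IG g))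
    (ν : ∀ x : M, TangentSpace IG (𝒢.unit x)) (V : ∀ x : M, TangentSpace IM x) :
    ∀ x : M, TangentSpace IM x :=
  𝒢.anchor IG IM (𝒢.nabla IG IM D V ν) + VectorField.mlieBracket IM (𝒢.anchor IG IM ν) V

/-- The basic curvature `R^bas_∇(ν, μ)(V)`. -/
def basicCurvature (𝒢 : Gpd G M) (D : ∀ g : G, Submodule ℝ (TangentSpace IG g))
    (ν μ : ∀ x : M, TangentSpace IG (𝒢.unit x)) (V : ∀ x : M, TangentSpace IM x) :
    ∀ x : M, TangentSpace IG (𝒢.unit x) :=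
  𝒢.nabla IG IM D V (𝒢.bracket IG ν μ) - 𝒢.bracket IG (𝒢.nabla IG IM D V ν) μ
    - 𝒢.bracket IG ν (𝒢.nabla IG IM D V μ) - 𝒢.nabla IG IM D (𝒢.basicT IG IM D μ V) ν
    + 𝒢.nabla IG IM D (𝒢.basicT IG IM D ν V) μ

/-- Fibrewise bilinear maps on `TM` with values in `𝔤 ⊆ unit^* TG`. -/
abbrev Bilin (𝒢 : Gpd G M) : Type _ :=
  ∀ x : M, TangentSpace IM x →ₗ[ℝ] TangentSpace IM x →ₗ[ℝ] TangentSpace IG (𝒢.unit x)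

/-- Evaluation of a form `ζ` on two vector fields. -/
def evalForm (𝒢 : Gpd G M) (ζ : Bilin IG IM 𝒢) (V W : ∀ x : M, TangentSpace IM x) (x : M) :
    TangentSpace IG (𝒢.unit x) := ζ x (V x) (W x)

/-- `ζ ∈ Ω²(M, 𝔤)`. -/
structure IsTwoForm (𝒢 : Gpd G M) (ζ : Bilin IG IM 𝒢) : Prop where
  alternating : ∀ x v, ζ x v v = 0
  smooth : ∀ V W, IsSmoothVF IM V → IsSmoothVF IM W →
    IsSection IG IM 𝒢 (𝒢.evalForm IG IM ζ V W)

/-- `(∇^bas_ν ζ)(V, W)`. -/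
def basicForm (𝒢 : Gpd G M) (D : ∀ g : G, Submodule ℝ (TangentSpace IG g))
    (ζ : Bilin IG IM 𝒢) (ν : ∀ x : M, TangentSpace IG (𝒢.unit x))
    (V W : ∀ x : M, TangentSpace IM x) : ∀ x : M, TangentSpace IG (𝒢.unit x) :=
  𝒢.basic IG IM D ν (𝒢.evalForm IG IM ζ V W)
    - 𝒢.evalForm IG IM ζ (𝒢.basicT IG IM D ν V) W
    - 𝒢.evalForm IG IM ζ V (𝒢.basicT IG IM D ν W)

/-- `(d^∇ ζ)(V₁, V₂, V₃)`, with `d^∇` the exterior covariant derivative. -/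
def extDeriv (𝒢 : Gpd G M) (D : ∀ g : G, Submodule ℝ (TangentSpace IG g))
    (ζ : Bilin IG IM 𝒢) (V₁ V₂ V₃ : ∀ x : M, TangentSpace IM x) :
    ∀ x : M, TangentSpace IG (𝒢.unit x) :=
  𝒢.nabla IG IM D V₁ (𝒢.evalForm IG IM ζ V₂ V₃) - 𝒢.nabla IG IM D V₂ (𝒢.evalForm IG IM ζ V₁ V₃)
    + 𝒢.nabla IG IM D V₃ (𝒢.evalForm IG IM ζ V₁ V₂)
    - 𝒢.evalForm IG IM ζ (VectorField.mlieBracket IM V₁ V₂) V₃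
    + 𝒢.evalForm IG IM ζ (VectorField.mlieBracket IM V₁ V₃) V₂
    - 𝒢.evalForm IG IM ζ (VectorField.mlieBracket IM V₂ V₃) V₁

/-- An adjustment of a Lie groupoid: a Cartan connection whose induced connection `∇` on the Lie
algebroid has vanishing basic curvature. -/
structure IsAdjustment (𝒢 : Gpd G M) (D : ∀ g : G, Submodule ℝ (TangentSpace IG g)) : Prop where
  cartan : 𝒢.IsCartanConnection IG IM D
  basicCurvature_eq_zero : ∀ ν μ V, 𝒢.IsSection IG IM ν → 𝒢.IsSection IG IM μ →
    IsSmoothVF IM V → ∀ x, 𝒢.basicCurvature IG IM D ν μ V x = 0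

/-- A covariant adjustment: an adjustment together with a primitive `ζ ∈ Ω²(M, 𝔤)`, that is,
`R_∇ + ∇^bas ζ = 0`. -/
structure IsCovariantAdjustment (𝒢 : Gpd G M) (D : ∀ g : G, Submodule ℝ (TangentSpace IG g))
    (ζ : Bilin IG IM 𝒢) : Prop extends IsAdjustment IG IM 𝒢 D where
  twoForm : 𝒢.IsTwoForm IG IM ζ
  primitive : ∀ V W ν, IsSmoothVF IM V → IsSmoothVF IM W → 𝒢.IsSection IG IM ν →
    ∀ x, 𝒢.curvature IG IM D V W ν x + 𝒢.basicForm IG IM D ζ ν V W x = 0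

/-- A strict covariant adjustment: a covariant adjustment with
`(d^∇ ζ)_{abc} - 3 ζ_{ad} ρ^d_β ζ^β_{bc} = 0` (as components of a `3`-form); the second term is
the cyclic sum of `ζ(V₁, ρ(ζ(V₂, V₃)))`. -/
structure IsStrictCovariantAdjustment (𝒢 : Gpd G M)
    (D : ∀ g : G, Submodule ℝ (TangentSpace IG g)) (ζ : Bilin IG IM 𝒢) : Prop
    extends IsCovariantAdjustment IG IM 𝒢 D ζ where
  strict : ∀ V₁ V₂ V₃, IsSmoothVF IM V₁ → IsSmoothVF IM V₂ → IsSmoothVF IM V₃ → ∀ x,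
    𝒢.extDeriv IG IM D ζ V₁ V₂ V₃ x
      = 𝒢.evalForm IG IM ζ V₁ (𝒢.anchor IG IM (𝒢.evalForm IG IM ζ V₂ V₃)) x
      + 𝒢.evalForm IG IM ζ V₂ (𝒢.anchor IG IM (𝒢.evalForm IG IM ζ V₃ V₁)) x
      + 𝒢.evalForm IG IM ζ V₃ (𝒢.anchor IG IM (𝒢.evalForm IG IM ζ V₁ V₂)) x

/-- An adjustment is flat if the induced connection on the Lie algebroid is flat. -/
def IsFlat (𝒢 : Gpd G M) (D : ∀ g : G, Submodule ℝ (TangentSpace IG g)) : Prop :=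
  ∀ V W ν, IsSmoothVF IM V → IsSmoothVF IM W → 𝒢.IsSection IG IM ν →
    ∀ x, 𝒢.curvature IG IM D V W ν x = 0

end Connection
end Smooth

/-! ### The pair groupoid and the groupoid `H × Pair(M)` -/

/-- The pair groupoid `M × M ⇉ M`. -/
@[simps]
def pair (M : Type*) : Gpd (M × M) M where
  src g := g.2
  tgt g := g.1
  unit x := (x, x)
  mul g h _ := (g.1, h.2)
  inv g := (g.2, g.1)
  src_unit _ := rfl
  tgt_unit _ := rfl
  src_mul _ _ _ := rfl
  tgt_mul _ _ _ := rfl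
  src_inv _ := rfl
  tgt_inv _ := rfl
  unit_mul _ _ := rfl
  mul_unit _ _ := rfl
  mul_inv _ _ := rfl
  inv_mul _ _ := rfl
  mul_assoc _ _ _ _ _ _ _ := rfl

/-- The product of a group `H` (a groupoid over a point) with the pair groupoid of `M`. -/
@[simps]
def groupProdPair (H M : Type*) [Group H] : Gpd (H × M × M) M where
  src g := g.2.2
  tgt g := g.2.1
  unit x := (1, x, x)
  mul g h _ := (g.1 * h.1, g.2.1, h.2.2)
  inv g := (g.1⁻¹, g.2.2, g.2.1)
  src_unit _ := rfl
  tgt_unit _ := rfl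
  src_mul _ _ _ := rfl
  tgt_mul _ _ _ := rfl
  src_inv _ := rfl
  tgt_inv _ := rfl
  unit_mul _ _ := by simp
  mul_unit _ _ := by simp
  mul_inv _ _ := by simp
  inv_mul _ _ := by simp
  mul_assoc _ _ _ _ _ _ _ := by simp [_root_.mul_assoc]

/-! ### Actions and action groupoids -/

/-- A right action of a groupoid `G ⇉ M` on `N` along `ψ : N → M`. -/
structure RightAction {G M : Type*} (𝒢 : Gpd G M) (N : Type*) where
  ψ : N → M
  act : ∀ (n : N) (g : G), ψ n = 𝒢.tgt g → N
  ψ_act : ∀ n g c, ψ (act n g c) = 𝒢.src g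
  act_unit : ∀ n c, act n (𝒢.unit (ψ n)) c = n
  act_act : ∀ n g h c₁ c₂ c₃ c₄, act (act n g c₁) h c₂ = act n (𝒢.mul g h c₃) c₄

/-- The arrows of the action groupoid: the elements `(n, g)` of the fibre product `N ×_M G`. -/
@[ext]
structure ActionArrows {G M N : Type*} {𝒢 : Gpd G M} (A : 𝒢.RightAction N) where
  obj : N
  arrow : G
  compat : A.ψ obj = 𝒢.tgt arrow

/-- The action groupoid `N ×_M G ⇉ N`. -/
def actionGroupoid {G M N : Type*} {𝒢 : Gpd G M} (A : 𝒢.RightAction N) :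
    Gpd (ActionArrows A) N where
  src k := A.act k.obj k.arrow k.compat
  tgt k := k.obj
  unit n := ⟨n, 𝒢.unit (A.ψ n), (𝒢.tgt_unit _).symm⟩
  mul k l c := ⟨k.obj, 𝒢.mul k.arrow l.arrow (by rw [← l.compat, ← c, A.ψ_act]),
    by rw [k.compat, 𝒢.tgt_mul]⟩
  inv k := ⟨A.act k.obj k.arrow k.compat, 𝒢.inv k.arrow, by rw [A.ψ_act, 𝒢.tgt_inv]⟩
  src_unit n := A.act_unit n _
  tgt_unit _ := rfl
  src_mul := by
    rintro ⟨n, g, hg⟩ ⟨m, h, hh⟩ c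
    dsimp at c
    subst c
    exact (A.act_act ..).symm
  tgt_mul _ _ _ := rfl
  src_inv := by
    rintro ⟨n, g, hg⟩
    dsimp only at hg ⊢
    rw [A.act_act _ _ _ _ _ (𝒢.tgt_inv g).symm (by rw [𝒢.tgt_mul, hg])]
    simp only [𝒢.mul_inv, ← hg]
    exact A.act_unit n _
  tgt_inv _ := rfl
  unit_mul := by
    rintro ⟨n, g, hg⟩ c
    refine ActionArrows.ext rfl ?_
    dsimp only at hg ⊢
    simp only [hg, 𝒢.unit_mul]
  mul_unit := by
    rintro ⟨n, g, hg⟩ c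
    refine ActionArrows.ext rfl ?_
    dsimp only at hg ⊢
    simp only [A.ψ_act, 𝒢.mul_unit]
  mul_inv := by
    rintro ⟨n, g, hg⟩ c
    refine ActionArrows.ext rfl ?_
    dsimp only at hg ⊢
    simp only [𝒢.mul_inv, hg]
  inv_mul := by
    rintro ⟨n, g, hg⟩ c
    refine ActionArrows.ext rfl ?_
    dsimp only at hg ⊢
    simp only [𝒢.inv_mul, A.ψ_act]
  mul_assoc := by
    intro k l m c₁ c₂ c₃ c₄
    exact ActionArrows.ext rfl (𝒢.mul_assoc ..)

end Gpd

/-! ### Manifolds glued from local homeomorphisms -/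

section Cover

variable {E H₀ N Q : Type*} [NormedAddCommGroup E] [NormedSpace ℝ E] [TopologicalSpace H₀]
  [TopologicalSpace N] [ChartedSpace H₀ N] [TopologicalSpace Q]

/-- The atlas on `Q` obtained from a covering family `C` of local homeomorphisms to a manifold
`N`, by composing the members of `C` with the charts of `N`. -/
@[reducible]
def coverChartedSpace (H₀ : Type*) [TopologicalSpace H₀] [ChartedSpace H₀ N]
    (C : Set (OpenPartialHomeomorph Q N)) (hC : ∀ q, ∃ c ∈ C, q ∈ c.source) :
    ChartedSpace H₀ Q :=
  letI : ChartedSpace N Q :=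
    { atlas := C
      chartAt := fun q => (hC q).choose
      mem_chart_source := fun q => (hC q).choose_spec.2
      chart_mem_atlas := fun q => (hC q).choose_spec.1 }
  ChartedSpace.comp H₀ N Q

theorem coverIsManifold (I : ModelWithCorners ℝ E H₀) [IsManifold I ∞ N]
    (C : Set (OpenPartialHomeomorph Q N)) (hC : ∀ q, ∃ c ∈ C, q ∈ c.source)
    (h : ∀ c ∈ C, ∀ c' ∈ C, ContMDiffOn I I ∞ (c.symm ≫ₕ c') (c.symm ≫ₕ c').source) :
    @IsManifold ℝ _ E _ _ H₀ _ I ∞ Q _ (coverChartedSpace H₀ C hC) := by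
  let _ := coverChartedSpace H₀ C hC
  refine isManifold_of_contDiffOn I ∞ Q ?_
  rintro _ _ ⟨c, hc, a, ha, rfl⟩ ⟨c', hc', a', ha', rfl⟩
  rw [← contMDiffOn_iff_contDiffOn]
  have h1 : ContMDiffOn 𝓘(ℝ, E) I ∞ I.symm (Set.range I) := I.contMDiffOn_symm
  have h2 := contMDiffOn_symm_of_mem_maximalAtlas (I := I) (n := ∞)
    (IsManifold.subset_maximalAtlas ha)
  have h3 := h c hc c' hc'
  have h4 := contMDiffOn_of_mem_maximalAtlas (I := I) (n := ∞)
    (IsManifold.subset_maximalAtlas ha')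
  have h5 : ContMDiff I 𝓘(ℝ, E) ∞ I := I.contMDiff
  have key := (h5.comp_contMDiffOn (h4.comp' (h3.comp' h2))).comp' h1
  refine key.mono ?_
  rintro x ⟨hx, hxr⟩
  simp only [Set.mem_preimage, OpenPartialHomeomorph.trans_source,
    OpenPartialHomeomorph.symm_source, OpenPartialHomeomorph.trans_symm_eq_symm_trans_symm,
    OpenPartialHomeomorph.coe_trans, Set.mem_inter_iff, Function.comp_apply] at hx ⊢
  tauto

theorem contMDiffOn_of_mem_cover (I : ModelWithCorners ℝ E H₀) [IsManifold I ∞ N]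
    (C : Set (OpenPartialHomeomorph Q N)) (hC : ∀ q, ∃ c ∈ C, q ∈ c.source)
    (h : ∀ c ∈ C, ∀ c' ∈ C, ContMDiffOn I I ∞ (c.symm ≫ₕ c') (c.symm ≫ₕ c').source)
    (c : OpenPartialHomeomorph Q N) (hc : c ∈ C) :
    letI := coverChartedSpace H₀ C hC
    ContMDiffOn I I ∞ c c.source := by
  let _ := coverChartedSpace H₀ C hC
  have := coverIsManifold I C hC h
  intro q hq
  refine ContMDiffAt.contMDiffWithinAt ?_
  have hmem : (c ≫ₕ chartAt H₀ (c q)) ∈ IsManifold.maximalAtlas I ∞ Q :=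
    IsManifold.subset_maximalAtlas ⟨c, hc, _, chart_mem_atlas H₀ _, rfl⟩
  have h1 := contMDiffOn_of_mem_maximalAtlas (I := I) (n := ∞) hmem
  have h2 := contMDiffOn_symm_of_mem_maximalAtlas (I := I) (n := ∞)
    (IsManifold.chart_mem_maximalAtlas (I := I) (n := ∞) (c q))
  have h3 := h2.comp' h1
  have hs : (c ≫ₕ chartAt H₀ (c q)).source ∩
      (c ≫ₕ chartAt H₀ (c q)) ⁻¹' (chartAt H₀ (c q)).target ∈ nhds q := by
    refine Filter.inter_mem ?_ ?_
    · exact (c ≫ₕ chartAt H₀ (c q)).open_source.mem_nhds (by simp [hq])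
    · refine ((c ≫ₕ chartAt H₀ (c q)).continuousAt (by simp [hq])).preimage_mem_nhds ?_
      exact (chartAt H₀ (c q)).open_target.mem_nhds (by simp)
  refine (h3.contMDiffAt hs).congr_of_eventuallyEq ?_
  filter_upwards [hs] with y hy
  simp only [OpenPartialHomeomorph.trans_source, Set.mem_inter_iff, Set.mem_preimage] at hy
  simp [hy.1.2]

end Cover

/-! ### Principal bundles and associated bundles -/

section Bundles

variable {EM EP EH EF M P H F : Type*}
  [NormedAddCommGroup EM] [NormedSpace ℝ EM] [NormedAddCommGroup EP] [NormedSpace ℝ EP]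
  [NormedAddCommGroup EH] [NormedSpace ℝ EH] [NormedAddCommGroup EF] [NormedSpace ℝ EF]
  [TopologicalSpace M] [ChartedSpace EM M] [TopologicalSpace P] [ChartedSpace EP P]
  [TopologicalSpace H] [ChartedSpace EH H] [Group H] [TopologicalSpace F] [ChartedSpace EF F]

variable (EH EF H F) in
/-- A smooth right action of a Lie group `H` on a manifold `F`. -/
structure SmoothRightAction where
  act : F → H → F
  act_one : ∀ f, act f 1 = f
  act_mul : ∀ f h k, act f (h * k) = act (act f h) k
  smooth : ContMDiff (𝓘(ℝ, EF).prod 𝓘(ℝ, EH)) 𝓘(ℝ, EF) ∞ (fun x : F × H => act x.1 x.2)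

/-- `e` is a local trivialization over `U ⊆ M` of the map `π : P → M`, equivariant for a right
action of `H` on `P`. -/
structure IsLocalTrivialization (act : P → H → P) (π : P → M) (U : Set M)
    (e : OpenPartialHomeomorph P (M × H)) : Prop where
  source_eq : e.source = π ⁻¹' U
  target_eq : e.target = U ×ˢ Set.univ
  smooth : ContMDiffOn 𝓘(ℝ, EP) (𝓘(ℝ, EM).prod 𝓘(ℝ, EH)) ∞ e e.source
  smooth_symm : ContMDiffOn (𝓘(ℝ, EM).prod 𝓘(ℝ, EH)) 𝓘(ℝ, EP) ∞ e.symm e.target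
  fst_eq : ∀ p ∈ e.source, (e p).1 = π p
  equivariant : ∀ p ∈ e.source, ∀ h, e (act p h) = ((e p).1, (e p).2 * h)

theorem IsLocalTrivialization.isOpen_base {act : P → H → P} {π : P → M} {U : Set M}
    {e : OpenPartialHomeomorph P (M × H)}
    (he : IsLocalTrivialization (EM := EM) (EP := EP) (EH := EH) act π U e) : IsOpen U := by
  have h : IsOpen (U ×ˢ (Set.univ : Set H)) := by rw [← he.target_eq]; exact e.open_target
  have hU : U = (fun x : M => (x, (1 : H))) ⁻¹' (U ×ˢ (Set.univ : Set H)) := by ext; simp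
  rw [hU]
  exact h.preimage (by fun_prop)

variable (EM EP EH M P H) in
/-- A principal `H`-bundle `P → M`. -/
structure PrincipalBundle extends SmoothRightAction EH EP H P where
  proj : P → M
  smooth_proj : ContMDiff 𝓘(ℝ, EP) 𝓘(ℝ, EM) ∞ proj
  proj_act : ∀ p h, proj (act p h) = proj p
  exists_trivialization : ∀ x : M, ∃ U : Set M, x ∈ U ∧
    ∃ e : OpenPartialHomeomorph P (M × H), IsLocalTrivialization (EM := EM) (EP := EP)
      (EH := EH) act proj U e

namespace PrincipalBundle

variable (B : PrincipalBundle EM EP EH M P H) (R : SmoothRightAction EH EF H F)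

theorem exists_act {p q : P} (hpq : B.proj p = B.proj q) : ∃ h, B.act p h = q := by
  obtain ⟨U, hU, e, he⟩ := B.exists_trivialization (B.proj p)
  have hp : p ∈ e.source := by rw [he.source_eq]; exact hU
  have hq : q ∈ e.source := by rw [he.source_eq, Set.mem_preimage, ← hpq]; exact hU
  refine ⟨(e p).2⁻¹ * (e q).2, e.injOn ?_ hq ?_⟩
  · rw [he.source_eq, Set.mem_preimage, B.proj_act]; exact hU
  · rw [he.equivariant p hp]
    ext
    · simp [he.fst_eq, hp, hq, hpq]
    · simp

theorem act_injective (p : P) : Function.Injective (B.act p) := by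
  intro h k hk
  obtain ⟨U, hU, e, he⟩ := B.exists_trivialization (B.proj p)
  have hp : p ∈ e.source := by rw [he.source_eq]; exact hU
  have h1 := he.equivariant p hp h
  rw [hk, he.equivariant p hp k] at h1
  exact (mul_left_cancel (Prod.ext_iff.1 h1).2).symm

theorem proj_surjective : Function.Surjective B.proj := by
  intro x
  obtain ⟨U, hU, e, he⟩ := B.exists_trivialization x
  have ht : (x, (1 : H)) ∈ e.target := by rw [he.target_eq]; exact ⟨hU, trivial⟩
  refine ⟨e.symm (x, 1), ?_⟩
  rw [← he.fst_eq _ (e.map_target ht), e.right_inv ht]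

/-- The diagonal action of `H` on `P × F`. -/
def assocSetoid : Setoid (P × F) where
  r x y := ∃ h, y = (B.act x.1 h, R.act x.2 h)
  iseqv :=
    { refl := fun x => ⟨1, by simp [B.act_one, R.act_one]⟩
      symm := by
        rintro x _ ⟨h, rfl⟩
        exact ⟨h⁻¹, by simp [← B.act_mul, ← R.act_mul, B.act_one, R.act_one]⟩
      trans := by
        rintro x _ _ ⟨h, rfl⟩ ⟨k, rfl⟩
        exact ⟨h * k, by simp [B.act_mul, R.act_mul]⟩ }

/-- The associated bundle `(P × F) / H`, with the quotient topology. -/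
def Assoc : Type _ := Quotient (B.assocSetoid R)

instance : TopologicalSpace (B.Assoc R) :=
  inferInstanceAs (TopologicalSpace (Quotient (B.assocSetoid R)))

/-- The class `[p, f]`. -/
def cls (p : P) (f : F) : B.Assoc R := Quotient.mk (B.assocSetoid R) (p, f)

variable {R}

theorem cls_eq_cls {p q : P} {f f' : F} :
    B.cls R p f = B.cls R q f' ↔ ∃ h, q = B.act p h ∧ f' = R.act f h := by
  refine Quotient.eq.trans ?_
  change (∃ h, (q, f') = _) ↔ _
  simp

theorem cls_act (p : P) (f : F) (h : H) : B.cls R (B.act p h) (R.act f h) = B.cls R p f :=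
  (B.cls_eq_cls.2 ⟨h, rfl, rfl⟩).symm

theorem cls_surj (a : B.Assoc R) : ∃ p f, a = B.cls R p f := by
  obtain ⟨⟨p, f⟩, h⟩ := Quotient.exists_rep a
  exact ⟨p, f, h.symm⟩

/-- The projection `(P × F) / H → M`. -/
def assocProj (a : B.Assoc R) : M :=
  Quotient.lift (fun x : P × F => B.proj x.1)
    (by rintro x _ ⟨h, rfl⟩; exact (B.proj_act _ _).symm) a

@[simp] theorem assocProj_cls (p : P) (f : F) : B.assocProj (B.cls R p f) = B.proj p := rfl

theorem continuous_cls : Continuous (fun x : P × F => B.cls R x.1 x.2) := continuous_quotient_mk'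

theorem continuous_assocProj : Continuous (B.assocProj (R := R)) :=
  Continuous.quotient_lift (B.smooth_proj.continuous.comp continuous_fst) _

theorem isOpenMap_cls : IsOpenMap (fun x : P × F => B.cls R x.1 x.2) := by
  intro s hs
  refine isOpen_coinduced.2 ?_
  have : (Quotient.mk (B.assocSetoid R)) ⁻¹' ((fun x : P × F => B.cls R x.1 x.2) '' s)
      = ⋃ h : H, (fun x : P × F => (B.act x.1 h, R.act x.2 h)) ⁻¹' s := by
    ext x
    simp only [Set.mem_preimage, Set.mem_iUnion]
    constructor
    · rintro ⟨y, hy, hyx⟩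
      obtain ⟨h, h1, h2⟩ := B.cls_eq_cls.1 (show B.cls R x.1 x.2 = B.cls R y.1 y.2 from hyx.symm)
      exact ⟨h, by rw [← h1, ← h2]; exact hy⟩
    · rintro ⟨h, hh⟩
      exact ⟨_, hh, B.cls_act _ _ _⟩
  refine Eq.mpr (congrArg IsOpen this) (isOpen_iUnion fun h => hs.preimage ?_)
  have hP : Continuous fun p : P => B.act p h :=
    B.smooth.continuous.comp (continuous_id.prodMk continuous_const)
  have hF : Continuous fun f : F => R.act f h :=
    R.smooth.continuous.comp (continuous_id.prodMk continuous_const)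
  exact (hP.comp continuous_fst).prodMk (hF.comp continuous_snd)

theorem map_nhds_cls (p : P) (f : F) :
    Filter.map (fun x : P × F => B.cls R x.1 x.2) (𝓝 (p, f)) = 𝓝 (B.cls R p f) :=
  B.isOpenMap_cls.map_nhds_eq B.continuous_cls.continuousAt

variable (R) in
/-- The local trivialization `[p, f] ↦ (π(p), f · h⁻¹)`, where `e p = (π(p), h)`, on all of the
associated bundle. -/
def assocTrivFun (e : OpenPartialHomeomorph P (M × H)) (a : B.Assoc R) : M × F :=
  (B.assocProj a, R.act (Quotient.out a).2 (e (Quotient.out a).1).2⁻¹)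

theorem assocTrivFun_cls {U : Set M} {e : OpenPartialHomeomorph P (M × H)}
    (he : IsLocalTrivialization (EM := EM) (EP := EP) (EH := EH) B.act B.proj U e)
    {p : P} (hp : B.proj p ∈ U) (f : F) :
    B.assocTrivFun R e (B.cls R p f) = (B.proj p, R.act f (e p).2⁻¹) := by
  have hout : B.cls R (Quotient.out (B.cls R p f)).1 (Quotient.out (B.cls R p f)).2
      = B.cls R p f := Quotient.out_eq (B.cls R p f)
  obtain ⟨h, h1, h2⟩ := B.cls_eq_cls.1 hout.symm
  have hs : p ∈ e.source := by rw [he.source_eq]; exact hp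
  simp only [assocTrivFun, assocProj_cls, h1, h2, he.equivariant p hs]
  rw [← R.act_mul]
  simp

variable [LieGroup 𝓘(ℝ, EH) ∞ H]

variable (R) in
/-- The local trivialization of the associated bundle induced by a local trivialization of the
principal bundle. -/
def assocTriv {U : Set M} {e : OpenPartialHomeomorph P (M × H)}
    (he : IsLocalTrivialization (EM := EM) (EP := EP) (EH := EH) B.act B.proj U e) :
    OpenPartialHomeomorph (B.Assoc R) (M × F) where
  toFun := B.assocTrivFun R e
  invFun y := B.cls R (e.symm (y.1, 1)) y.2
  source := B.assocProj ⁻¹' U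
  target := U ×ˢ Set.univ
  map_source' _ ha := ⟨ha, trivial⟩
  map_target' y hy := by
    have ht : (y.1, (1 : H)) ∈ e.target := by rw [he.target_eq]; exact ⟨hy.1, trivial⟩
    have := e.map_target ht
    rwa [he.source_eq] at this
  left_inv' a ha := by
    obtain ⟨p, f, rfl⟩ := B.cls_surj a
    have hp : p ∈ e.source := by rw [he.source_eq]; exact ha
    rw [B.assocTrivFun_cls he ha, B.cls_eq_cls]
    have ht : (B.proj p, (1 : H)) ∈ e.target := by rw [he.target_eq]; exact ⟨ha, trivial⟩
    refine ⟨(e p).2, e.injOn hp ?_ ?_, ?_⟩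
    · rw [he.source_eq, Set.mem_preimage, B.proj_act]
      have := e.map_target ht
      rwa [he.source_eq] at this
    · rw [he.equivariant _ (e.map_target ht), e.right_inv ht]
      ext <;> simp [he.fst_eq p hp]
    · rw [← R.act_mul]; simp [R.act_one]
  right_inv' y hy := by
    have ht : (y.1, (1 : H)) ∈ e.target := by rw [he.target_eq]; exact ⟨hy.1, trivial⟩
    have hs := e.map_target ht
    have hp : B.proj (e.symm (y.1, 1)) = y.1 := by
      rw [← he.fst_eq _ hs, e.right_inv ht]
    rw [B.assocTrivFun_cls he (by rw [hp]; exact hy.1), e.right_inv ht, hp]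
    simp [R.act_one]
  open_source := he.isOpen_base.preimage B.continuous_assocProj
  open_target := he.isOpen_base.prod isOpen_univ
  continuousOn_toFun := by
    intro a ha
    obtain ⟨p, f, rfl⟩ := B.cls_surj a
    refine ContinuousAt.continuousWithinAt ?_
    have hp : p ∈ e.source := by rw [he.source_eq]; exact ha
    rw [ContinuousAt, ← B.map_nhds_cls p f, Filter.tendsto_map'_iff,
      B.assocTrivFun_cls he ha]
    have hev : ∀ᶠ x : P × F in 𝓝 (p, f), x.1 ∈ e.source :=
      continuous_fst.continuousAt.eventually (e.open_source.mem_nhds hp)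
    have hc : ContinuousAt (fun x : P × F => (B.proj x.1, R.act x.2 (e x.1).2⁻¹)) (p, f) := by
      have he1 : ContinuousAt (fun x : P × F => (e x.1).2⁻¹) (p, f) :=
        ((contMDiff_inv 𝓘(ℝ, EH) ∞ (G := H)).continuous.comp continuous_snd).continuousAt.comp
          ((e.continuousAt hp).comp continuous_fst.continuousAt)
      refine ContinuousAt.prodMk (B.smooth_proj.continuous.comp continuous_fst).continuousAt ?_
      exact R.smooth.continuous.continuousAt.comp
        (continuous_snd.continuousAt.prodMk he1)
    refine hc.tendsto.congr' ?_
    filter_upwards [hev] with x hx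
    exact (B.assocTrivFun_cls he (by rw [he.source_eq] at hx; exact hx) _).symm
  continuousOn_invFun := by
    refine B.continuous_cls.comp_continuousOn (ContinuousOn.prodMk ?_ continuousOn_snd)
    refine e.continuousOn_symm.comp (by fun_prop) ?_
    intro y hy
    rw [he.target_eq]
    exact ⟨hy.1, trivial⟩

variable (R) in
/-- The local trivializations of the associated bundle. -/
def assocCover : Set (OpenPartialHomeomorph (B.Assoc R) (M × F)) :=
  {c | ∃ (U : Set M) (e : OpenPartialHomeomorph P (M × H))
    (he : IsLocalTrivialization (EM := EM) (EP := EP) (EH := EH) B.act B.proj U e),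
    c = B.assocTriv R he}

variable (R) in
theorem exists_mem_assocCover (a : B.Assoc R) : ∃ c ∈ B.assocCover R, a ∈ c.source := by
  obtain ⟨U, hU, e, he⟩ := B.exists_trivialization (B.assocProj a)
  exact ⟨_, ⟨U, e, he, rfl⟩, hU⟩

/-- The manifold structure of the associated bundle. -/
instance : ChartedSpace (ModelProd EM EF) (B.Assoc R) :=
  coverChartedSpace (ModelProd EM EF) (B.assocCover R) (B.exists_mem_assocCover R)

theorem assocCover_transition (c : OpenPartialHomeomorph (B.Assoc R) (M × F))
    (hc : c ∈ B.assocCover R) (c' : OpenPartialHomeomorph (B.Assoc R) (M × F))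
    (hc' : c' ∈ B.assocCover R) :
    ContMDiffOn (𝓘(ℝ, EM).prod 𝓘(ℝ, EF)) (𝓘(ℝ, EM).prod 𝓘(ℝ, EF)) ∞ (c.symm ≫ₕ c')
      (c.symm ≫ₕ c').source := by
  obtain ⟨U, e, he, rfl⟩ := hc
  obtain ⟨U', e', he', rfl⟩ := hc'
  have hkey : ∀ y ∈ ((B.assocTriv R he).symm ≫ₕ B.assocTriv R he').source,
      y.1 ∈ U ∧ (y.1, (1 : H)) ∈ e.target ∧ e.symm (y.1, 1) ∈ e'.source ∧
        B.proj (e.symm (y.1, 1)) = y.1 := by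
    rintro y ⟨hy, hy'⟩
    have ht : (y.1, (1 : H)) ∈ e.target := by rw [he.target_eq]; exact ⟨hy.1, trivial⟩
    refine ⟨hy.1, ht, ?_, ?_⟩
    · rw [he'.source_eq]; exact hy'
    · rw [← he.fst_eq _ (e.map_target ht), e.right_inv ht]
  have h1 : ContMDiffOn (𝓘(ℝ, EM).prod 𝓘(ℝ, EF)) 𝓘(ℝ, EP) ∞
      (fun y : M × F => e.symm (y.1, 1)) ((B.assocTriv R he).symm ≫ₕ B.assocTriv R he').source :=
    he.smooth_symm.comp
      (ContMDiff.contMDiffOn (contMDiff_fst.prodMk contMDiff_const)) fun y hy => (hkey y hy).2.1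
  have h2 : ContMDiffOn (𝓘(ℝ, EM).prod 𝓘(ℝ, EF)) 𝓘(ℝ, EH) ∞
      (fun y : M × F => (e' (e.symm (y.1, 1))).2⁻¹)
      ((B.assocTriv R he).symm ≫ₕ B.assocTriv R he').source :=
    ((contMDiff_inv 𝓘(ℝ, EH) ∞ (G := H)).comp contMDiff_snd).comp_contMDiffOn
      (he'.smooth.comp h1 fun y hy => (hkey y hy).2.2.1)
  have h3 : ContMDiffOn (𝓘(ℝ, EM).prod 𝓘(ℝ, EF)) 𝓘(ℝ, EF) ∞
      (fun y : M × F => R.act y.2 (e' (e.symm (y.1, 1))).2⁻¹)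
      ((B.assocTriv R he).symm ≫ₕ B.assocTriv R he').source :=
    R.smooth.comp_contMDiffOn (contMDiffOn_snd.prodMk h2)
  refine (contMDiffOn_fst.prodMk h3).congr fun y hy => ?_
  obtain ⟨-, -, k3, k4⟩ := hkey y hy
  change B.assocTrivFun R e' (B.cls R (e.symm (y.1, 1)) y.2) = _
  rw [B.assocTrivFun_cls he' (by rw [he'.source_eq] at k3; exact k3), k4]

variable [IsManifold 𝓘(ℝ, EM) ∞ M] [IsManifold 𝓘(ℝ, EF) ∞ F]

instance : IsManifold (𝓘(ℝ, EM).prod 𝓘(ℝ, EF)) ∞ (B.Assoc R) :=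
  coverIsManifold _ (B.assocCover R) (B.exists_mem_assocCover R) B.assocCover_transition

theorem contMDiffOn_assocTriv {U : Set M} {e : OpenPartialHomeomorph P (M × H)}
    (he : IsLocalTrivialization (EM := EM) (EP := EP) (EH := EH) B.act B.proj U e) :
    ContMDiffOn (𝓘(ℝ, EM).prod 𝓘(ℝ, EF)) (𝓘(ℝ, EM).prod 𝓘(ℝ, EF)) ∞ (B.assocTriv R he)
      (B.assocProj ⁻¹' U) :=
  contMDiffOn_of_mem_cover _ (B.assocCover R) (B.exists_mem_assocCover R)
    B.assocCover_transition _ ⟨U, e, he, rfl⟩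

theorem contMDiff_assocProj :
    ContMDiff (𝓘(ℝ, EM).prod 𝓘(ℝ, EF)) 𝓘(ℝ, EM) ∞ (B.assocProj (R := R)) := by
  intro a
  obtain ⟨U, hU, e, he⟩ := B.exists_trivialization (B.assocProj a)
  have h := contMDiff_fst.comp_contMDiffOn (B.contMDiffOn_assocTriv (R := R) he)
  exact h.contMDiffAt ((B.assocTriv R he).open_source.mem_nhds hU)

end PrincipalBundle

/-! ### The Atiyah groupoid and its action on associated bundles -/

namespace PrincipalBundle

variable (B : PrincipalBundle EM EP EH M P H) (R : SmoothRightAction EH EF H F)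

/-- The total space `(P × P) / H` of the Atiyah groupoid. -/
abbrev AtiyahArrows : Type _ := B.Assoc B.toSmoothRightAction

/-- The class `[p, q]`. -/
abbrev pairCls (p q : P) : B.AtiyahArrows := B.cls B.toSmoothRightAction p q

theorem pairCls_eq {p q p' q' : P} :
    B.pairCls p q = B.pairCls p' q' ↔ ∃ h, p' = B.act p h ∧ q' = B.act q h := B.cls_eq_cls

theorem atiyahSrc_aux (x y : P × P) (h : (B.assocSetoid B.toSmoothRightAction).r x y) :
    B.proj x.2 = B.proj y.2 := by
  obtain ⟨h, rfl⟩ := h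
  exact (B.proj_act _ _).symm

/-- The source `[p, q] ↦ π(q)` of the Atiyah groupoid. -/
def atiyahSrc (g : B.AtiyahArrows) : M :=
  Quotient.lift (fun x : P × P => B.proj x.2) B.atiyahSrc_aux g

@[simp] theorem atiyahSrc_cls (p q : P) : B.atiyahSrc (B.pairCls p q) = B.proj q := rfl

/-- Composable arrows are of the form `[p, q]`, `[q, r]`. -/
theorem exists_comp {g h : B.AtiyahArrows} (c : B.atiyahSrc g = B.assocProj h) :
    ∃ k : B.AtiyahArrows, ∃ p q r, g = B.pairCls p q ∧ h = B.pairCls q r ∧ k = B.pairCls p r := by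
  obtain ⟨p, q, rfl⟩ := B.cls_surj g
  obtain ⟨q', r, rfl⟩ := B.cls_surj h
  obtain ⟨a, rfl⟩ := B.exists_act (p := q') (q := q) c.symm
  exact ⟨_, p, _, B.act r a, rfl, (B.cls_act q' r a).symm, rfl⟩

/-- The composition `[p, q] ∘ [q, r] = [p, r]` of the Atiyah groupoid. -/
def atiyahMul (g h : B.AtiyahArrows) (c : B.atiyahSrc g = B.assocProj h) : B.AtiyahArrows :=
  (B.exists_comp c).choose

theorem atiyahMul_cls (p q r : P) (c : B.atiyahSrc (B.pairCls p q) = B.assocProj (B.pairCls q r)) :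
    B.atiyahMul (B.pairCls p q) (B.pairCls q r) c = B.pairCls p r := by
  obtain ⟨p', q', r', h1, h2, h3⟩ := (B.exists_comp c).choose_spec
  rw [atiyahMul, h3]
  obtain ⟨a, rfl, rfl⟩ := B.pairCls_eq.1 h1
  obtain ⟨b, hb, rfl⟩ := B.pairCls_eq.1 h2
  obtain rfl := B.act_injective _ hb
  exact B.cls_act p r a

/-- The inverse `[p, q]⁻¹ = [q, p]` of the Atiyah groupoid. -/
def atiyahInv (g : B.AtiyahArrows) : B.AtiyahArrows :=
  Quotient.lift (fun x : P × P => B.pairCls x.2 x.1)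
    (by rintro x _ ⟨h, rfl⟩; exact (B.cls_act _ _ _).symm) g

@[simp] theorem atiyahInv_cls (p q : P) : B.atiyahInv (B.pairCls p q) = B.pairCls q p := rfl

/-- The unit `π(p) ↦ [p, p]` of the Atiyah groupoid. -/
def atiyahUnit (x : M) : B.AtiyahArrows :=
  B.pairCls (B.proj_surjective x).choose (B.proj_surjective x).choose

theorem atiyahUnit_proj (p : P) : B.atiyahUnit (B.proj p) = B.pairCls p p := by
  obtain ⟨h, hh⟩ := B.exists_act (B.proj_surjective (B.proj p)).choose_spec
  exact B.pairCls_eq.2 ⟨h, hh.symm, hh.symm⟩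

/-- The Atiyah groupoid `(P × P) / H ⇉ M`. -/
def atiyah : Gpd B.AtiyahArrows M where
  src := B.atiyahSrc
  tgt := B.assocProj
  unit := B.atiyahUnit
  mul := B.atiyahMul
  inv := B.atiyahInv
  src_unit x := (B.proj_surjective x).choose_spec
  tgt_unit x := (B.proj_surjective x).choose_spec
  src_mul := by
    intro g h c
    obtain ⟨-, p, q, r, rfl, rfl, -⟩ := B.exists_comp c
    rw [B.atiyahMul_cls]; rfl
  tgt_mul := by
    intro g h c
    obtain ⟨-, p, q, r, rfl, rfl, -⟩ := B.exists_comp c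
    rw [B.atiyahMul_cls]; rfl
  src_inv := by
    intro g
    obtain ⟨p, q, rfl⟩ := B.cls_surj g
    rfl
  tgt_inv := by
    intro g
    obtain ⟨p, q, rfl⟩ := B.cls_surj g
    rfl
  unit_mul := by
    intro g c
    obtain ⟨p, q, rfl⟩ := B.cls_surj g
    simp only [assocProj_cls, atiyahUnit_proj]
    exact B.atiyahMul_cls p p q _
  mul_unit := by
    intro g c
    obtain ⟨p, q, rfl⟩ := B.cls_surj g
    simp only [atiyahSrc_cls, atiyahUnit_proj]
    exact B.atiyahMul_cls p q q _
  mul_inv := by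
    intro g c
    obtain ⟨p, q, rfl⟩ := B.cls_surj g
    simp only [assocProj_cls, atiyahUnit_proj]
    exact B.atiyahMul_cls p q p _
  inv_mul := by
    intro g c
    obtain ⟨p, q, rfl⟩ := B.cls_surj g
    simp only [atiyahSrc_cls, atiyahUnit_proj]
    exact B.atiyahMul_cls q p q _
  mul_assoc := by
    intro g h k c₁ c₂ c₃ c₄
    obtain ⟨-, p, q, r, rfl, rfl, -⟩ := B.exists_comp c₁
    obtain ⟨r', t', rfl⟩ := B.cls_surj k
    obtain ⟨b, rfl⟩ := B.exists_act (p := r') (q := r) c₃.symm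
    obtain ⟨t, ht⟩ : ∃ t, B.cls B.toSmoothRightAction r' t' = B.pairCls (B.act r' b) t :=
      ⟨_, (B.cls_act r' t' b).symm⟩
    simp only [ht, B.atiyahMul_cls]

variable {R}

theorem exists_assocAct {n : B.Assoc R} {g : B.AtiyahArrows} (c : B.assocProj n = B.assocProj g) :
    ∃ k : B.Assoc R, ∃ p q f, n = B.cls R p f ∧ g = B.pairCls p q ∧ k = B.cls R q f := by
  obtain ⟨p, f, rfl⟩ := B.cls_surj n
  obtain ⟨p', q, rfl⟩ := B.cls_surj g
  obtain ⟨a, rfl⟩ := B.exists_act (p := p') (q := p) c.symm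
  exact ⟨_, _, B.act q a, f, rfl, (B.cls_act p' q a).symm, rfl⟩

/-- The right action `[p, f] ◁ [p, q] = [q, f]` of the Atiyah groupoid on `(P × F) / H`; it is
`n ◁ g = g⁻¹ · n` for the left action `[p, q] · [q, f] = [p, f]`. -/
def assocAct (n : B.Assoc R) (g : B.AtiyahArrows) (c : B.assocProj n = B.assocProj g) :
    B.Assoc R :=
  (B.exists_assocAct c).choose

theorem assocAct_cls (p q : P) (f : F) (c : B.assocProj (B.cls R p f) = B.assocProj (B.pairCls p q)) :
    B.assocAct (B.cls R p f) (B.pairCls p q) c = B.cls R q f := by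
  obtain ⟨p', q', f', h1, h2, h3⟩ := (B.exists_assocAct c).choose_spec
  rw [assocAct, h3]
  obtain ⟨a, rfl, rfl⟩ := B.cls_eq_cls.1 h1
  obtain ⟨b, hb, rfl⟩ := B.pairCls_eq.1 h2
  obtain rfl := B.act_injective _ hb
  exact B.cls_act q f a

variable (R)

/-- The action of the Atiyah groupoid on the associated bundle `(P × F) / H`. -/
def atiyahAction : B.atiyah.RightAction (B.Assoc R) where
  ψ := B.assocProj
  act := B.assocAct
  ψ_act := by
    intro n g c
    obtain ⟨-, p, q, f, rfl, rfl, -⟩ := B.exists_assocAct c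
    exact congrArg B.assocProj (B.assocAct_cls p q f c)
  act_unit := by
    intro n c
    obtain ⟨p, f, rfl⟩ := B.cls_surj n
    simp only [atiyah, assocProj_cls, atiyahUnit_proj]
    exact B.assocAct_cls p p f _
  act_act := by
    intro n g h c₁ c₂ c₃ c₄
    obtain ⟨-, p, q, f, rfl, rfl, -⟩ := B.exists_assocAct c₁
    obtain ⟨r', t', rfl⟩ := B.cls_surj h
    obtain ⟨b, rfl⟩ := B.exists_act (p := r') (q := q) c₃.symm
    obtain ⟨t, ht⟩ : ∃ t, B.cls B.toSmoothRightAction r' t' = B.pairCls (B.act r' b) t :=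
      ⟨_, (B.cls_act r' t' b).symm⟩
    have h1 := B.assocAct_cls p (B.act r' b) f c₁
    have h2 := B.atiyahMul_cls p (B.act r' b) t (by exact ht ▸ c₃)
    simp only [ht, h1, h2, atiyah]
    rw [B.assocAct_cls, B.assocAct_cls]

/-- The action groupoid `𝒦 ⇉ (P × F) / H` of the Atiyah groupoid acting on the associated
bundle. -/
def actionGpd : Gpd (Gpd.ActionArrows (B.atiyahAction R)) (B.Assoc R) :=
  Gpd.actionGroupoid (B.atiyahAction R)

/-- The topology on the arrows of `𝒦` as a subspace of a product. -/
instance : TopologicalSpace (Gpd.ActionArrows (B.atiyahAction R)) :=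
  TopologicalSpace.induced (fun k => (k.obj, k.arrow)) inferInstance

theorem continuous_obj_arrow :
    Continuous (fun k : Gpd.ActionArrows (B.atiyahAction R) => (k.obj, k.arrow)) :=
  continuous_induced_dom

theorem continuous_obj :
    Continuous (fun k : Gpd.ActionArrows (B.atiyahAction R) => k.obj) :=
  continuous_fst.comp (B.continuous_obj_arrow R)

theorem continuous_arrow :
    Continuous (fun k : Gpd.ActionArrows (B.atiyahAction R) => k.arrow) :=
  continuous_snd.comp (B.continuous_obj_arrow R)

theorem assocProj_obj (k : Gpd.ActionArrows (B.atiyahAction R)) :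
    B.assocProj k.obj = B.assocProj k.arrow := k.compat

section ActionManifold

variable [LieGroup 𝓘(ℝ, EH) ∞ H]

theorem assocProj_assocTriv_symm {U : Set M} {e : OpenPartialHomeomorph P (M × H)}
    (he : IsLocalTrivialization (EM := EM) (EP := EP) (EH := EH) B.act B.proj U e)
    {x : M} (hx : x ∈ U) (f : F) : B.assocProj ((B.assocTriv R he).symm (x, f)) = x := by
  have ht : (x, f) ∈ (B.assocTriv R he).target := ⟨hx, trivial⟩
  have := congrArg Prod.fst ((B.assocTriv R he).right_inv ht)
  exact this

open Classical in
/-- The arrow over an arrow `g` of the Atiyah groupoid whose object has the coordinate `f` in a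
local trivialization (and some arrow over `g` outside the domain of the trivialization). -/
def arrowMk {U : Set M} {e : OpenPartialHomeomorph P (M × H)}
    (he : IsLocalTrivialization (EM := EM) (EP := EP) (EH := EH) B.act B.proj U e)
    (y : B.AtiyahArrows × F) : Gpd.ActionArrows (B.atiyahAction R) where
  obj :=
    if B.assocProj y.1 ∈ U then (B.assocTriv R he).symm (B.assocProj y.1, y.2)
    else B.cls R (B.proj_surjective (B.assocProj y.1)).choose y.2
  arrow := y.1
  compat := by
    change B.assocProj _ = B.assocProj y.1
    split_ifs with h
    · exact B.assocProj_assocTriv_symm R he h y.2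
    · exact (B.proj_surjective (B.assocProj y.1)).choose_spec

theorem arrowMk_obj {U : Set M} {e : OpenPartialHomeomorph P (M × H)}
    (he : IsLocalTrivialization (EM := EM) (EP := EP) (EH := EH) B.act B.proj U e)
    {y : B.AtiyahArrows × F} (hy : B.assocProj y.1 ∈ U) :
    (B.arrowMk R he y).obj = (B.assocTriv R he).symm (B.assocProj y.1, y.2) := if_pos hy

/-- The local trivialization of the space of arrows `(n, g)` of `𝒦`, as a bundle with fibre `F`
over the space of arrows `g` of the Atiyah groupoid. -/
def arrowTriv {U : Set M} {e : OpenPartialHomeomorph P (M × H)}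
    (he : IsLocalTrivialization (EM := EM) (EP := EP) (EH := EH) B.act B.proj U e) :
    OpenPartialHomeomorph (Gpd.ActionArrows (B.atiyahAction R)) (B.AtiyahArrows × F) where
  toFun k := (k.arrow, (B.assocTriv R he k.obj).2)
  invFun y := B.arrowMk R he y
  source := {k | B.assocProj k.obj ∈ U}
  target := {y | B.assocProj y.1 ∈ U}
  map_source' k hk := by
    rw [Set.mem_ofPred_eq, ← B.assocProj_obj]; exact hk
  map_target' y hy := by
    rw [Set.mem_ofPred_eq, B.assocProj_obj]; exact hy
  left_inv' k hk := by
    have h : B.assocProj k.arrow ∈ U := by rw [← B.assocProj_obj]; exact hk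
    refine Gpd.ActionArrows.ext ?_ rfl
    rw [B.arrowMk_obj R he h]
    dsimp only
    rw [← B.assocProj_obj]
    exact (B.assocTriv R he).left_inv hk
  right_inv' y hy := by
    refine Prod.ext rfl ?_
    dsimp only
    rw [B.arrowMk_obj R he hy]
    exact congrArg Prod.snd ((B.assocTriv R he).right_inv (x := (B.assocProj y.1, y.2))
      ⟨hy, trivial⟩)
  open_source := he.isOpen_base.preimage (B.continuous_assocProj.comp (B.continuous_obj R))
  open_target := he.isOpen_base.preimage (B.continuous_assocProj.comp continuous_fst)
  continuousOn_toFun :=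
    (B.continuous_arrow R).continuousOn.prodMk
      (continuous_snd.comp_continuousOn ((B.assocTriv R he).continuousOn.comp
        (B.continuous_obj R).continuousOn fun k hk => hk))
  continuousOn_invFun := by
    have h1 : ContinuousOn (fun y : B.AtiyahArrows × F =>
        ((B.assocTriv R he).symm (B.assocProj y.1, y.2), y.1)) {y | B.assocProj y.1 ∈ U} := by
      refine ContinuousOn.prodMk ((B.assocTriv R he).continuousOn_symm.comp
        ((B.continuous_assocProj.comp continuous_fst).prodMk continuous_snd).continuousOn ?_)
        continuousOn_fst
      exact fun y hy => ⟨hy, trivial⟩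
    have hi : Topology.IsInducing
        (fun k : Gpd.ActionArrows (B.atiyahAction R) => (k.obj, k.arrow)) := ⟨rfl⟩
    rw [hi.continuousOn_iff]
    refine h1.congr fun y hy => ?_
    rw [Function.comp_apply, B.arrowMk_obj R he hy]
    rfl

/-- The local trivializations of the manifold of arrows of `𝒦`. -/
def arrowCover :
    Set (OpenPartialHomeomorph (Gpd.ActionArrows (B.atiyahAction R)) (B.AtiyahArrows × F)) :=
  {c | ∃ (U : Set M) (e : OpenPartialHomeomorph P (M × H))
    (he : IsLocalTrivialization (EM := EM) (EP := EP) (EH := EH) B.act B.proj U e),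
    c = B.arrowTriv R he}

theorem exists_mem_arrowCover (k : Gpd.ActionArrows (B.atiyahAction R)) :
    ∃ c ∈ B.arrowCover R, k ∈ c.source := by
  obtain ⟨U, hU, e, he⟩ := B.exists_trivialization (B.assocProj k.obj)
  exact ⟨_, ⟨U, e, he, rfl⟩, hU⟩

/-- The manifold structure on the arrows of `𝒦`, that is, on the fibre product
`(P × F) / H ×_M (P × P) / H`. -/
instance : ChartedSpace (ModelProd (ModelProd EM EP) EF) (Gpd.ActionArrows (B.atiyahAction R)) :=
  coverChartedSpace (ModelProd (ModelProd EM EP) EF) (B.arrowCover R) (B.exists_mem_arrowCover R)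

variable [IsManifold 𝓘(ℝ, EM) ∞ M] [IsManifold 𝓘(ℝ, EP) ∞ P]

theorem arrowCover_transition
    (c : OpenPartialHomeomorph (Gpd.ActionArrows (B.atiyahAction R)) (B.AtiyahArrows × F))
    (hc : c ∈ B.arrowCover R)
    (c' : OpenPartialHomeomorph (Gpd.ActionArrows (B.atiyahAction R)) (B.AtiyahArrows × F))
    (hc' : c' ∈ B.arrowCover R) :
    ContMDiffOn ((𝓘(ℝ, EM).prod 𝓘(ℝ, EP)).prod 𝓘(ℝ, EF))
      ((𝓘(ℝ, EM).prod 𝓘(ℝ, EP)).prod 𝓘(ℝ, EF)) ∞ (c.symm ≫ₕ c') (c.symm ≫ₕ c').source := by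
  obtain ⟨U, e, he, rfl⟩ := hc
  obtain ⟨U', e', he', rfl⟩ := hc'
  have htr := B.assocCover_transition (R := R) _ ⟨U, e, he, rfl⟩ _ ⟨U', e', he', rfl⟩
  have hp : ContMDiff ((𝓘(ℝ, EM).prod 𝓘(ℝ, EP)).prod 𝓘(ℝ, EF)) (𝓘(ℝ, EM).prod 𝓘(ℝ, EF)) ∞
      (fun y : B.AtiyahArrows × F => (B.assocProj y.1, y.2)) :=
    (B.contMDiff_assocProj.comp contMDiff_fst).prodMk contMDiff_snd
  have h2 := contMDiff_snd.comp_contMDiffOn (htr.comp hp.contMDiffOn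
    (s := ((B.arrowTriv R he).symm ≫ₕ B.arrowTriv R he').source) ?_)
  · refine (contMDiffOn_fst.prodMk h2).congr fun y hy => ?_
    have h := B.arrowMk_obj R he (y := y) hy.1
    change (y.1, (B.assocTriv R he' (B.arrowMk R he y).obj).2) = _
    rw [h]
    rfl
  · intro y hy
    have h := B.arrowMk_obj R he (y := y) hy.1
    refine ⟨⟨hy.1, trivial⟩, ?_⟩
    have h' : B.assocProj (B.arrowMk R he y).obj ∈ U' := hy.2
    rw [h] at h'
    exact h'

instance [IsManifold 𝓘(ℝ, EF) ∞ F] : IsManifold ((𝓘(ℝ, EM).prod 𝓘(ℝ, EP)).prod 𝓘(ℝ, EF)) ∞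
    (Gpd.ActionArrows (B.atiyahAction R)) :=
  coverIsManifold _ (B.arrowCover R) (B.exists_mem_arrowCover R) (B.arrowCover_transition R)

end ActionManifold

/-! ### Trivializations and the induced splitting -/

/-- `Φ` is a global trivialization of the principal bundle. -/
structure IsTrivialization
    (Φ : P ≃ₘ⟮𝓘(ℝ, EP), 𝓘(ℝ, EM).prod 𝓘(ℝ, EH)⟯ (M × H)) : Prop where
  fst_eq : ∀ p, (Φ p).1 = B.proj p
  equivariant : ∀ p h, Φ (B.act p h) = ((Φ p).1, (Φ p).2 * h)

variable {B} in
theorem IsTrivialization.proj_symm {Φ : P ≃ₘ⟮𝓘(ℝ, EP), 𝓘(ℝ, EM).prod 𝓘(ℝ, EH)⟯ (M × H)}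
    (hΦ : B.IsTrivialization Φ) (y : M × H) : B.proj (Φ.symm y) = y.1 := by
  rw [← hΦ.fst_eq, Φ.apply_symm_apply]

/-- The section `x ↦ [p, f₀]`, with `π(p) = x`, of the associated bundle; it is independent of the
choice of `p` if `f₀ : F` is fixed by `H`. -/
def fixedSection (f₀ : F) (x : M) : B.Assoc R := B.cls R (B.proj_surjective x).choose f₀

/-- The map `(h, m₂, m₁) ↦ ([s(m₂), f₀], [s(m₂) · h, s(m₁)])` from `H × Pair(M)` to the arrows of
`𝒦`, where `s = Φ⁻¹(·, 1)` is the section of `P` corresponding to the trivialization `Φ`. -/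
def splitting (f₀ : F) {Φ : P ≃ₘ⟮𝓘(ℝ, EP), 𝓘(ℝ, EM).prod 𝓘(ℝ, EH)⟯ (M × H)}
    (hΦ : B.IsTrivialization Φ) (a : H × M × M) : Gpd.ActionArrows (B.atiyahAction R) where
  obj := B.fixedSection R f₀ a.2.1
  arrow := B.pairCls (B.act (Φ.symm (a.2.1, 1)) a.1) (Φ.symm (a.2.2, 1))
  compat := by
    change B.proj _ = B.proj _
    rw [(B.proj_surjective a.2.1).choose_spec, B.proj_act, hΦ.proj_symm]

end PrincipalBundle

/-- The right action `f · h = h⁻¹ · f` of a smooth left action, for which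
`(P × F) / H` is the quotient by `(p, f) ∼ (p · h, h⁻¹ · f)`. -/
def SmoothRightAction.ofLeft [LieGroup 𝓘(ℝ, EH) ∞ H] [MulAction H F]
    (hs : ContMDiff (𝓘(ℝ, EH).prod 𝓘(ℝ, EF)) 𝓘(ℝ, EF) ∞ (fun x : H × F => x.1 • x.2)) :
    SmoothRightAction EH EF H F where
  act f h := h⁻¹ • f
  act_one f := by simp
  act_mul f h k := by simp [mul_smul]
  smooth := hs.comp (((contMDiff_inv 𝓘(ℝ, EH) ∞).comp contMDiff_snd).prodMk contMDiff_fst)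

end Bundles

/-! ### Restrictions, and the canonical adjustment on `H × Pair(M)` -/

namespace Gpd

section Restriction

variable {EG HG EM HM EK HK EN HN : Type*} [NormedAddCommGroup EG] [NormedSpace ℝ EG]
  [NormedAddCommGroup EM] [NormedSpace ℝ EM] [TopologicalSpace HG] [TopologicalSpace HM]
  [NormedAddCommGroup EK] [NormedSpace ℝ EK] [TopologicalSpace HK]
  [NormedAddCommGroup EN] [NormedSpace ℝ EN] [TopologicalSpace HN]
  (IG : ModelWithCorners ℝ EG HG) (IM : ModelWithCorners ℝ EM HM)
  (IK : ModelWithCorners ℝ EK HK) (IN : ModelWithCorners ℝ EN HN)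
  {G M K N : Type*} [TopologicalSpace G] [ChartedSpace HG G] [TopologicalSpace M]
  [ChartedSpace HM M] [TopologicalSpace K] [ChartedSpace HK K] [TopologicalSpace N]
  [ChartedSpace HN N]

/-- `f` is an embedding of (finite-dimensional) manifolds: a topological embedding and an
immersion. -/
structure IsEmbeddingOfManifolds (f : G → K) : Prop where
  smooth : ContMDiff IG IK ∞ f
  isEmbedding : Topology.IsEmbedding f
  immersion : ∀ a, Function.Injective (mfderiv IG IK f a)

/-- `(ι, j)` is an isomorphism of Lie groupoids from `𝒢 ⇉ M` onto the restriction `𝒦|_{j(M)}` of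
`𝒦 ⇉ N` to the submanifold `j(M) ⊆ N`, whose arrows are all arrows of `𝒦` with source and target
in `j(M)`. -/
structure IsIsoOntoRestriction (𝒢 : Gpd G M) (𝒦 : Gpd K N) (ι : G → K) (j : M → N) : Prop where
  embedding_base : IsEmbeddingOfManifolds IM IN j
  embedding : IsEmbeddingOfManifolds IG IK ι
  range_eq : Set.range ι = {k | 𝒦.src k ∈ Set.range j ∧ 𝒦.tgt k ∈ Set.range j}
  src_map : ∀ g, 𝒦.src (ι g) = j (𝒢.src g)
  tgt_map : ∀ g, 𝒦.tgt (ι g) = j (𝒢.tgt g)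
  unit_map : ∀ x, ι (𝒢.unit x) = 𝒦.unit (j x)
  mul_map : ∀ g h c c', ι (𝒢.mul g h c) = 𝒦.mul (ι g) (ι h) c'

/-- The distribution `DK` and the form `ζK` on `𝒦` restrict to the distribution `D` and the form
`ζ` on `𝒢` along `(ι, j)`. (As `ι (𝒢.unit x) = 𝒦.unit (j x)`, both sides of the second equation
are in the same tangent space.) -/
structure RestrictsTo (𝒢 : Gpd G M) (𝒦 : Gpd K N) (ι : G → K) (j : M → N)
    (DK : ∀ k : K, Submodule ℝ (TangentSpace IK k)) (ζK : Bilin IK IN 𝒦)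
    (D : ∀ g : G, Submodule ℝ (TangentSpace IG g)) (ζ : Bilin IG IM 𝒢) : Prop where
  distribution : ∀ g, (DK (ι g)).comap (mfderiv IG IK ι g).toLinearMap = D g
  form : ∀ x v w, (ζK (j x) (mfderiv IM IN j x v) (mfderiv IM IN j x w) : EK)
    = (mfderiv IG IK ι (𝒢.unit x) (ζ x v w) : EK)

end Restriction

section Canonical

variable {EM EH M H : Type*} [NormedAddCommGroup EM] [NormedSpace ℝ EM] [NormedAddCommGroup EH]
  [NormedSpace ℝ EH] [TopologicalSpace M] [ChartedSpace EM M] [TopologicalSpace H]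
  [ChartedSpace EH H] [Group H]

variable (EH H) in
/-- The distribution `0 ⊕ D` on `H × Pair(M)`, for a distribution `D` on `Pair(M)`. -/
def canonicalDistribution
    (D : ∀ g : M × M, Submodule ℝ (TangentSpace (𝓘(ℝ, EM).prod 𝓘(ℝ, EM)) g)) (a : H × M × M) :
    Submodule ℝ (TangentSpace (𝓘(ℝ, EH).prod (𝓘(ℝ, EM).prod 𝓘(ℝ, EM))) a) :=
  Submodule.prod (⊥ : Submodule ℝ (TangentSpace 𝓘(ℝ, EH) a.1)) (D a.2)

variable (EH H) in
/-- The form `0 ⊕ ζ` on `M` with values in the Lie algebroid of `H × Pair(M)`, for a form `ζ` with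
values in the Lie algebroid of `Pair(M)`. -/
def canonicalForm (ζ : Bilin (𝓘(ℝ, EM).prod 𝓘(ℝ, EM)) 𝓘(ℝ, EM) (pair M)) :
    Bilin (𝓘(ℝ, EH).prod (𝓘(ℝ, EM).prod 𝓘(ℝ, EM))) 𝓘(ℝ, EM) (groupProdPair H M) := fun x =>
  (ζ x).compr₂ (LinearMap.inr ℝ (TangentSpace 𝓘(ℝ, EH) (1 : H))
    (TangentSpace (𝓘(ℝ, EM).prod 𝓘(ℝ, EM)) (x, x)))

end Canonical

end Gpd

end

/-! A Cartan connection on the pair groupoid is a parallelism of `M`. Being complementary to the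
kernel of the differential of the target, the distribution at `(x, y)` is the graph of a linear map
from `T_x M` to `T_y M`; closure under inverses and products makes these maps invertible and
compatible with composition. Transport from a base point therefore gives a smooth global frame `e`
such that the distribution at `(x, y)` is the set of all `(e x v, e y v)` (`exists_frame`). Let `c`
be its structure functions, `[e v, e w] = e (c v w)`.

In such a frame all the operators become explicit (`nab_eq`, `brk_eq`). Let θ(V) be the coefficients
of a vector field V, and n those of a section ν. Then ∇_V ν has the coefficients c(θ(V), n) + V(n).
The c-terms cancel in the basic connection, so that ∇^bas_ν V has the coefficients ρ(ν)(θ(V)). The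
rest is the Jacobi identity of the frame (`IsFrame.jacobi`): it makes the basic curvature vanish
(`basicCurvature_frame`), and it shows that R_∇(V, W)ν has the coefficients −(∂_n c)(θ(V), θ(W))
(`curvature_frame`). If ζ has the coefficients z, then ∇^bas_ν ζ has the coefficients ∂_n z
(`basicForm_frame`). Hence ζ is a primitive exactly when ∂z = ∂c. The choice z = c solves this, and
for z = c strictness is once more the Jacobi identity (`IsFrame.isStrictPrimitive`). Flatness means
∂c = 0.

Over a trivial bundle the groupoid 𝒦 is the product of the pair groupoid with the action groupoid of
`H` on the vector space `F`: its arrows are ((h, m₂, m₁), f), with target (m₂, f) and source (m₁,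
h⁻¹ f). The extended connection keeps h constant, moves m₂ and m₁ in parallel and lets f move
freely. The frames acquire extra coefficients, in the Lie algebra of `H` for the Lie algebroid and
in `F` for the tangent bundle of the base. They do not disturb the calculation: the Lie algebra
coefficients are merely differentiated by ∇, their anchor lies in the `F`-directions, and c, z and
the extended form see only the coefficients along `M`. So the conditions on z (`IsStrictPrimitive`)
are the same as over the pair groupoid.

The calculation is therefore done once, for groupoids with such frames (`Gpd.IsFramed`), and applied
to three instances of one model (`Gpd.IsModel`): the pair groupoid, with `H` and `F` trivial; the
product of `H` with it, with `F` trivial; and 𝒦. A given strict form on the pair groupoid yields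
coefficients z (`IsStrictCovariantAdjustment.exists_coeff`), and the forms with the same z on the
other two groupoids are the required ones. The fixed point 0 makes f = 0 a subgroupoid, which is the
image of the splitting (`isIsoOntoRestriction`, `restrictsTo`). -/

open scoped Manifold ContDiff Topology
noncomputable section
open VectorField Filter

/-! ### Differentials and Lie brackets with values in the model spaces -/

section Derivatives

variable {E H M E' H' M' E'' H'' M'' EX HX X F : Type*} [NormedAddCommGroup E] [NormedSpace ℝ E]
  [TopologicalSpace H] {I : ModelWithCorners ℝ E H} [TopologicalSpace M] [ChartedSpace H M]
  [NormedAddCommGroup E'] [NormedSpace ℝ E'] [TopologicalSpace H'] {I' : ModelWithCorners ℝ E' H'}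
  [TopologicalSpace M'] [ChartedSpace H' M'] [NormedAddCommGroup F] [NormedSpace ℝ F]
  [NormedAddCommGroup E''] [NormedSpace ℝ E''] [TopologicalSpace H'']
  {I'' : ModelWithCorners ℝ E'' H''} [TopologicalSpace M''] [ChartedSpace H'' M'']
  [NormedAddCommGroup EX] [NormedSpace ℝ EX] [TopologicalSpace HX]
  {IX : ModelWithCorners ℝ EX HX} [TopologicalSpace X] [ChartedSpace HX X]

variable (I I') in
/-- The differential of a map between manifolds, as a map between the model spaces. -/
def der (f : M → M') (x : M) : E →L[ℝ] E' := mfderiv I I' f x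

variable (I) in
/-- The derivative of a vector-valued function along a vector field. -/
def dirDeriv (V : M → E) (φ : M → F) (x : M) : F := der I 𝓘(ℝ, F) φ x (V x)

variable (I) in
/-- The Lie bracket of vector fields, as functions with values in the model space. -/
def lieB (V W : M → E) (x : M) : E := mlieBracket I (V : ∀ y : M, TangentSpace I y) W x

variable (IX I) in
/-- Smoothness at a point of a vector field along a map. -/
def SmoothAlongAt [IsManifold I ∞ M] (f : X → M) (w : X → E) (x : X) : Prop :=
  ContMDiffAt IX I.tangent ∞ (fun y => (⟨f y, w y⟩ : TangentBundle I M)) x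

section der

theorem der_comp {g : M' → M''} {f : M → M'} {x : M} (hg : MDifferentiableAt I' I'' g (f x))
    (hf : MDifferentiableAt I I' f x) (v : E) :
    der I I'' (fun y => g (f y)) x v = der I' I'' g (f x) (der I I' f x v) :=
  congrArg (fun L : E →L[ℝ] E'' => L v) (mfderiv_comp x hg hf)

theorem der_congr {f g : M → M'} {x : M} (h : f =ᶠ[𝓝 x] g) : der I I' f x = der I I' g x :=
  h.mfderiv_eq

theorem der_prodMk {f : M → M'} {g : M → M''} {x : M} (hf : MDifferentiableAt I I' f x)
    (hg : MDifferentiableAt I I'' g x) (v : E) :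
    der I (I'.prod I'') (fun y => (f y, g y)) x v = (der I I' f x v, der I I'' g x v) :=
  congrArg (fun L : E →L[ℝ] E' × E'' => L v) (mfderiv_prodMk hf hg)

theorem der_fst (x : M × M') (v : E × E') : der (I.prod I') I Prod.fst x v = v.1 :=
  congrArg (fun L : E × E' →L[ℝ] E => L v) (mfderiv_fst (x := x))

theorem der_snd (x : M × M') (v : E × E') : der (I.prod I') I' Prod.snd x v = v.2 :=
  congrArg (fun L : E × E' →L[ℝ] E' => L v) (mfderiv_snd (x := x))

theorem der_id (x : M) (v : E) : der I I (fun y => y) x v = v :=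
  congrArg (fun L : E →L[ℝ] E => L v) (mfderiv_id (x := x))

theorem der_const (c : M') (x : M) (v : E) : der I I' (fun _ => c) x v = 0 :=
  congrArg (fun L : E →L[ℝ] E' => L v) (mfderiv_const (x := x) (c := c))

theorem der_eq_fderiv (φ : E → F) (x : E) : der 𝓘(ℝ, E) 𝓘(ℝ, F) φ x = fderiv ℝ φ x :=
  mfderiv_eq_fderiv

end der

section LieBracket

/-- Chain rule: pulling `V` back applies the inverse of the differential of the inverse chart, and
the two cancel. -/
theorem fderiv_comp_extChartAt_symm [IsManifold I ∞ M] [I.Boundaryless] {φ : M → F} {x : M}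
    {z : E} (hz : z ∈ (extChartAt I x).target)
    (hφ : MDifferentiableAt I 𝓘(ℝ, F) φ ((extChartAt I x).symm z))
    (V : ∀ y : M, TangentSpace I y) :
    fderiv ℝ (φ ∘ (extChartAt I x).symm) z
      (mpullback 𝓘(ℝ, E) I (extChartAt I x).symm V z)
      = dirDeriv I V φ ((extChartAt I x).symm z) := by
  have hs : MDifferentiableAt 𝓘(ℝ, E) I (extChartAt I x).symm z := by
    have := mdifferentiableWithinAt_extChartAt_symm (I := I) hz
    rwa [I.range_eq_univ, mdifferentiableWithinAt_univ] at this
  have hinv := isInvertible_mfderivWithin_extChartAt_symm (I := I) hz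
  rw [I.range_eq_univ, mfderivWithin_univ] at hinv
  rw [← mfderiv_eq_fderiv, mfderiv_comp z hφ hs]
  change (mfderiv I 𝓘(ℝ, F) φ ((extChartAt I x).symm z)) ((mfderiv 𝓘(ℝ, E) I _ z)
    ((mfderiv 𝓘(ℝ, E) I _ z).inverse (V ((extChartAt I x).symm z)))) = _
  rw [hinv.self_apply_inverse]
  rfl

theorem fderiv_comp_extChartAt_symm' [IsManifold I ∞ M] [I.Boundaryless] {φ : M → F} {x : M}
    (hφ : MDifferentiableAt I 𝓘(ℝ, F) φ x) (V : ∀ y : M, TangentSpace I y) :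
    fderiv ℝ (φ ∘ (extChartAt I x).symm) (extChartAt I x x)
      (mpullback 𝓘(ℝ, E) I (extChartAt I x).symm V (extChartAt I x x))
      = dirDeriv I V φ x := by
  have h := extChartAt_to_inv (I := I) x
  rw [fderiv_comp_extChartAt_symm (mem_extChartAt_target x) (by rwa [h]), h]

/-- The derivative along a Lie bracket is the commutator of the derivatives. -/
theorem dirDeriv_mlieBracket [IsManifold I ∞ M] [I.Boundaryless] [CompleteSpace E]
    {φ : M → F} {V W : ∀ y : M, TangentSpace I y} {x : M} (hφ : ContMDiffAt I 𝓘(ℝ, F) 2 φ x)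
    (hV : MDifferentiableAt I I.tangent (fun y => (⟨y, V y⟩ : TangentBundle I M)) x)
    (hW : MDifferentiableAt I I.tangent (fun y => (⟨y, W y⟩ : TangentBundle I M)) x)
    (hVφ : MDifferentiableAt I 𝓘(ℝ, F) (dirDeriv I V φ) x)
    (hWφ : MDifferentiableAt I 𝓘(ℝ, F) (dirDeriv I W φ) x) :
    dirDeriv I (mlieBracket I V W) φ x
      = dirDeriv I V (dirDeriv I W φ) x - dirDeriv I W (dirDeriv I V φ) x := by
  let z : E := extChartAt I x x
  have hsymm : (extChartAt I x).symm z = x := extChartAt_to_inv x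
  let V' : E → E := mpullback 𝓘(ℝ, E) I (extChartAt I x).symm V
  let W' : E → E := mpullback 𝓘(ℝ, E) I (extChartAt I x).symm W
  have hdiff (U : ∀ y : M, TangentSpace I y)
      (hU : MDifferentiableAt I I.tangent (fun y => (⟨y, U y⟩ : TangentBundle I M)) x) :
      DifferentiableAt ℝ (fun z => (mpullback 𝓘(ℝ, E) I (extChartAt I x).symm U z : E)) z := by
    have := (hU.mdifferentiableWithinAt
      (s := Set.univ)).differentiableWithinAt_mpullbackWithin_vectorField
    rw [I.range_eq_univ, mpullbackWithin_univ, Set.preimage_univ, Set.univ_inter] at this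
    exact differentiableWithinAt_univ.1 this
  have hV' : DifferentiableAt ℝ V' z := hdiff V hV
  have hW' : DifferentiableAt ℝ W' z := hdiff W hW
  have hφ' : ContDiffAt ℝ 2 (φ ∘ (extChartAt I x).symm) z := by
    rw [← contMDiffAt_iff_contDiffAt]
    refine ContMDiffAt.comp_of_eq (I' := I) hφ ?_ hsymm
    have := contMDiffWithinAt_extChartAt_symm_range (I := I) (n := 2) x (mem_extChartAt_target x)
    rwa [I.range_eq_univ, contMDiffWithinAt_univ] at this
  have hev : ∀ᶠ y in 𝓝 z, y ∈ (extChartAt I x).target ∧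
      MDifferentiableAt I 𝓘(ℝ, F) φ ((extChartAt I x).symm y) := by
    refine Filter.Eventually.and (extChartAt_target_mem_nhds (I := I) x) ?_
    have h1 : ∀ᶠ y in 𝓝 ((extChartAt I x).symm z), MDifferentiableAt I 𝓘(ℝ, F) φ y := by
      rw [hsymm]
      filter_upwards [(contMDiffAt_iff_contMDiffAt_nhds (by simp)).1 hφ] with y hy
      exact hy.mdifferentiableAt (by simp)
    exact (continuousAt_extChartAt_symm (I := I) x).eventually h1
  have hA (U : ∀ y : M, TangentSpace I y) :
      (fun y => fderiv ℝ (φ ∘ (extChartAt I x).symm) y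
        (mpullback 𝓘(ℝ, E) I (extChartAt I x).symm U y)) =ᶠ[𝓝 z]
        (dirDeriv I U φ) ∘ (extChartAt I x).symm :=
    hev.mono fun y hy => fderiv_comp_extChartAt_symm hy.1 hy.2 U
  -- In the chart the identity is the symmetry of the second derivative of `φ`; the remaining steps
  -- carry both sides to the chart and back.
  have key := fderiv_apply_lieBracket hφ' (by simp) hW' hV'
  have e1 := fderiv_comp_extChartAt_symm' hWφ V
  have e2 := fderiv_comp_extChartAt_symm' hVφ W
  rw [← (hA W).fderiv_eq] at e1
  rw [← (hA V).fderiv_eq] at e2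
  rw [← e1, ← e2]
  refine Eq.trans ?_ key
  have hinv := isInvertible_mfderiv_extChartAt (I := I) (mem_extChartAt_source x)
  have hcomp : φ =ᶠ[𝓝 x] (φ ∘ (extChartAt I x).symm) ∘ extChartAt I x := by
    filter_upwards [extChartAt_source_mem_nhds (I := I) x] with y hy
    simp only [Function.comp_apply, (extChartAt I x).left_inv hy]
  change mfderiv I 𝓘(ℝ, F) φ x (mlieBracket I V W x) = _
  rw [hcomp.mfderiv_eq, mfderiv_comp x (I' := 𝓘(ℝ, E))
    (hφ'.differentiableAt (by simp)).mdifferentiableAt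
    (mdifferentiableAt_extChartAt (mem_chart_source H x)), mfderiv_eq_fderiv,
    ← mlieBracketWithin_univ, mlieBracketWithin_apply, I.range_eq_univ, mpullbackWithin_univ,
    mpullbackWithin_univ, Set.preimage_univ, Set.univ_inter]
  refine congrArg (fderiv ℝ (φ ∘ (extChartAt I x).symm) z)
    ((hinv.self_apply_inverse _).trans ?_)
  exact congrFun (lieBracketWithin_univ (V := V') (W := W')) z

theorem dirDeriv_lieB [IsManifold I ∞ M] [I.Boundaryless] [CompleteSpace E]
    {φ : M → F} {V W : M → E} {x : M} (hφ : ContMDiffAt I 𝓘(ℝ, F) ∞ φ x)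
    (hV : SmoothAlongAt I I (fun y => y) V x) (hW : SmoothAlongAt I I (fun y => y) W x)
    (hVφ : ContMDiffAt I 𝓘(ℝ, F) ∞ (dirDeriv I V φ) x)
    (hWφ : ContMDiffAt I 𝓘(ℝ, F) ∞ (dirDeriv I W φ) x) :
    dirDeriv I (lieB I V W) φ x
      = dirDeriv I V (dirDeriv I W φ) x - dirDeriv I W (dirDeriv I V φ) x :=
  dirDeriv_mlieBracket (hφ.of_le (by norm_cast)) (hV.mdifferentiableAt (by simp))
    (hW.mdifferentiableAt (by simp)) (hVφ.mdifferentiableAt (by simp))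
    (hWφ.mdifferentiableAt (by simp))

end LieBracket

section SmoothAlong

variable [IsManifold I ∞ M] [IsManifold I' ∞ M'] {f : X → M} {w : X → E} {x₀ : X}

/-- The trivialization of the tangent bundle at `f x₀` is the differential of the chart there. This
turns smoothness of a field along `f` into smoothness of a vector-valued function, to which ordinary
calculus applies. -/
theorem smoothAlongAt_iff :
    SmoothAlongAt I IX f w x₀ ↔ ContMDiffAt IX I ∞ f x₀ ∧ ContMDiffAt IX 𝓘(ℝ, E) ∞
      (fun x => der I 𝓘(ℝ, E) (extChartAt I (f x₀)) (f x) (w x)) x₀ := by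
  refine Bundle.contMDiffAt_totalSpace.trans (and_congr_right fun hf => ?_)
  refine EventuallyEq.contMDiffAt_iff ?_
  have hs : ∀ᶠ x in 𝓝 x₀, f x ∈ (chartAt H (f x₀)).source :=
    hf.continuousAt.eventually ((chartAt H (f x₀)).open_source.mem_nhds (mem_chart_source H _))
  filter_upwards [hs] with x hx
  have h1 := TangentBundle.continuousLinearMapAt_trivializationAt (I := I) hx
  have h2 : f x ∈ (trivializationAt E (TangentSpace I) (f x₀)).baseSet := hx
  exact (((trivializationAt E (TangentSpace I) (f x₀)).continuousLinearMapAt_apply_of_mem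
    (R := ℝ) h2 (w x)).symm).trans (congrArg (fun L : E →L[ℝ] E => L (w x)) h1)

theorem SmoothAlongAt.base (h : SmoothAlongAt I IX f w x₀) : ContMDiffAt IX I ∞ f x₀ :=
  (smoothAlongAt_iff.1 h).1

theorem SmoothAlongAt.map (h : SmoothAlongAt I IX f w x₀) {g : M → M'}
    (hg : ContMDiffAt I I' ∞ g (f x₀)) :
    SmoothAlongAt I' IX (fun x => g (f x)) (fun x => der I I' g (f x) (w x)) x₀ := by
  have hϕ : ContMDiffAt IX 𝓘(ℝ, E →L[ℝ] E') ∞ (fun y => ContinuousLinearMap.inCoordinates E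
      (TangentSpace I (M := M)) E' (TangentSpace I' (M := M')) (f x₀) (f y) (g (f x₀)) (g (f y))
      (mfderiv I I' g (f y))) x₀ :=
    ContMDiffAt.comp (I' := I) x₀ (ContMDiffAt.mfderiv_const (m := ∞) hg le_rfl) h.base
  exact ContMDiffAt.clm_apply_of_inCoordinates hϕ h (hg.comp x₀ h.base)

theorem smoothAlongAt_space_iff {f : X → F} {w : X → F} :
    SmoothAlongAt 𝓘(ℝ, F) IX f w x₀ ↔
      ContMDiffAt IX 𝓘(ℝ, F) ∞ f x₀ ∧ ContMDiffAt IX 𝓘(ℝ, F) ∞ w x₀ := by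
  rw [smoothAlongAt_iff]
  refine and_congr_right fun hf => EventuallyEq.contMDiffAt_iff (.of_forall fun x => ?_)
  rw [extChartAt_model_space_eq_id]
  exact der_id (I := 𝓘(ℝ, F)) (f x) (w x)

theorem SmoothAlongAt.der_apply (h : SmoothAlongAt I IX f w x₀) {φ : M → F}
    (hφ : ContMDiffAt I 𝓘(ℝ, F) ∞ φ (f x₀)) :
    ContMDiffAt IX 𝓘(ℝ, F) ∞ (fun x => der I 𝓘(ℝ, F) φ (f x) (w x)) x₀ :=
  (smoothAlongAt_space_iff.1 (h.map hφ)).2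

omit [IsManifold I ∞ M] in
theorem SmoothAlongAt.comp {f : M → M'} {w : M → E'} {g : X → M}
    (h : SmoothAlongAt I' I f w (g x₀)) (hg : ContMDiffAt IX I ∞ g x₀) :
    SmoothAlongAt I' IX (fun x => f (g x)) (fun x => w (g x)) x₀ :=
  ContMDiffAt.comp (I' := I) x₀ h hg

end SmoothAlong

end Derivatives

/-! ### Smooth frames and the smoothness of coefficients -/

section Frames

variable {E H M E' H' M' E'' H'' M'' EX HX X F F' : Type*} [NormedAddCommGroup E] [NormedSpace ℝ E]
  [TopologicalSpace H] {I : ModelWithCorners ℝ E H} [TopologicalSpace M] [ChartedSpace H M]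
  [NormedAddCommGroup E'] [NormedSpace ℝ E'] [TopologicalSpace H'] {I' : ModelWithCorners ℝ E' H'}
  [TopologicalSpace M'] [ChartedSpace H' M'] [NormedAddCommGroup F] [NormedSpace ℝ F]
  [NormedAddCommGroup F'] [NormedSpace ℝ F']
  [NormedAddCommGroup EX] [NormedSpace ℝ EX] [TopologicalSpace HX]
  {IX : ModelWithCorners ℝ EX HX} [TopologicalSpace X] [ChartedSpace HX X] [FiniteDimensional ℝ F]
  {x₀ : X}

/-- As `F` is finite-dimensional, `A` is a finite sum of rank-one maps built from a basis and the
values of `A` on it. -/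
theorem contMDiffAt_clm_of_apply {A : X → F →L[ℝ] F'}
    (h : ∀ v, ContMDiffAt IX 𝓘(ℝ, F') ∞ (fun x => A x v) x₀) :
    ContMDiffAt IX 𝓘(ℝ, F →L[ℝ] F') ∞ A x₀ := by
  let b := Module.finBasis ℝ F
  have hA : A = fun x => ∑ i, ContinuousLinearMap.smulRightL ℝ F F'
      (LinearMap.toContinuousLinearMap (b.coord i)) (A x (b i)) := by
    funext x
    ext v
    have h := congrArg (A x) (b.sum_repr v)
    rw [map_sum] at h
    simpa using h.symm
  rw [hA]
  refine contMDiffAt_finsetSum fun i _ => ?_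
  exact (ContinuousLinearMap.contMDiff _).contMDiffAt.comp x₀ (h (b i))

variable [IsManifold I ∞ M] {f : X → M} {b : X → F →ₗ[ℝ] E} {φ : X → F}

theorem contMDiffAt_der_chart_comp (hb : ∀ v, SmoothAlongAt I IX f (fun x => b x v) x₀) :
    ContMDiffAt IX 𝓘(ℝ, F →L[ℝ] E) ∞ (fun x => (der I 𝓘(ℝ, E) (extChartAt I (f x₀)) (f x)).comp
      (LinearMap.toContinuousLinearMap (b x))) x₀ :=
  contMDiffAt_clm_of_apply fun v => (smoothAlongAt_iff.1 (hb v)).2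

theorem SmoothAlongAt.frame (hb : ∀ v, SmoothAlongAt I IX f (fun x => b x v) x₀)
    (hφ : ContMDiffAt IX 𝓘(ℝ, F) ∞ φ x₀) : SmoothAlongAt I IX f (fun x => b x (φ x)) x₀ :=
  smoothAlongAt_iff.2 ⟨(hb 0).base, (contMDiffAt_der_chart_comp hb).clm_apply hφ⟩

/-- The coefficients of a smooth section with respect to a smooth frame are smooth. -/
theorem SmoothAlongAt.coeff [FiniteDimensional ℝ E]
    (hb : ∀ v, SmoothAlongAt I IX f (fun x => b x v) x₀)
    (hinj : Function.Injective (b x₀)) (h : SmoothAlongAt I IX f (fun x => b x (φ x)) x₀) :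
    ContMDiffAt IX 𝓘(ℝ, F) ∞ φ x₀ := by
  let A : X → F →L[ℝ] E := fun x => (der I 𝓘(ℝ, E) (extChartAt I (f x₀)) (f x)).comp
      (LinearMap.toContinuousLinearMap (b x))
  have hA : ContMDiffAt IX 𝓘(ℝ, F →L[ℝ] E) ∞ A x₀ := contMDiffAt_der_chart_comp hb
  have hAφ : ContMDiffAt IX 𝓘(ℝ, E) ∞ (fun x => A x (φ x)) x₀ := (smoothAlongAt_iff.1 h).2
  have hA0 : LinearMap.ker (A x₀ : F →ₗ[ℝ] E) = ⊥ := by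
    refine LinearMap.ker_eq_bot.2 (Function.Injective.comp (g := der I 𝓘(ℝ, E) _ _) ?_ hinj)
    exact (isInvertible_mfderiv_extChartAt (mem_extChartAt_source (f x₀))).injective
  -- With `L` a left inverse of `A x₀`, the endomorphism `L ∘ A x` is the identity at `x₀`, hence
  -- invertible nearby, and `φ` is recovered as its inverse applied to `L (A x (φ x))`. Injectivity
  -- at `x₀` is enough, so that frames of a subbundle, such as the Lie algebroid, are covered.
  obtain ⟨L', hL'⟩ := LinearMap.exists_leftInverse_of_injective (A x₀ : F →ₗ[ℝ] E) hA0
  let L : E →L[ℝ] F := LinearMap.toContinuousLinearMap L'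
  let B : X → F →L[ℝ] F := fun x => L.comp (A x)
  have hB : ContMDiffAt IX 𝓘(ℝ, F →L[ℝ] F) ∞ B x₀ := contMDiffAt_const.clm_comp hA
  have hB0 : B x₀ = 1 := by ext v; exact LinearMap.congr_fun hL' v
  have hri : ContDiffAt ℝ ∞ (Ring.inverse : (F →L[ℝ] F) → F →L[ℝ] F) (B x₀) := by
    rw [hB0]
    exact contDiffAt_ringInverse ℝ (1 : (F →L[ℝ] F)ˣ)
  have hinv : ContMDiffAt IX 𝓘(ℝ, F →L[ℝ] F) ∞ (fun x => Ring.inverse (B x)) x₀ :=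
    hri.contMDiffAt.comp x₀ hB
  have hunit : ∀ᶠ x in 𝓝 x₀, IsUnit (B x) := by
    refine hB.continuousAt.eventually ?_
    rw [hB0]
    exact Units.nhds (1 : (F →L[ℝ] F)ˣ)
  have hL : ContMDiffAt IX 𝓘(ℝ, F) ∞ (fun x => L (A x (φ x))) x₀ :=
    (ContinuousLinearMap.contMDiff (n := ∞) L).contMDiffAt.comp x₀ hAφ
  refine (hinv.clm_apply hL).congr_of_eventuallyEq ?_
  filter_upwards [hunit] with x hx
  have := congrArg (fun T : F →L[ℝ] F => T (φ x)) (Ring.inverse_mul_cancel _ hx)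
  exact this.symm

end Frames

/-! ### Product rules for derivatives along a vector field -/

section DirDeriv

variable {E H M F F' F'' : Type*} [NormedAddCommGroup E] [NormedSpace ℝ E]
  [TopologicalSpace H] {I : ModelWithCorners ℝ E H} [TopologicalSpace M] [ChartedSpace H M]
  [NormedAddCommGroup F] [NormedSpace ℝ F] [NormedAddCommGroup F'] [NormedSpace ℝ F']
  [NormedAddCommGroup F''] [NormedSpace ℝ F'']
  {V : M → E} {x : M}

theorem dirDeriv_clm_apply [I.Boundaryless] {A : M → F →L[ℝ] F'} {φ : M → F}
    (hA : MDifferentiableAt I 𝓘(ℝ, F →L[ℝ] F') A x) (hφ : MDifferentiableAt I 𝓘(ℝ, F) φ x) :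
    dirDeriv I V (fun y => A y (φ y)) x
      = dirDeriv I V A x (φ x) + A x (dirDeriv I V φ x) := by
  have hA' : DifferentiableAt ℝ (A ∘ (extChartAt I x).symm) (extChartAt I x x) := by
    have := hA.differentiableWithinAt_writtenInExtChartAt; rwa [I.range_eq_univ, differentiableWithinAt_univ] at this
  have hφ' : DifferentiableAt ℝ (φ ∘ (extChartAt I x).symm) (extChartAt I x x) := by
    have := hφ.differentiableWithinAt_writtenInExtChartAt; rwa [I.range_eq_univ, differentiableWithinAt_univ] at this
  have h := fderiv_clm_apply hA' hφ'
  have e1 : der I 𝓘(ℝ, F →L[ℝ] F') A x = fderiv ℝ (A ∘ (extChartAt I x).symm) (extChartAt I x x) := by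
    rw [der, hA.mfderiv, I.range_eq_univ, fderivWithin_univ]; rfl
  have e2 : der I 𝓘(ℝ, F) φ x = fderiv ℝ (φ ∘ (extChartAt I x).symm) (extChartAt I x x) := by
    rw [der, hφ.mfderiv, I.range_eq_univ, fderivWithin_univ]; rfl
  have e3 : der I 𝓘(ℝ, F') (fun y => A y (φ y)) x
      = fderiv ℝ ((fun y => A y (φ y)) ∘ (extChartAt I x).symm) (extChartAt I x x) := by
    rw [der, (hA.clm_apply hφ).mfderiv, I.range_eq_univ, fderivWithin_univ]; rfl
  have h' := congrArg (fun L : E →L[ℝ] F' => L (V x)) h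
  simp only [dirDeriv, e1, e2, e3]
  refine h'.trans ?_
  simp [add_comm]

theorem dirDeriv_add {φ ψ : M → F} (hφ : MDifferentiableAt I 𝓘(ℝ, F) φ x)
    (hψ : MDifferentiableAt I 𝓘(ℝ, F) ψ x) :
    dirDeriv I V (fun y => φ y + ψ y) x = dirDeriv I V φ x + dirDeriv I V ψ x :=
  congrArg (fun L : E →L[ℝ] F => L (V x)) (hφ.hasMFDerivAt.add hψ.hasMFDerivAt).mfderiv

theorem dirDeriv_sub {φ ψ : M → F} (hφ : MDifferentiableAt I 𝓘(ℝ, F) φ x)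
    (hψ : MDifferentiableAt I 𝓘(ℝ, F) ψ x) :
    dirDeriv I V (fun y => φ y - ψ y) x = dirDeriv I V φ x - dirDeriv I V ψ x :=
  congrArg (fun L : E →L[ℝ] F => L (V x)) (hφ.hasMFDerivAt.sub hψ.hasMFDerivAt).mfderiv

theorem dirDeriv_const (c : F) : dirDeriv I V (fun _ => c) x = 0 := der_const c x (V x)

theorem dirDeriv_clm (L : F →L[ℝ] F') {φ : M → F} (hφ : MDifferentiableAt I 𝓘(ℝ, F) φ x) :
    dirDeriv I V (fun y => L (φ y)) x = L (dirDeriv I V φ x) := by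
  have h := der_comp (g := L) L.differentiableAt.mdifferentiableAt hφ (V x)
  rw [der_eq_fderiv, L.fderiv] at h
  exact h

end DirDeriv

/-! ### Related vector fields and the Leibniz rule in a frame -/

section Related

variable {E H M E' H' M' F EX HX X : Type*} [NormedAddCommGroup E] [NormedSpace ℝ E]
  [TopologicalSpace H] {I : ModelWithCorners ℝ E H} [TopologicalSpace M] [ChartedSpace H M]
  [NormedAddCommGroup E'] [NormedSpace ℝ E'] [TopologicalSpace H'] {I' : ModelWithCorners ℝ E' H'}
  [TopologicalSpace M'] [ChartedSpace H' M'] [NormedAddCommGroup F] [NormedSpace ℝ F]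
  [NormedAddCommGroup EX] [NormedSpace ℝ EX] [TopologicalSpace HX]
  {IX : ModelWithCorners ℝ EX HX} [TopologicalSpace X] [ChartedSpace HX X]
  [IsManifold I ∞ M] [IsManifold I' ∞ M'] [I.Boundaryless] [I'.Boundaryless]
  [CompleteSpace E] [CompleteSpace E']

variable (I) in
/-- Smoothness of a vector field with values in the model space. -/
def SmoothField (V : M → E) : Prop := ∀ x, SmoothAlongAt I I (fun y => y) V x

omit [I.Boundaryless] [CompleteSpace E] in
theorem SmoothField.dirDeriv {V : M → E} (hV : SmoothField I V) {φ : M → F} {x : M}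
    (hφ : ContMDiffAt I 𝓘(ℝ, F) ∞ φ x) : ContMDiffAt I 𝓘(ℝ, F) ∞ (dirDeriv I V φ) x :=
  (hV x).der_apply hφ

/-- The Lie brackets of related vector fields are related. -/
theorem lieB_related {f : M → M'} (hf : ContMDiff I I' ∞ f) {V W : M → E} {V' W' : M' → E'}
    (hV : SmoothField I V) (hW : SmoothField I W) (hV' : SmoothField I' V')
    (hW' : SmoothField I' W') (hVV' : ∀ x, der I I' f x (V x) = V' (f x))
    (hWW' : ∀ x, der I I' f x (W x) = W' (f x)) (x : M) :
    der I I' f x (lieB I V W x) = lieB I' V' W' (f x) := by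
  -- A tangent vector at `f x` is determined by its action on the chart `χ`. So it suffices to
  -- compare iterated derivatives of `χ ∘ f` upstairs with those of `χ` downstairs.
  let χ : M' → E' := extChartAt I' (f x)
  have hχ : ContMDiffAt I' 𝓘(ℝ, E') ∞ χ (f x) := contMDiffAt_extChartAt
  have hχf : ContMDiffAt I 𝓘(ℝ, E') ∞ (fun y => χ (f y)) x := hχ.comp x hf.contMDiffAt
  have hmem : ∀ᶠ y in 𝓝 x, f y ∈ (chartAt H' (f x)).source :=
    hf.continuous.continuousAt.eventually
      ((chartAt H' (f x)).open_source.mem_nhds (mem_chart_source H' _))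
  have hinj : Function.Injective (der I' 𝓘(ℝ, E') χ (f x)) :=
    (isInvertible_mfderiv_extChartAt (mem_extChartAt_source (f x))).injective
  have hrel (U : M → E) (U' : M' → E') (hUU' : ∀ x, der I I' f x (U x) = U' (f x)) :
      dirDeriv I U (fun y => χ (f y)) =ᶠ[𝓝 x] fun y => dirDeriv I' U' χ (f y) := by
    filter_upwards [hmem] with y hy
    rw [_root_.dirDeriv, der_comp (mdifferentiableAt_extChartAt hy)
      (hf.contMDiffAt.mdifferentiableAt (by simp)), hUU']
    rfl
  have h2 (U₁ U₂ : M → E) (U₁' U₂' : M' → E') (hU₂' : SmoothField I' U₂')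
      (h₁ : ∀ x, der I I' f x (U₁ x) = U₁' (f x)) (h₂ : ∀ x, der I I' f x (U₂ x) = U₂' (f x)) :
      dirDeriv I U₁ (dirDeriv I U₂ (fun y => χ (f y))) x
        = dirDeriv I' U₁' (dirDeriv I' U₂' χ) (f x) := by
    rw [_root_.dirDeriv, der_congr (hrel U₂ U₂' h₂),
      der_comp ((hU₂'.dirDeriv hχ).mdifferentiableAt (by simp))
      (hf.contMDiffAt.mdifferentiableAt (by simp)), h₁]
    rfl
  apply hinj
  have e1 := dirDeriv_lieB hχf (hV x) (hW x) (hV.dirDeriv hχf) (hW.dirDeriv hχf)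
  have e2 := dirDeriv_lieB hχ (hV' (f x)) (hW' (f x)) (hV'.dirDeriv hχ) (hW'.dirDeriv hχ)
  rw [h2 V W V' W' hW' hVV' hWW', h2 W V W' V' hV' hWW' hVV', ← e2, _root_.dirDeriv,
    der_comp (hχ.mdifferentiableAt (by simp)) (hf.contMDiffAt.mdifferentiableAt (by simp))] at e1
  exact e1

omit [I.Boundaryless] in
theorem SmoothField.lieB {V W : M → E} (hV : SmoothField I V) (hW : SmoothField I W) :
    SmoothField I (lieB I V W) := fun x => by
  have : IsManifold I (minSmoothness ℝ 2) M := by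
    rw [minSmoothness_of_isRCLikeNormedField]; exact IsManifold.of_le (n := ∞) (by norm_cast)
  have : IsManifold I (((⊤ : ℕ∞) : WithTop ℕ∞) + 1) M := inferInstanceAs (IsManifold I ∞ M)
  exact ContMDiffAt.mlieBracket_vectorField (n := ⊤) (m := ⊤) (hV x) (hW x)
    (by rw [minSmoothness_of_isRCLikeNormedField]; exact le_rfl)

omit [IsManifold I ∞ M] [I.Boundaryless] [CompleteSpace E] in
theorem lieB_swap (V W : M → E) (x : M) : lieB I V W x = - lieB I W V x :=
  mlieBracket_swap_apply

/-- The Leibniz rule for a vector field with coefficients in a frame. -/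
theorem lieB_frame [FiniteDimensional ℝ F] {V : M → E} {b : M → F →ₗ[ℝ] E} {φ : M → F}
    (hV : SmoothField I V) (hb : ∀ v, SmoothField I (fun x => b x v))
    (hφ : ContMDiff I 𝓘(ℝ, F) ∞ φ) (x : M) :
    lieB I V (fun y => b y (φ y)) x = lieB I V (fun y => b y (φ x)) x
      + b x (dirDeriv I V φ x) := by
  -- Both sides are again tested on a chart `χ`. The derivative of `χ` along the field `b φ` is a
  -- matrix function applied to `φ`; the product rule separates the term in which `φ` is frozen at
  -- `x` from the one in which `φ` is differentiated.
  obtain ⟨χ, hχ, hinj, hA⟩ : ∃ χ : M → E, ContMDiffAt I 𝓘(ℝ, E) ∞ χ x ∧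
      Function.Injective (der I 𝓘(ℝ, E) χ x) ∧
      ContMDiffAt I 𝓘(ℝ, F →L[ℝ] E) ∞ (fun y => (der I 𝓘(ℝ, E) χ y).comp
        (LinearMap.toContinuousLinearMap (b y))) x :=
    ⟨extChartAt I x, contMDiffAt_extChartAt,
      (isInvertible_mfderiv_extChartAt (mem_extChartAt_source x)).injective,
      contMDiffAt_der_chart_comp (f := fun y => y) (x₀ := x) (IX := I) fun v => hb v x⟩
  have hW : SmoothField I (fun y => b y (φ y)) := fun y =>
    SmoothAlongAt.frame (fun v => hb v y) hφ.contMDiffAt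
  apply hinj
  have e1 := dirDeriv_lieB hχ (hV x) (hW x) (hV.dirDeriv hχ) (hW.dirDeriv hχ)
  have e2 := dirDeriv_lieB hχ (hV x) (hb (φ x) x) (hV.dirDeriv hχ) ((hb (φ x)).dirDeriv hχ)
  have key := dirDeriv_clm_apply (V := V) (hA.mdifferentiableAt (by simp))
      (hφ.contMDiffAt.mdifferentiableAt (x := x) (by simp))
  have key' := dirDeriv_clm (V := V) (ContinuousLinearMap.apply ℝ E (φ x))
    (hA.mdifferentiableAt (by simp))
  rw [map_add]
  exact e1.trans ((congrArg₂ _ key rfl).trans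
    ((add_sub_right_comm _ _ _).trans (congrArg₂ _ ((congrArg₂ _ key'.symm rfl).trans e2.symm) rfl)))

end Related

/-! ### Fields along maps into products, derivatives within subsets, and bracket identities -/

section Products

variable {E H M E' H' M' E'' H'' M'' EX HX X F : Type*} [NormedAddCommGroup E] [NormedSpace ℝ E]
  [TopologicalSpace H] {I : ModelWithCorners ℝ E H} [TopologicalSpace M] [ChartedSpace H M]
  [NormedAddCommGroup E'] [NormedSpace ℝ E'] [TopologicalSpace H'] {I' : ModelWithCorners ℝ E' H'}
  [TopologicalSpace M'] [ChartedSpace H' M']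
  [NormedAddCommGroup E''] [NormedSpace ℝ E''] [TopologicalSpace H'']
  {I'' : ModelWithCorners ℝ E'' H''} [TopologicalSpace M''] [ChartedSpace H'' M'']
  [NormedAddCommGroup EX] [NormedSpace ℝ EX] [TopologicalSpace HX]
  {IX : ModelWithCorners ℝ EX HX} [TopologicalSpace X] [ChartedSpace HX X]

theorem SmoothAlongAt.zero [IsManifold I ∞ M] {f : X → M} {x₀ : X} (hf : ContMDiffAt IX I ∞ f x₀) :
    SmoothAlongAt I IX f (fun _ => 0) x₀ := by
  refine smoothAlongAt_iff.2 ⟨hf, ?_⟩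
  simp only [map_zero]
  exact contMDiffAt_const

theorem SmoothAlongAt.const [IsManifold I ∞ M] (p : M) (w : E) (x₀ : X) :
    SmoothAlongAt I IX (fun _ => p) (fun _ => w) x₀ :=
  smoothAlongAt_iff.2 ⟨contMDiffAt_const, contMDiffAt_const⟩

theorem SmoothAlongAt.prodMk [IsManifold I ∞ M] [IsManifold I' ∞ M'] {f : X → M} {w : X → E}
    {g : X → M'} {u : X → E'} {x₀ : X} (h : SmoothAlongAt I IX f w x₀)
    (h' : SmoothAlongAt I' IX g u x₀) :
    SmoothAlongAt (I.prod I') IX (fun x => (f x, g x)) (fun x => (w x, u x)) x₀ := by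
  have h1 : ContMDiffAt IX (I.tangent.prod I'.tangent) ∞ (fun x =>
      ((⟨f x, w x⟩ : TangentBundle I M), (⟨g x, u x⟩ : TangentBundle I' M'))) x₀ :=
    ContMDiffAt.prodMk h h'
  exact (contMDiff_equivTangentBundleProd_symm (n := ∞) (I := I) (I' := I') (M := M)
    (M' := M')).contMDiffAt.comp x₀ h1

theorem SmoothAlongAt.congr [IsManifold I ∞ M] {f f' : X → M} {w w' : X → E} {x₀ : X}
    (h : SmoothAlongAt I IX f w x₀) (hf : f' = f) (hw : w' = w) :
    SmoothAlongAt I IX f' w' x₀ := by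
  subst hf hw; exact h

/-- The derivative within a set is determined along curves, and more generally along maps, into
this set. -/
theorem mfderivWithin_of_mapsTo {f : M → M'} {s : Set M} {φ : X → M} {x : X}
    (hf : MDifferentiableWithinAt I I' f s (φ x)) (hφ : MDifferentiableAt IX I φ x)
    (hs : ∀ y, φ y ∈ s) (w : EX) :
    (mfderivWithin I I' f s (φ x) : E →L[ℝ] E') (der IX I φ x w)
      = der IX I' (fun y => f (φ y)) x w := by
  -- The chain rule holds for whichever derivative within `s` has been chosen. Uniqueness of this
  -- derivative, which may fail on thin sets such as the composable pairs or a fibre of the target,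
  -- is not needed.
  have h1 := HasMFDerivWithinAt.comp (I'' := I') x hf.hasMFDerivWithinAt
    (hφ.hasMFDerivAt.hasMFDerivWithinAt (s := Set.univ)) (fun y _ => hs y)
  exact (congrArg (fun L : EX →L[ℝ] E' => L w) (hasMFDerivWithinAt_univ.1 h1).mfderiv).symm

theorem der_surjective_of_rightInverse {f : M → M'} {σ : M' → M} {x : M}
    (hf : MDifferentiableAt I I' f x) (hσ : MDifferentiableAt I' I σ (f x))
    (h : ∀ y, f (σ y) = y) (hx : σ (f x) = x) : Function.Surjective (der I I' f x) := by
  intro w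
  refine ⟨der I' I σ (f x) w, ?_⟩
  have h1 := der_comp (g := f) (f := σ) (x := f x) (by rwa [hx]) hσ w
  rw [hx] at h1
  rw [← h1]
  simp only [h]
  exact der_id _ w

theorem der_leftInverse {f : M → M'} {g : M' → M} {x : M} (hf : MDifferentiableAt I I' f x)
    (hg : MDifferentiableAt I' I g (f x)) (h : ∀ y, g (f y) = y) (w : E) :
    der I' I g (f x) (der I I' f x w) = w := by
  rw [← der_comp hg hf]
  simp only [h]
  exact der_id _ w

/-- The derivative of a map of two variables is the sum of the partial derivatives. -/
theorem der_prod_eq_add {f : M × M' → M''} {p : M × M'}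
    (hf : MDifferentiableAt (I.prod I') I'' f p) (v : E × E') :
    der (I.prod I') I'' f p v = der I I'' (fun z => f (z, p.2)) p.1 v.1
      + der I' I'' (fun z => f (p.1, z)) p.2 v.2 :=
  mfderiv_prod_eq_add_apply hf

theorem jacobi_lieB [IsManifold I ∞ M] [CompleteSpace E] {U V W : M → E} (hU : SmoothField I U)
    (hV : SmoothField I V) (hW : SmoothField I W) (x : M) :
    lieB I U (lieB I V W) x = lieB I (lieB I U V) W x + lieB I V (lieB I U W) x := by
  have : IsManifold I (minSmoothness ℝ 3) M := by
    rw [minSmoothness_of_isRCLikeNormedField]; exact IsManifold.of_le (n := ∞) (by norm_cast)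
  have h2 (A : M → E) (hA : SmoothField I A) : ContMDiffAt I I.tangent (minSmoothness ℝ 2)
      (fun y => (⟨y, A y⟩ : TangentBundle I M)) x := by
    rw [minSmoothness_of_isRCLikeNormedField]; exact (hA x).of_le (by norm_cast)
  exact leibniz_identity_mlieBracket_apply (h2 U hU) (h2 V hV) (h2 W hW)

theorem lieB_zero_right (V : M → E) (x : M) : lieB I V (fun _ => 0) x = 0 :=
  congrFun (mlieBracket_zero_right (I := I)) x

theorem lieB_zero_left (V : M → E) (x : M) : lieB I (fun _ => 0) V x = 0 :=
  congrFun (mlieBracket_zero_left (I := I)) x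

theorem lieB_add_right [IsManifold I ∞ M] [CompleteSpace E] {U V W : M → E}
    (hV : SmoothField I V) (hW : SmoothField I W) (x : M) :
    lieB I U (fun y => V y + W y) x = lieB I U V x + lieB I U W x :=
  have : IsManifold I 2 M := IsManifold.of_le (n := ∞) (by norm_cast)
  mlieBracket_add_right ((hV x).mdifferentiableAt (by simp)) ((hW x).mdifferentiableAt (by simp))

theorem lieB_smul_right [IsManifold I ∞ M] [CompleteSpace E] {U V : M → E} (r : ℝ)
    (hV : SmoothField I V) (x : M) :
    lieB I U (fun y => r • V y) x = r • lieB I U V x :=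
  have : IsManifold I 2 M := IsManifold.of_le (n := ∞) (by norm_cast)
  mlieBracket_const_smul_right ((hV x).mdifferentiableAt (by simp))

end Products

/-! ### Left-invariant vector fields on a Lie group -/

section InvariantFields

variable {E H₀ H : Type*} [NormedAddCommGroup E] [NormedSpace ℝ E]
  [TopologicalSpace H₀] {I : ModelWithCorners ℝ E H₀} [TopologicalSpace H] [ChartedSpace H₀ H]
  [Group H]

variable (I) in
/-- The frame of left-invariant vector fields on a Lie group. -/
def invFrame (h : H) : E →ₗ[ℝ] E := (der I I (fun k : H => h * k) 1).toLinearMap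

variable [LieGroup I ∞ H]

theorem mdifferentiableAt_mul_left' (h k : H) : MDifferentiableAt I I (fun k : H => h * k) k :=
  (contMDiff_mul_left (I := I) (n := ∞)).contMDiffAt.mdifferentiableAt (by simp)

theorem mdifferentiableAt_mul_right' (h k : H) : MDifferentiableAt I I (fun k : H => k * h) k :=
  (contMDiff_mul_right (I := I) (n := ∞)).contMDiffAt.mdifferentiableAt (by simp)

theorem der_mul_left_invFrame (g h : H) (η : E) :
    der I I (fun k : H => g * k) h (invFrame I h η) = invFrame I (g * h) η := by
  have h1 := der_comp (f := fun k : H => h * k) (g := fun k : H => g * k) (x := 1)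
    (mdifferentiableAt_mul_left' g (h * 1)) (mdifferentiableAt_mul_left' (I := I) h 1) η
  rw [mul_one] at h1
  refine h1.symm.trans ?_
  simp only [← mul_assoc]
  rfl

omit [LieGroup I ∞ H] in
theorem invFrame_one (η : E) : invFrame I (1 : H) η = η := by
  change der I I (fun k : H => 1 * k) 1 η = η
  simp only [one_mul]
  exact der_id _ η

/-- The field is the differential of the multiplication applied to the smooth field `(0, η)` along
`h ↦ (h, 1)`. -/
theorem smoothField_invFrame (η : E) : SmoothField I (fun h : H => invFrame I h η) := by
  intro h₀
  have h1 : SmoothAlongAt (I.prod I) I (fun h : H => (h, (1 : H))) (fun _ => ((0 : E), η)) h₀ :=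
    (SmoothAlongAt.zero contMDiffAt_id).prodMk (SmoothAlongAt.const 1 η h₀)
  refine (h1.map (g := fun p : H × H => p.1 * p.2) (contMDiff_mul I ∞).contMDiffAt).congr
    (by simp) ?_
  funext h
  rw [der_prod_eq_add ((contMDiff_mul I ∞).contMDiffAt.mdifferentiableAt (by simp)), map_zero,
    zero_add]
  rfl

/-- Left translation by `h` relates each invariant field to itself, hence also their bracket. -/
theorem lieB_invFrame [I.Boundaryless] [CompleteSpace E] (η θ : E) (h : H) :
    lieB I (fun h : H => invFrame I h η) (fun h => invFrame I h θ) h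
      = invFrame I h (lieB I (fun h : H => invFrame I h η) (fun h => invFrame I h θ) 1) := by
  have h1 := lieB_related (f := fun k : H => h * k) (contMDiff_mul_left (I := I) (n := ∞))
    (smoothField_invFrame (I := I) (H := H) η) (smoothField_invFrame θ)
    (smoothField_invFrame (I := I) (H := H) η) (smoothField_invFrame θ)
    (fun k => der_mul_left_invFrame h k η) (fun k => der_mul_left_invFrame h k θ) 1
  rw [mul_one] at h1
  exact h1.symm

variable (I H) in
/-- The bracket of the Lie algebra of a Lie group. -/
theorem exists_lieB_invFrame [I.Boundaryless] [FiniteDimensional ℝ E] :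
    ∃ k : E →L[ℝ] E →L[ℝ] E, ∀ (η θ : E) (h : H),
      lieB I (fun h : H => invFrame I h η) (fun h => invFrame I h θ) h
        = invFrame I h (k η θ) := by
  have := FiniteDimensional.complete ℝ E
  let k : E → E → E := fun η θ =>
    lieB I (fun h : H => invFrame I h η) (fun h => invFrame I h θ) 1
  have hs (η : E) : SmoothField I (fun h : H => invFrame I h η) := smoothField_invFrame η
  have hswap (η θ : E) : k η θ = - k θ η := lieB_swap _ _ _
  have hadd (η θ θ' : E) : k η (θ + θ') = k η θ + k η θ' := by
    refine Eq.trans ?_ (lieB_add_right (hs θ) (hs θ') 1)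
    simp only [k, map_add]
  have hsmul (r : ℝ) (η θ : E) : k η (r • θ) = r • k η θ := by
    refine Eq.trans ?_ (lieB_smul_right r (hs θ) 1)
    simp only [k, map_smul]
  let K : E →ₗ[ℝ] E →ₗ[ℝ] E := LinearMap.mk₂ ℝ k
    (fun η η' θ => by rw [hswap, hadd, hswap θ η, hswap θ η']; abel)
    (fun r η θ => by rw [hswap, hsmul, hswap θ η]; simp) hadd hsmul
  refine ⟨LinearMap.toContinuousLinearMap
    ((LinearMap.toContinuousLinearMap : (E →ₗ[ℝ] E) ≃ₗ[ℝ] (E →L[ℝ] E)).toLinearMap ∘ₗ K),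
    fun η θ h => ?_⟩
  exact lieB_invFrame η θ h

end InvariantFields

/-! ### Global frames, their structure functions and the Jacobi identity -/

section FrameOnManifold

variable {E H M F F' : Type*} [NormedAddCommGroup E] [NormedSpace ℝ E] [FiniteDimensional ℝ E]
  [TopologicalSpace H] {I : ModelWithCorners ℝ E H} [TopologicalSpace M] [ChartedSpace H M]
  [IsManifold I ∞ M] [NormedAddCommGroup F] [NormedSpace ℝ F] [NormedAddCommGroup F']
  [NormedSpace ℝ F']

variable (I) in
/-- `e` is a smooth global frame of the tangent bundle with structure functions `c`. -/
structure IsFrame (e : M → E →ₗ[ℝ] E) (c : M → E →L[ℝ] E →L[ℝ] E) : Prop where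
  smooth : ∀ v, SmoothField I (fun x => e x v)
  bijective : ∀ x, Function.Bijective (e x)
  smooth_coeff : ContMDiff I 𝓘(ℝ, E →L[ℝ] E →L[ℝ] E) ∞ c
  lieB_eq : ∀ v w x, lieB I (fun y => e y v) (fun y => e y w) x = e x (c x v w)

variable (I) in
/-- The derivative of a function along a frame. -/
def frameDeriv (e : M → E →ₗ[ℝ] E) (φ : M → F) (x : M) : E →ₗ[ℝ] F :=
  (der I 𝓘(ℝ, F) φ x).toLinearMap ∘ₗ e x

variable {e : M → E →ₗ[ℝ] E} {c : M → E →L[ℝ] E →L[ℝ] E}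

omit [FiniteDimensional ℝ E] in
theorem IsFrame.skew (h : IsFrame I e c) (x : M) (v w : E) : c x v w = - c x w v := by
  apply (h.bijective x).1
  rw [← h.lieB_eq, lieB_swap, h.lieB_eq, map_neg]

theorem IsFrame.lieB_frame (h : IsFrame I e c) [I.Boundaryless] {φ : M → E}
    (hφ : ContMDiff I 𝓘(ℝ, E) ∞ φ) (v : E) (x : M) :
    lieB I (fun y => e y v) (fun y => e y (φ y)) x = e x (c x v (φ x) + frameDeriv I e φ x v) := by
  have := FiniteDimensional.complete ℝ E
  rw [_root_.lieB_frame (h.smooth v) h.smooth hφ, h.lieB_eq, map_add]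
  rfl

omit [IsManifold I ∞ M] [FiniteDimensional ℝ E] in
theorem frameDeriv_clm_apply [I.Boundaryless] {A : M → F →L[ℝ] F'} {x : M}
    (hA : MDifferentiableAt I 𝓘(ℝ, F →L[ℝ] F') A x) (f : F) (v : E) :
    frameDeriv I e (fun y => A y f) x v = frameDeriv I e A x v f := by
  have h := dirDeriv_clm (V := fun y => e y v) (ContinuousLinearMap.apply ℝ F' f) hA
  exact h

/-- The inner bracket has the non-constant coefficients `c y v w`, whence the derivative of `c`. -/
theorem IsFrame.lieB_lieB (h : IsFrame I e c) [I.Boundaryless] (u v w : E) (x : M) :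
    lieB I (fun y => e y u) (lieB I (fun y => e y v) (fun y => e y w)) x
      = e x (c x u (c x v w) + frameDeriv I e c x u v w) := by
  have hc (y : M) := h.smooth_coeff.contMDiffAt (x := y)
  have hcv : ContMDiff I 𝓘(ℝ, E →L[ℝ] E) ∞ (fun y => c y v) := fun y =>
    (hc y).clm_apply contMDiffAt_const
  have hcvw : ContMDiff I 𝓘(ℝ, E) ∞ (fun y => c y v w) := fun y =>
    (hcv y).clm_apply contMDiffAt_const
  have h1 : lieB I (fun y => e y v) (fun y => e y w) = fun y => e y (c y v w) :=
    funext fun y => h.lieB_eq v w y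
  rw [h1, h.lieB_frame hcvw,
    frameDeriv_clm_apply (A := fun y => c y v) ((hcv x).mdifferentiableAt (by simp)),
    frameDeriv_clm_apply ((hc x).mdifferentiableAt (by simp))]

omit [FiniteDimensional ℝ E] in
theorem IsFrame.frameDeriv_skew (h : IsFrame I e c) [I.Boundaryless] (u v w : E) (x : M) :
    frameDeriv I e c x u v w = - frameDeriv I e c x u w v := by
  have hc := h.smooth_coeff.contMDiffAt (x := x)
  have hcv (v : E) : ContMDiffAt I 𝓘(ℝ, E →L[ℝ] E) ∞ (fun y => c y v) x :=
    hc.clm_apply contMDiffAt_const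
  have hd := hc.mdifferentiableAt (n := ∞) (by simp)
  have hdv (v : E) := (hcv v).mdifferentiableAt (n := ∞) (by simp)
  rw [← frameDeriv_clm_apply hd, ← frameDeriv_clm_apply (A := fun y => c y v) (hdv v),
    ← frameDeriv_clm_apply hd, ← frameDeriv_clm_apply (A := fun y => c y w) (hdv w)]
  have h1 : (fun y => c y v w) = fun y => (-(1 : ℝ)) • c y w v :=
    funext fun y => by rw [h.skew]; simp
  have h2 := dirDeriv_clm (V := fun y => e y u) ((-(1 : ℝ)) • ContinuousLinearMap.id ℝ E)
    (((hcv w).clm_apply (contMDiffAt_const (c := v))).mdifferentiableAt (by simp))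
  rw [h1]
  refine h2.trans ?_
  simp [frameDeriv, dirDeriv]

/-- The Jacobi identity for a frame. -/
theorem IsFrame.jacobi (h : IsFrame I e c) [I.Boundaryless] (u v w : E) (x : M) :
    frameDeriv I e c x u v w + frameDeriv I e c x v w u + frameDeriv I e c x w u v
      + (c x u (c x v w) + c x v (c x w u) + c x w (c x u v)) = 0 := by
  have := FiniteDimensional.complete ℝ E
  have h1 := jacobi_lieB (h.smooth u) (h.smooth v) (h.smooth w) x
  rw [lieB_swap (lieB I _ _), h.lieB_lieB, h.lieB_lieB, h.lieB_lieB, ← map_neg, ← map_add] at h1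
  have h2 := (h.bijective x).1 h1
  rw [h.skew x w u, h.frameDeriv_skew v w u, map_neg]
  refine Eq.trans ?_ (sub_eq_zero.2 h2)
  abel

end FrameOnManifold

/-! ### Framed groupoids: the connection and the bracket in coefficients -/

namespace Gpd

section Framed

variable {EG HG EN HN EM HM EH F G N M : Type*}
  [NormedAddCommGroup EG] [NormedSpace ℝ EG] [FiniteDimensional ℝ EG] [TopologicalSpace HG]
  [NormedAddCommGroup EN] [NormedSpace ℝ EN] [FiniteDimensional ℝ EN] [TopologicalSpace HN]
  [NormedAddCommGroup EM] [NormedSpace ℝ EM] [FiniteDimensional ℝ EM] [TopologicalSpace HM]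
  [NormedAddCommGroup EH] [NormedSpace ℝ EH] [FiniteDimensional ℝ EH]
  [NormedAddCommGroup F] [NormedSpace ℝ F] [FiniteDimensional ℝ F]
  {IG : ModelWithCorners ℝ EG HG} {IN : ModelWithCorners ℝ EN HN} {IM : ModelWithCorners ℝ EM HM}
  [TopologicalSpace G] [ChartedSpace HG G] [IsManifold IG ∞ G]
  [TopologicalSpace N] [ChartedSpace HN N] [IsManifold IN ∞ N]
  [TopologicalSpace M] [ChartedSpace HM M] [IsManifold IM ∞ M]

variable (IG IN) in
/-- The connection `nabla`, on functions with values in the model spaces. -/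
def nab (𝒢 : Gpd G N) (D : ∀ g : G, Submodule ℝ (TangentSpace IG g)) (V : N → EN) (ν : N → EG) :
    N → EG :=
  𝒢.nabla IG IN D V ν

variable (IG) in
/-- The bracket of the Lie algebroid, on functions with values in the model space. -/
def brk (𝒢 : Gpd G N) (ν μ : N → EG) : N → EG := 𝒢.bracket IG ν μ

variable (IG IN) in
/-- The anchor, on functions with values in the model spaces. -/
def anc (𝒢 : Gpd G N) (ν : N → EG) : N → EN := 𝒢.anchor IG IN ν

variable (IG IN IM) in
/-- A Lie groupoid `𝒢 ⇉ N` with a distribution `D`, together with frames of `TN` and of the Lie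
algebroid, and a map `pr` to a manifold `M` with a frame `e`, such that the brackets and the
connection are determined by the structure functions `c` of `e` and by a constant bracket `k`. -/
structure IsFramed (𝒢 : Gpd G N) (D : ∀ g : G, Submodule ℝ (TangentSpace IG g))
    (e : M → EM →ₗ[ℝ] EM) (c : M → EM →L[ℝ] EM →L[ℝ] EM) (k : EH →L[ℝ] EH →L[ℝ] EH)
    (pr : N → M) (eB : N → EM × F →ₗ[ℝ] EN) (eA : N → EM × EH →ₗ[ℝ] EG)
    (τ : N → EH →ₗ[ℝ] F) (HB : G → EM × F →ₗ[ℝ] EG) (LA : G → EM × EH →ₗ[ℝ] EG) : Prop where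
  lie : 𝒢.IsLieGroupoid IG IN
  frame : IsFrame IM e c
  smooth_pr : ContMDiff IN IM ∞ pr
  der_pr : ∀ y v, der IN IM pr y (eB y v) = e (pr y) v.1
  smooth_eB : ∀ v, SmoothField IN (fun y => eB y v)
  bijective_eB : ∀ y, Function.Bijective (eB y)
  smooth_eA : ∀ n y, SmoothAlongAt IG IN 𝒢.unit (fun y => eA y n) y
  injective_eA : ∀ y, Function.Injective (eA y)
  vertical_eA : ∀ y n, der IG IN 𝒢.tgt (𝒢.unit y) (eA y n) = 0
  exists_eA : ∀ y w, der IG IN 𝒢.tgt (𝒢.unit y) w = 0 → ∃ n, eA y n = w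
  anchor_eA : ∀ y n, der IG IN 𝒢.src (𝒢.unit y) (eA y n) = eB y (n.1, τ y n.2)
  lieB_eB : ∀ v w y, lieB IN (fun y => eB y v) (fun y => eB y w) y
    = eB y (c (pr y) v.1 w.1, 0)
  smooth_HB : ∀ v, SmoothField IG (fun g => HB g v)
  smooth_LA : ∀ n, SmoothField IG (fun g => LA g n)
  hor_eq : ∀ v g, (𝒢.hor IG IN D (fun y => eB y v) g : EG) = HB g v
  leftInv_eq : ∀ n g, (𝒢.leftInv IG (fun y => eA y n) g : EG) = LA g n
  HB_unit : ∀ y v, HB (𝒢.unit y) v = der IN IG 𝒢.unit y (eB y v)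
  LA_unit : ∀ y n, LA (𝒢.unit y) n = eA y n
  lieB_LA : ∀ n m y, lieB IG (fun g => LA g n) (fun g => LA g m) (𝒢.unit y)
    = eA y (c (pr y) n.1 m.1, k n.2 m.2)
  lieB_HB_LA : ∀ v n y, lieB IG (fun g => HB g v) (fun g => LA g n) (𝒢.unit y)
    = eA y (c (pr y) v.1 n.1, 0)

namespace IsFramed

variable {𝒢 : Gpd G N} {D : ∀ g : G, Submodule ℝ (TangentSpace IG g)}
    {e : M → EM →ₗ[ℝ] EM} {c : M → EM →L[ℝ] EM →L[ℝ] EM} {k : EH →L[ℝ] EH →L[ℝ] EH}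
    {pr : N → M} {eB : N → EM × F →ₗ[ℝ] EN} {eA : N → EM × EH →ₗ[ℝ] EG}
    {τ : N → EH →ₗ[ℝ] F} {HB : G → EM × F →ₗ[ℝ] EG} {LA : G → EM × EH →ₗ[ℝ] EG}
  [IG.Boundaryless] [IN.Boundaryless] [IM.Boundaryless]
  (h : IsFramed IG IN IM 𝒢 D e c k pr eB eA τ HB LA)

include h

set_option linter.unusedSectionVars false

theorem der_src_LA (y : N) (n : EM × EH) :
    der IG IN 𝒢.src (𝒢.unit y) (LA (𝒢.unit y) n) = eB y (n.1, τ y n.2) := by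
  rw [h.LA_unit, h.anchor_eA]

/-- At a unit the horizontal frame is tangent to the submanifold of units, on which the source
inverts the unit map. -/
theorem der_src_HB (y : N) (v : EM × F) :
    der IG IN 𝒢.src (𝒢.unit y) (HB (𝒢.unit y) v) = eB y v := by
  rw [h.HB_unit]
  exact der_leftInverse (h.lie.smooth_unit.mdifferentiableAt (by simp))
    (h.lie.smooth_src.mdifferentiableAt (by simp)) 𝒢.src_unit _

theorem der_comp_src {Y : Type*} [NormedAddCommGroup Y] [NormedSpace ℝ Y] {φ : N → Y}
    (hφ : ContMDiff IN 𝓘(ℝ, Y) ∞ φ) (y : N) (w : EG) :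
    der IG 𝓘(ℝ, Y) (fun g => φ (𝒢.src g)) (𝒢.unit y) w
      = der IN 𝓘(ℝ, Y) φ y (der IG IN 𝒢.src (𝒢.unit y) w) := by
  rw [der_comp (hφ.mdifferentiableAt (by simp)) (h.lie.smooth_src.mdifferentiableAt (by simp)),
    𝒢.src_unit]

theorem der_comp_tgt {Y : Type*} [NormedAddCommGroup Y] [NormedSpace ℝ Y] {φ : N → Y}
    (hφ : ContMDiff IN 𝓘(ℝ, Y) ∞ φ) (y : N) (w : EG) :
    der IG 𝓘(ℝ, Y) (fun g => φ (𝒢.tgt g)) (𝒢.unit y) w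
      = der IN 𝓘(ℝ, Y) φ y (der IG IN 𝒢.tgt (𝒢.unit y) w) := by
  rw [der_comp (hφ.mdifferentiableAt (by simp)) (h.lie.smooth_tgt.mdifferentiableAt (by simp)),
    𝒢.tgt_unit]

theorem smoothField_LA {n : N → EM × EH} (hn : ContMDiff IN 𝓘(ℝ, EM × EH) ∞ n) :
    SmoothField IG (fun g => LA g (n (𝒢.src g))) := fun g =>
  SmoothAlongAt.frame (fun n => h.smooth_LA n g) (hn.comp h.lie.smooth_src).contMDiffAt

theorem smoothField_HB {v : N → EM × F} (hv : ContMDiff IN 𝓘(ℝ, EM × F) ∞ v) :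
    SmoothField IG (fun g => HB g (v (𝒢.tgt g))) := fun g =>
  SmoothAlongAt.frame (fun v => h.smooth_HB v g) (hv.comp h.lie.smooth_tgt).contMDiffAt

/-- The Leibniz rule for brackets with left-invariant vector fields. -/
theorem lieB_LA_comp_src {n : N → EM × EH} (hn : ContMDiff IN 𝓘(ℝ, EM × EH) ∞ n)
    {V : G → EG} (hV : SmoothField IG V) (y : N) :
    lieB IG V (fun g => LA g (n (𝒢.src g))) (𝒢.unit y)
      = lieB IG V (fun g => LA g (n y)) (𝒢.unit y)
        + eA y (der IN 𝓘(ℝ, EM × EH) n y (der IG IN 𝒢.src (𝒢.unit y) (V (𝒢.unit y)))) := by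
  have := FiniteDimensional.complete ℝ EG
  rw [lieB_frame hV h.smooth_LA (φ := fun g => n (𝒢.src g)) (hn.comp h.lie.smooth_src),
    ← h.der_comp_src hn, h.LA_unit, 𝒢.src_unit]
  rfl

/-- The left-invariant frame is killed by the differential of the target at the units. Coefficients
pulled back along the target therefore have zero derivative along it, and may be frozen. -/
theorem lieB_LA_HB_comp_tgt {v : N → EM × F} (hv : ContMDiff IN 𝓘(ℝ, EM × F) ∞ v)
    (n : EM × EH) (y : N) :
    lieB IG (fun g => HB g (v (𝒢.tgt g))) (fun g => LA g n) (𝒢.unit y)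
      = eA y (c (pr y) (v y).1 n.1, 0) := by
  have := FiniteDimensional.complete ℝ EG
  have h1 : dirDeriv IG (fun g => LA g n) (fun g => v (𝒢.tgt g)) (𝒢.unit y) = 0 := by
    rw [dirDeriv, h.der_comp_tgt hv, h.LA_unit, h.vertical_eA, map_zero]
  rw [lieB_swap, lieB_frame (h.smooth_LA n) h.smooth_HB (φ := fun g => v (𝒢.tgt g))
    (hv.comp h.lie.smooth_tgt), h1, map_zero, add_zero, ← lieB_swap, 𝒢.tgt_unit, h.lieB_HB_LA]

/-- The horizontal lift has the coefficients `v ∘ tgt`, and the left-invariant field the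
coefficients `n ∘ src`. The former act as constants because the frame of the second field is
vertical; the latter contribute the derivative of `n` along the vector field on the base, onto which
the source maps the horizontal lift at the units. -/
theorem nab_frame {v : N → EM × F} {n : N → EM × EH} (hv : ContMDiff IN 𝓘(ℝ, EM × F) ∞ v)
    (hn : ContMDiff IN 𝓘(ℝ, EM × EH) ∞ n) (y : N) :
    𝒢.nab IG IN D (fun y => eB y (v y)) (fun y => eA y (n y)) y
      = eA y ((c (pr y) (v y).1 (n y).1, 0) + dirDeriv IN (fun y => eB y (v y)) n y) := by
  have e1 : 𝒢.nab IG IN D (fun y => eB y (v y)) (fun y => eA y (n y)) y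
      = lieB IG (fun g => HB g (v (𝒢.tgt g))) (fun g => LA g (n (𝒢.src g))) (𝒢.unit y) := by
    -- `hor` and `leftInv` at `g` use their arguments only at `tgt g` and `src g`, so that the
    -- formulas for constant coefficients apply arrow by arrow.
    have a1 : (fun g => HB g (v (𝒢.tgt g))) = 𝒢.hor IG IN D (fun y => eB y (v y)) :=
      funext fun g => (h.hor_eq (v (𝒢.tgt g)) g).symm
    have a2 : (fun g => LA g (n (𝒢.src g))) = 𝒢.leftInv IG (fun y => eA y (n y)) :=
      funext fun g => (h.leftInv_eq (n (𝒢.src g)) g).symm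
    rw [a1, a2]
    rfl
  rw [e1, h.lieB_LA_comp_src hn (h.smoothField_HB hv), h.lieB_LA_HB_comp_tgt hv, 𝒢.tgt_unit,
    h.der_src_HB, map_add]
  rfl

/-- Two applications of the Leibniz rule, one in each argument. Since the source sends a
left-invariant field at the units to the anchor of its section, the derivatives are taken along the
anchors. -/
theorem brk_frame {n m : N → EM × EH} (hn : ContMDiff IN 𝓘(ℝ, EM × EH) ∞ n)
    (hm : ContMDiff IN 𝓘(ℝ, EM × EH) ∞ m) (y : N) :
    𝒢.brk IG (fun y => eA y (n y)) (fun y => eA y (m y)) y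
      = eA y ((c (pr y) (n y).1 (m y).1, k (n y).2 (m y).2)
        + dirDeriv IN (fun y => eB y ((n y).1, τ y (n y).2)) m y
        - dirDeriv IN (fun y => eB y ((m y).1, τ y (m y).2)) n y) := by
  have e1 : 𝒢.brk IG (fun y => eA y (n y)) (fun y => eA y (m y)) y
      = lieB IG (fun g => LA g (n (𝒢.src g))) (fun g => LA g (m (𝒢.src g))) (𝒢.unit y) := by
    have a1 (n : N → EM × EH) :
        (fun g => LA g (n (𝒢.src g))) = 𝒢.leftInv IG (fun y => eA y (n y)) :=
      funext fun g => (h.leftInv_eq (n (𝒢.src g)) g).symm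
    rw [a1, a1]
    rfl
  rw [e1, h.lieB_LA_comp_src hm (h.smoothField_LA hn), lieB_swap,
    h.lieB_LA_comp_src hn (h.smooth_LA (m y)), lieB_swap (fun g => LA g (m y)), h.lieB_LA,
    𝒢.src_unit, h.der_src_LA, h.der_src_LA, map_sub, map_add]
  simp only [dirDeriv]
  abel

end IsFramed
end Framed
end Gpd

/-! ### The basic connections and the basic curvature in coefficients -/

namespace Gpd
namespace IsFramed

section

variable {EG HG EN HN EM HM EH F Y G N M : Type*}
  [NormedAddCommGroup EG] [NormedSpace ℝ EG] [FiniteDimensional ℝ EG] [TopologicalSpace HG]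
  [NormedAddCommGroup EN] [NormedSpace ℝ EN] [FiniteDimensional ℝ EN] [TopologicalSpace HN]
  [NormedAddCommGroup EM] [NormedSpace ℝ EM] [FiniteDimensional ℝ EM] [TopologicalSpace HM]
  [NormedAddCommGroup EH] [NormedSpace ℝ EH] [FiniteDimensional ℝ EH]
  [NormedAddCommGroup F] [NormedSpace ℝ F] [FiniteDimensional ℝ F]
  [NormedAddCommGroup Y] [NormedSpace ℝ Y]
  {IG : ModelWithCorners ℝ EG HG} {IN : ModelWithCorners ℝ EN HN} {IM : ModelWithCorners ℝ EM HM}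
  [TopologicalSpace G] [ChartedSpace HG G] [IsManifold IG ∞ G]
  [TopologicalSpace N] [ChartedSpace HN N] [IsManifold IN ∞ N]
  [TopologicalSpace M] [ChartedSpace HM M] [IsManifold IM ∞ M]
  {𝒢 : Gpd G N} {D : ∀ g : G, Submodule ℝ (TangentSpace IG g)}
    {e : M → EM →ₗ[ℝ] EM} {c : M → EM →L[ℝ] EM →L[ℝ] EM} {k : EH →L[ℝ] EH →L[ℝ] EH}
    {pr : N → M} {eB : N → EM × F →ₗ[ℝ] EN} {eA : N → EM × EH →ₗ[ℝ] EG}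
    {τ : N → EH →ₗ[ℝ] F} {HB : G → EM × F →ₗ[ℝ] EG} {LA : G → EM × EH →ₗ[ℝ] EG}
  [IG.Boundaryless] [IN.Boundaryless] [IM.Boundaryless]

set_option linter.unusedSectionVars false

/-- The coefficients of a tangent vector with respect to the frame. -/
def coeffB (h : IsFramed IG IN IM 𝒢 D e c k pr eB eA τ HB LA) (y : N) : EN →ₗ[ℝ] EM × F :=
  (LinearEquiv.ofBijective (eB y) (h.bijective_eB y)).symm.toLinearMap

/-- The part of the coefficients of a tangent vector that is determined by its projection. -/
def theta (h : IsFramed IG IN IM 𝒢 D e c k pr eB eA τ HB LA) (y : N) : EN →ₗ[ℝ] EM :=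
  LinearMap.fst ℝ EM F ∘ₗ h.coeffB y

/-- The anchor of the section with the given coefficients. -/
def rho (_ : IsFramed IG IN IM 𝒢 D e c k pr eB eA τ HB LA) (n₁ : N → EM) (n₂ : N → EH) (y : N) :
    EN :=
  eB y (n₁ y, τ y (n₂ y))

variable (h : IsFramed IG IN IM 𝒢 D e c k pr eB eA τ HB LA)

include h

theorem eB_coeffB (y : N) (v : EN) : eB y (h.coeffB y v) = v :=
  (LinearEquiv.ofBijective (eB y) (h.bijective_eB y)).apply_symm_apply v

theorem coeffB_eB (y : N) (v : EM × F) : h.coeffB y (eB y v) = v :=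
  (LinearEquiv.ofBijective (eB y) (h.bijective_eB y)).symm_apply_apply v

theorem theta_eB (y : N) (v : EM × F) : h.theta y (eB y v) = v.1 :=
  congrArg Prod.fst (h.coeffB_eB y v)

theorem der_pr_eq (y : N) (v : EN) : der IN IM pr y v = e (pr y) (h.theta y v) := by
  have h1 := h.der_pr y (h.coeffB y v)
  rwa [h.eB_coeffB] at h1

theorem contMDiff_coeffB {V : N → EN} (hV : SmoothField IN V) :
    ContMDiff IN 𝓘(ℝ, EM × F) ∞ (fun y => h.coeffB y (V y)) := fun y =>
  SmoothAlongAt.coeff (fun v => h.smooth_eB v y) (h.bijective_eB y).1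
    ((hV y).congr rfl (funext fun y => h.eB_coeffB y (V y)))

theorem contMDiff_theta {V : N → EN} (hV : SmoothField IN V) :
    ContMDiff IN 𝓘(ℝ, EM) ∞ (fun y => h.theta y (V y)) := fun y =>
  (ContinuousLinearMap.fst ℝ EM F).contMDiff.contMDiffAt.comp y (h.contMDiff_coeffB hV y)

omit h in
theorem contMDiff_pair {n₁ : N → EM} {n₂ : N → EH} (h₁ : ContMDiff IN 𝓘(ℝ, EM) ∞ n₁)
    (h₂ : ContMDiff IN 𝓘(ℝ, EH) ∞ n₂) : ContMDiff IN 𝓘(ℝ, EM × EH) ∞ (fun y => (n₁ y, n₂ y)) :=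
  h₁.prodMk_space h₂

theorem smoothAlong_eA {n₁ : N → EM} {n₂ : N → EH} (h₁ : ContMDiff IN 𝓘(ℝ, EM) ∞ n₁)
    (h₂ : ContMDiff IN 𝓘(ℝ, EH) ∞ n₂) (y : N) :
    SmoothAlongAt IG IN 𝒢.unit (fun y => eA y (n₁ y, n₂ y)) y :=
  SmoothAlongAt.frame (fun v => h.smooth_eA v y) (contMDiff_pair h₁ h₂ y)

theorem anc_eq (n₁ : N → EM) (n₂ : N → EH) :
    𝒢.anc IG IN (fun y => eA y (n₁ y, n₂ y)) = h.rho n₁ n₂ :=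
  funext fun y => h.anchor_eA y (n₁ y, n₂ y)

theorem smoothField_rho {n₁ : N → EM} {n₂ : N → EH} (h₁ : ContMDiff IN 𝓘(ℝ, EM) ∞ n₁)
    (h₂ : ContMDiff IN 𝓘(ℝ, EH) ∞ n₂) : SmoothField IN (h.rho n₁ n₂) := fun y =>
  ((h.smoothAlong_eA h₁ h₂ y).map h.lie.smooth_src.contMDiffAt).congr
    (funext fun y => (𝒢.src_unit y).symm) (h.anc_eq n₁ n₂).symm

/-- The anchor of a coefficient in `EH` lies in the `F`-directions, which `theta` forgets. For this
reason the action of the group does not enter the equations along `M`. -/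
theorem theta_rho (n₁ : N → EM) (n₂ : N → EH) (y : N) : h.theta y (h.rho n₁ n₂ y) = n₁ y :=
  h.theta_eB y _

omit h in
theorem dirDeriv_pair {V : N → EN} {n₁ : N → EM} {n₂ : N → EH}
    (h₁ : ContMDiff IN 𝓘(ℝ, EM) ∞ n₁) (h₂ : ContMDiff IN 𝓘(ℝ, EH) ∞ n₂) (y : N) :
    dirDeriv IN V (fun y => (n₁ y, n₂ y)) y = (dirDeriv IN V n₁ y, dirDeriv IN V n₂ y) := by
  have h' := (contMDiff_pair h₁ h₂).mdifferentiableAt (x := y) (by simp)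
  exact Prod.ext (dirDeriv_clm (ContinuousLinearMap.fst ℝ EM EH) h').symm
    (dirDeriv_clm (ContinuousLinearMap.snd ℝ EM EH) h').symm

theorem nab_eq {V : N → EN} {n₁ : N → EM} {n₂ : N → EH} (hV : SmoothField IN V)
    (h₁ : ContMDiff IN 𝓘(ℝ, EM) ∞ n₁) (h₂ : ContMDiff IN 𝓘(ℝ, EH) ∞ n₂) :
    𝒢.nab IG IN D V (fun y => eA y (n₁ y, n₂ y))
      = fun y => eA y (c (pr y) (h.theta y (V y)) (n₁ y) + dirDeriv IN V n₁ y,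
          dirDeriv IN V n₂ y) := by
  funext y
  have h1 := h.nab_frame (h.contMDiff_coeffB hV) (contMDiff_pair h₁ h₂) y
  have h2 : (fun y => eB y (h.coeffB y (V y))) = V := funext fun y => h.eB_coeffB y (V y)
  rw [h2, dirDeriv_pair h₁ h₂, Prod.mk_add_mk, zero_add] at h1
  exact h1

theorem brk_eq {n₁ m₁ : N → EM} {n₂ m₂ : N → EH} (h₁ : ContMDiff IN 𝓘(ℝ, EM) ∞ n₁)
    (h₂ : ContMDiff IN 𝓘(ℝ, EH) ∞ n₂) (h₁' : ContMDiff IN 𝓘(ℝ, EM) ∞ m₁)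
    (h₂' : ContMDiff IN 𝓘(ℝ, EH) ∞ m₂) :
    𝒢.brk IG (fun y => eA y (n₁ y, n₂ y)) (fun y => eA y (m₁ y, m₂ y))
      = fun y => eA y
        (c (pr y) (n₁ y) (m₁ y) + dirDeriv IN (h.rho n₁ n₂) m₁ y - dirDeriv IN (h.rho m₁ m₂) n₁ y,
          k (n₂ y) (m₂ y) + dirDeriv IN (h.rho n₁ n₂) m₂ y - dirDeriv IN (h.rho m₁ m₂) n₂ y) := by
  funext y
  have h1 := h.brk_frame (contMDiff_pair h₁ h₂) (contMDiff_pair h₁' h₂') y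
  rw [dirDeriv_pair h₁ h₂, dirDeriv_pair h₁' h₂', Prod.mk_add_mk, Prod.mk_sub_mk] at h1
  exact h1

theorem contMDiff_comp_pr {φ : M → Y} (hφ : ContMDiff IM 𝓘(ℝ, Y) ∞ φ) :
    ContMDiff IN 𝓘(ℝ, Y) ∞ (fun y => φ (pr y)) := hφ.comp h.smooth_pr

theorem dirDeriv_comp_pr {φ : M → Y} (hφ : ContMDiff IM 𝓘(ℝ, Y) ∞ φ) (V : N → EN) (y : N) :
    dirDeriv IN V (fun y => φ (pr y)) y = frameDeriv IM e φ (pr y) (h.theta y (V y)) := by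
  rw [dirDeriv, der_comp (hφ.mdifferentiableAt (by simp)) (h.smooth_pr.mdifferentiableAt (by simp)),
    h.der_pr_eq]
  rfl

variable {b : M → EM →L[ℝ] EM →L[ℝ] EM} (hb : ContMDiff IM 𝓘(ℝ, EM →L[ℝ] EM →L[ℝ] EM) ∞ b)

include hb

theorem contMDiff_bilin {p q : N → EM} (hp : ContMDiff IN 𝓘(ℝ, EM) ∞ p)
    (hq : ContMDiff IN 𝓘(ℝ, EM) ∞ q) : ContMDiff IN 𝓘(ℝ, EM) ∞ (fun y => b (pr y) (p y) (q y)) :=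
  ((h.contMDiff_comp_pr hb).clm_apply hp).clm_apply hq

theorem dirDeriv_bilin {p q : N → EM} (hp : ContMDiff IN 𝓘(ℝ, EM) ∞ p)
    (hq : ContMDiff IN 𝓘(ℝ, EM) ∞ q) (V : N → EN) (y : N) :
    dirDeriv IN V (fun y => b (pr y) (p y) (q y)) y
      = frameDeriv IM e b (pr y) (h.theta y (V y)) (p y) (q y)
        + b (pr y) (dirDeriv IN V p y) (q y) + b (pr y) (p y) (dirDeriv IN V q y) := by
  have hbp := (h.contMDiff_comp_pr hb).clm_apply hp
  rw [dirDeriv_clm_apply (A := fun y => b (pr y) (p y)) (hbp.mdifferentiableAt (by simp))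
    (hq.mdifferentiableAt (by simp)), dirDeriv_clm_apply
    ((h.contMDiff_comp_pr hb).mdifferentiableAt (by simp)) (hp.mdifferentiableAt (by simp)),
    h.dirDeriv_comp_pr hb]
  rfl

omit hb

/-- Brackets of frame fields have no `F`-component, and `c` involves only the `M`-coefficients, so
that the bracket formula closes up on `theta`. It results from the Leibniz rule in each of the two
arguments. -/
theorem theta_lieB {V W : N → EN} (hV : SmoothField IN V) (hW : SmoothField IN W) (y : N) :
    h.theta y (lieB IN V W y) = c (pr y) (h.theta y (V y)) (h.theta y (W y))
      + dirDeriv IN V (fun y => h.theta y (W y)) y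
      - dirDeriv IN W (fun y => h.theta y (V y)) y := by
  have := FiniteDimensional.complete ℝ EN
  have hv := h.contMDiff_coeffB hV
  have hw := h.contMDiff_coeffB hW
  have hV' : (fun y => eB y (h.coeffB y (V y))) = V := funext fun y => h.eB_coeffB y (V y)
  have hW' : (fun y => eB y (h.coeffB y (W y))) = W := funext fun y => h.eB_coeffB y (W y)
  have h1 := lieB_frame hV h.smooth_eB hw y
  have h2 := lieB_frame (h.smooth_eB (h.coeffB y (W y))) h.smooth_eB hv y
  rw [lieB_swap] at h2
  rw [hV', h.lieB_eB] at h2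
  rw [hW', neg_eq_iff_eq_neg.1 h2] at h1
  have e1 : (dirDeriv IN V (fun y => h.coeffB y (W y)) y).1
      = dirDeriv IN V (fun y => h.theta y (W y)) y :=
    (dirDeriv_clm (ContinuousLinearMap.fst ℝ EM F) (hw.mdifferentiableAt (x := y) (by simp))).symm
  have e2 : (dirDeriv IN (fun z => eB z (h.coeffB y (W y))) (fun y => h.coeffB y (V y)) y).1
      = dirDeriv IN W (fun y => h.theta y (V y)) y := by
    refine (dirDeriv_clm (ContinuousLinearMap.fst ℝ EM F)
      (hv.mdifferentiableAt (x := y) (by simp))).symm.trans ?_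
    rw [dirDeriv, dirDeriv, h.eB_coeffB]
    rfl
  have e3 (U : N → EN) : (h.coeffB y (U y)).1 = h.theta y (U y) := rfl
  rw [h1, map_add, map_neg, map_add, h.theta_eB, h.theta_eB, h.theta_eB, e1, e2, e3, e3,
    h.frame.skew, neg_add, neg_neg]
  abel

/-- The coefficients of `∇^bas_ν V`, where `ν` has the coefficients `n`. -/
theorem theta_basicT {V : N → EN} {n₁ : N → EM} {n₂ : N → EH} (hV : SmoothField IN V)
    (h₁ : ContMDiff IN 𝓘(ℝ, EM) ∞ n₁) (h₂ : ContMDiff IN 𝓘(ℝ, EH) ∞ n₂) (y : N) :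
    h.theta y ((𝒢.anc IG IN (𝒢.nab IG IN D V (fun y => eA y (n₁ y, n₂ y)))
      + lieB IN (𝒢.anc IG IN (fun y => eA y (n₁ y, n₂ y))) V) y)
      = dirDeriv IN (h.rho n₁ n₂) (fun y => h.theta y (V y)) y := by
  rw [h.nab_eq hV h₁ h₂, h.anc_eq, h.anc_eq, Pi.add_apply, map_add, h.theta_rho,
    h.theta_lieB (h.smoothField_rho h₁ h₂) hV]
  simp only [h.theta_rho]
  -- The term with `c` from the connection is opposite to the one from the bracket. What remains is
  -- the derivative of the coefficients of `V` along the anchor: in the frame, the basic connection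
  -- is plain differentiation.
  rw [h.frame.skew _ (n₁ y)]
  abel

theorem smoothField_basicT {V : N → EN} {n₁ : N → EM} {n₂ : N → EH} (hV : SmoothField IN V)
    (h₁ : ContMDiff IN 𝓘(ℝ, EM) ∞ n₁) (h₂ : ContMDiff IN 𝓘(ℝ, EH) ∞ n₂) :
    SmoothField IN (𝒢.anc IG IN (𝒢.nab IG IN D V (fun y => eA y (n₁ y, n₂ y)))
      + lieB IN (𝒢.anc IG IN (fun y => eA y (n₁ y, n₂ y))) V) := by
  have := FiniteDimensional.complete ℝ EN
  have hr := h.smoothField_rho h₁ h₂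
  rw [h.nab_eq hV h₁ h₂, h.anc_eq, h.anc_eq]
  have a := h.smoothField_rho ((h.contMDiff_bilin h.frame.smooth_coeff (h.contMDiff_theta hV)
    h₁).add fun y => hV.dirDeriv (h₁ y)) fun y => hV.dirDeriv (h₂ y)
  have hl := hr.lieB hV
  intro y
  refine (SmoothAlongAt.frame (b := eB) (φ := fun y => h.coeffB y _ + h.coeffB y _)
    (fun v => h.smooth_eB v y) ((h.contMDiff_coeffB a y).add (h.contMDiff_coeffB hl y))).congr
    rfl (funext fun y => ?_)
  rw [map_add, h.eB_coeffB, h.eB_coeffB]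
  rfl

/-- The derivative along `∇^bas_ν V`. -/
theorem dirDeriv_basicT {V : N → EN} {n₁ : N → EM} {n₂ : N → EH} (hV : SmoothField IN V)
    (h₁ : ContMDiff IN 𝓘(ℝ, EM) ∞ n₁) (h₂ : ContMDiff IN 𝓘(ℝ, EH) ∞ n₂)
    {φ : N → Y} (hφ : ContMDiff IN 𝓘(ℝ, Y) ∞ φ) (y : N) :
    dirDeriv IN (𝒢.anc IG IN (𝒢.nab IG IN D V (fun y => eA y (n₁ y, n₂ y)))
      + lieB IN (𝒢.anc IG IN (fun y => eA y (n₁ y, n₂ y))) V) φ y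
      = dirDeriv IN (𝒢.anc IG IN (𝒢.nab IG IN D V (fun y => eA y (n₁ y, n₂ y)))) φ y
        + (dirDeriv IN (h.rho n₁ n₂) (dirDeriv IN V φ) y
          - dirDeriv IN V (dirDeriv IN (h.rho n₁ n₂) φ) y) := by
  have := FiniteDimensional.complete ℝ EN
  have hr := h.smoothField_rho h₁ h₂
  rw [← dirDeriv_lieB (hφ y) (hr y) (hV y) (hr.dirDeriv (hφ y)) (hV.dirDeriv (hφ y)), ← h.anc_eq]
  exact map_add _ _ _

/-- Along `M`, the second derivatives and the derivatives of the coefficients cancel, and what is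
left is the Jacobi expression for the coefficients of `V` and of the two sections. In `EH` the
connection is plain differentiation and `k` is constant, so that the product rule for `k` and
commutators of derivatives cancel everything. -/
theorem basicCurvature_frame {V : N → EN} {n₁ m₁ : N → EM} {n₂ m₂ : N → EH}
    (hV : SmoothField IN V) (h₁ : ContMDiff IN 𝓘(ℝ, EM) ∞ n₁) (h₂ : ContMDiff IN 𝓘(ℝ, EH) ∞ n₂)
    (h₁' : ContMDiff IN 𝓘(ℝ, EM) ∞ m₁) (h₂' : ContMDiff IN 𝓘(ℝ, EH) ∞ m₂) (y : N) :
    𝒢.basicCurvature IG IN D (fun y => eA y (n₁ y, n₂ y)) (fun y => eA y (m₁ y, m₂ y)) V y = 0 := by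
  let ν : N → EG := fun y => eA y (n₁ y, n₂ y)
  let μ : N → EG := fun y => eA y (m₁ y, m₂ y)
  change 𝒢.nab IG IN D V (𝒢.brk IG ν μ) y - 𝒢.brk IG (𝒢.nab IG IN D V ν) μ y
    - 𝒢.brk IG ν (𝒢.nab IG IN D V μ) y
    - 𝒢.nab IG IN D (𝒢.anc IG IN (𝒢.nab IG IN D V μ) + lieB IN (𝒢.anc IG IN μ) V) ν y
    + 𝒢.nab IG IN D (𝒢.anc IG IN (𝒢.nab IG IN D V ν) + lieB IN (𝒢.anc IG IN ν) V) μ y = 0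
  have hc := h.frame.smooth_coeff
  have hθ := h.contMDiff_theta hV
  have hn := h.smoothField_rho h₁ h₂
  have hm := h.smoothField_rho h₁' h₂'
  have L {U : N → EN} (hU : SmoothField IN U) {φ : N → EM} (hφ : ContMDiff IN 𝓘(ℝ, EM) ∞ φ) :
    ContMDiff IN 𝓘(ℝ, EM) ∞ (dirDeriv IN U φ) := fun y => hU.dirDeriv (hφ y)
  have L' {U : N → EN} (hU : SmoothField IN U) {φ : N → EH} (hφ : ContMDiff IN 𝓘(ℝ, EH) ∞ φ) :
    ContMDiff IN 𝓘(ℝ, EH) ∞ (dirDeriv IN U φ) := fun y => hU.dirDeriv (hφ y)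
  have A {φ ψ : N → EM} (hφ : ContMDiff IN 𝓘(ℝ, EM) ∞ φ) (hψ : ContMDiff IN 𝓘(ℝ, EM) ∞ ψ) :
    ContMDiff IN 𝓘(ℝ, EM) ∞ (fun y => φ y + ψ y) := hφ.add hψ
  have A' {φ ψ : N → EH} (hφ : ContMDiff IN 𝓘(ℝ, EH) ∞ φ) (hψ : ContMDiff IN 𝓘(ℝ, EH) ∞ ψ) :
    ContMDiff IN 𝓘(ℝ, EH) ∞ (fun y => φ y + ψ y) := hφ.add hψ
  have S {φ ψ : N → EM} (hφ : ContMDiff IN 𝓘(ℝ, EM) ∞ φ) (hψ : ContMDiff IN 𝓘(ℝ, EM) ∞ ψ) :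
    ContMDiff IN 𝓘(ℝ, EM) ∞ (fun y => φ y - ψ y) := hφ.sub hψ
  have S' {φ ψ : N → EH} (hφ : ContMDiff IN 𝓘(ℝ, EH) ∞ φ) (hψ : ContMDiff IN 𝓘(ℝ, EH) ∞ ψ) :
    ContMDiff IN 𝓘(ℝ, EH) ∞ (fun y => φ y - ψ y) := hφ.sub hψ
  have hk : ContMDiff IN 𝓘(ℝ, EH) ∞ (fun y => k (n₂ y) (m₂ y)) :=
    ((ContinuousLinearMap.contMDiff k).comp h₂).clm_apply h₂'
  have ca := h.contMDiff_bilin hc h₁ h₁'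
  have cb := h.contMDiff_bilin hc hθ h₁
  have cb' := h.contMDiff_bilin hc hθ h₁'
  rw [h.nab_eq (h.smoothField_basicT hV h₁ h₂) h₁' h₂',
    h.nab_eq (h.smoothField_basicT hV h₁' h₂') h₁ h₂, h.brk_eq h₁ h₂ h₁' h₂',
    h.nab_eq hV (S (A ca (L hn h₁')) (L hm h₁)) (S' (A' hk (L' hn h₂')) (L' hm h₂))]
  simp only [h.theta_basicT hV h₁ h₂, h.theta_basicT hV h₁' h₂', h.dirDeriv_basicT hV h₁ h₂ h₁',
    h.dirDeriv_basicT hV h₁ h₂ h₂', h.dirDeriv_basicT hV h₁' h₂' h₁,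
    h.dirDeriv_basicT hV h₁' h₂' h₂]
  simp only [ν, μ]
  rw [h.nab_eq hV h₁ h₂, h.nab_eq hV h₁' h₂', h.anc_eq, h.anc_eq,
    h.brk_eq h₁ h₂ (A cb' (L hV h₁')) (L' hV h₂'), h.brk_eq (A cb (L hV h₁)) (L' hV h₂) h₁' h₂']
  beta_reduce
  have tn : h.theta y (h.rho n₁ n₂ y) = n₁ y := h.theta_rho n₁ n₂ y
  have tm : h.theta y (h.rho m₁ m₂ y) = m₁ y := h.theta_rho m₁ m₂ y
  have jac := h.frame.jacobi (h.theta y (V y)) (n₁ y) (m₁ y) (pr y)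
  have dm {φ : N → EM} (hφ : ContMDiff IN 𝓘(ℝ, EM) ∞ φ) : MDifferentiableAt IN 𝓘(ℝ, EM) φ y :=
    hφ.mdifferentiableAt (by simp)
  have dm' {φ : N → EH} (hφ : ContMDiff IN 𝓘(ℝ, EH) ∞ φ) : MDifferentiableAt IN 𝓘(ℝ, EH) φ y :=
    hφ.mdifferentiableAt (by simp)
  -- As `k` does not depend on the point, differentiating it produces no analogue of the derivative
  -- of `c`, and hence no Jacobi identity for `k` is required.
  have dk : dirDeriv IN V (fun y => k (n₂ y) (m₂ y)) y
      = k (dirDeriv IN V n₂ y) (m₂ y) + k (n₂ y) (dirDeriv IN V m₂ y) := by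
    rw [dirDeriv_clm_apply (A := fun y => k (n₂ y))
      (((ContinuousLinearMap.contMDiff k).comp h₂).mdifferentiableAt (n := ∞) (by simp)) (dm' h₂'),
      dirDeriv_clm k (dm' h₂)]
  simp only [← map_sub, ← map_add, Prod.mk_add_mk, Prod.mk_sub_mk]
  refine (congrArg (eA y) (Prod.ext ?_ ?_)).trans (map_zero (eA y))
  · dsimp only
    rw [dirDeriv_sub (dm (A ca (L hn h₁'))) (dm (L hm h₁)), dirDeriv_add (dm ca) (dm (L hn h₁')),
      dirDeriv_add (dm cb) (dm (L hV h₁)), dirDeriv_add (dm cb') (dm (L hV h₁')),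
      h.dirDeriv_bilin hc h₁ h₁', h.dirDeriv_bilin hc hθ h₁, h.dirDeriv_bilin hc hθ h₁', tn, tm]
    simp only [map_add, map_sub, add_apply]
    rw [h.frame.frameDeriv_skew (n₁ y) (h.theta y (V y)), h.frame.skew _ (c _ _ _) (m₁ y),
      h.frame.skew _ (h.theta y (V y)) (m₁ y), map_neg]
    refine Eq.trans ?_ jac
    abel
  · dsimp only
    rw [dirDeriv_sub (dm' (A' hk (L' hn h₂'))) (dm' (L' hm h₂)),
      dirDeriv_add (dm' hk) (dm' (L' hn h₂')), dk]
    change _ = (0 : EH)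
    abel

end

end IsFramed
end Gpd

/-! ### The equations for the coefficients of a strict primitive -/

section

variable {E H M : Type*} [NormedAddCommGroup E] [NormedSpace ℝ E] [FiniteDimensional ℝ E]
  [TopologicalSpace H] {I : ModelWithCorners ℝ E H} [TopologicalSpace M] [ChartedSpace H M]

variable (I) in
/-- The conditions on the coefficients `z` of a form for a strict covariant adjustment. -/
structure IsStrictPrimitive (e : M → E →ₗ[ℝ] E) (c z : M → E →L[ℝ] E →L[ℝ] E) : Prop where
  smooth : ContMDiff I 𝓘(ℝ, E →L[ℝ] E →L[ℝ] E) ∞ z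
  alternating : ∀ x v, z x v v = 0
  frameDeriv_eq : ∀ x, frameDeriv I e z x = frameDeriv I e c x
  cyclic : ∀ x v₁ v₂ v₃, frameDeriv I e z x v₁ v₂ v₃ - frameDeriv I e z x v₂ v₁ v₃
        + frameDeriv I e z x v₃ v₁ v₂ + c x v₁ (z x v₂ v₃)
        - c x v₂ (z x v₁ v₃) + c x v₃ (z x v₁ v₂)
        - z x (c x v₁ v₂) v₃ + z x (c x v₁ v₃) v₂ - z x (c x v₂ v₃) v₁
      = z x v₁ (z x v₂ v₃) + z x v₂ (z x v₃ v₁) + z x v₃ (z x v₁ v₂)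

/-- The derivative condition is trivial for `z = c`. By skew-symmetry, the terms quadratic in `c`
make up twice their cyclic sum on the left of the last equation and once on the right. The
difference of the two sides is therefore the Jacobi expression. -/
theorem IsFrame.isStrictPrimitive [IsManifold I ∞ M] [I.Boundaryless] {e : M → E →ₗ[ℝ] E}
    {c : M → E →L[ℝ] E →L[ℝ] E} (h : IsFrame I e c) : IsStrictPrimitive I e c c where
  smooth := h.smooth_coeff
  alternating x v := by
    have h2 : (2 : ℝ) • c x v v = 0 := by
      rw [two_smul]
      nth_rewrite 1 [h.skew]
      exact neg_add_cancel _
    exact (smul_eq_zero.1 h2).resolve_left two_ne_zero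
  frameDeriv_eq _ := rfl
  cyclic x v₁ v₂ v₃ := by
    have jac := h.jacobi v₁ v₂ v₃ x
    rw [h.frameDeriv_skew v₂ v₁ v₃, h.skew x v₃ v₁, h.skew x v₁ v₃, h.skew x (c x v₁ v₂),
      h.skew x (c x _ _) v₁]
    simp only [map_neg, neg_apply] at jac ⊢
    rw [h.skew x (c x v₃ v₁) v₂]
    have jac' := h.jacobi v₁ v₂ v₃ x
    refine sub_eq_zero.1 (Eq.trans ?_ jac')
    abel

end

/-! ### Curvature, forms and strict covariant adjustments of framed groupoids -/

namespace Gpd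
namespace IsFramed

section

variable {EG HG EN HN EM HM EH F Y G N M : Type*}
  [NormedAddCommGroup EG] [NormedSpace ℝ EG] [FiniteDimensional ℝ EG] [TopologicalSpace HG]
  [NormedAddCommGroup EN] [NormedSpace ℝ EN] [FiniteDimensional ℝ EN] [TopologicalSpace HN]
  [NormedAddCommGroup EM] [NormedSpace ℝ EM] [FiniteDimensional ℝ EM] [TopologicalSpace HM]
  [NormedAddCommGroup EH] [NormedSpace ℝ EH] [FiniteDimensional ℝ EH]
  [NormedAddCommGroup F] [NormedSpace ℝ F] [FiniteDimensional ℝ F]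
  [NormedAddCommGroup Y] [NormedSpace ℝ Y]
  {IG : ModelWithCorners ℝ EG HG} {IN : ModelWithCorners ℝ EN HN} {IM : ModelWithCorners ℝ EM HM}
  [TopologicalSpace G] [ChartedSpace HG G] [IsManifold IG ∞ G]
  [TopologicalSpace N] [ChartedSpace HN N] [IsManifold IN ∞ N]
  [TopologicalSpace M] [ChartedSpace HM M] [IsManifold IM ∞ M]
  {𝒢 : Gpd G N} {D : ∀ g : G, Submodule ℝ (TangentSpace IG g)}
    {e : M → EM →ₗ[ℝ] EM} {c : M → EM →L[ℝ] EM →L[ℝ] EM} {k : EH →L[ℝ] EH →L[ℝ] EH}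
    {pr : N → M} {eB : N → EM × F →ₗ[ℝ] EN} {eA : N → EM × EH →ₗ[ℝ] EG}
    {τ : N → EH →ₗ[ℝ] F} {HB : G → EM × F →ₗ[ℝ] EG} {LA : G → EM × EH →ₗ[ℝ] EG}
  [IG.Boundaryless] [IN.Boundaryless] [IM.Boundaryless]

set_option linter.unusedSectionVars false

variable (h : IsFramed IG IN IM 𝒢 D e c k pr eB eA τ HB LA)

include h

omit h in
theorem contMDiff_dirDeriv {V : N → EN} (hV : SmoothField IN V) {φ : N → Y}
    (hφ : ContMDiff IN 𝓘(ℝ, Y) ∞ φ) : ContMDiff IN 𝓘(ℝ, Y) ∞ (dirDeriv IN V φ) := fun y =>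
  hV.dirDeriv (hφ y)

omit h in
theorem contMDiff_add' {φ ψ : N → Y} (hφ : ContMDiff IN 𝓘(ℝ, Y) ∞ φ)
    (hψ : ContMDiff IN 𝓘(ℝ, Y) ∞ ψ) : ContMDiff IN 𝓘(ℝ, Y) ∞ (fun y => φ y + ψ y) := hφ.add hψ

/-- The derivatives of `n₁` and `n₂` cancel against those along the bracket of `V` and `W`. The
remaining terms are the Jacobi expression for `V`, `W` and `n₁` without the derivative of `c` in the
direction `n₁`, hence equal to minus that derivative. The `EH`-part of the connection is flat. -/
theorem curvature_frame {V W : N → EN} {n₁ : N → EM} {n₂ : N → EH}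
    (hV : SmoothField IN V) (hW : SmoothField IN W) (h₁ : ContMDiff IN 𝓘(ℝ, EM) ∞ n₁)
    (h₂ : ContMDiff IN 𝓘(ℝ, EH) ∞ n₂) (y : N) :
    𝒢.curvature IG IN D V W (fun y => eA y (n₁ y, n₂ y)) y
      = eA y (- frameDeriv IM e c (pr y) (n₁ y) (h.theta y (V y)) (h.theta y (W y)), 0) := by
  have := FiniteDimensional.complete ℝ EN
  change 𝒢.nab IG IN D V (𝒢.nab IG IN D W (fun y => eA y (n₁ y, n₂ y))) y
    - 𝒢.nab IG IN D W (𝒢.nab IG IN D V (fun y => eA y (n₁ y, n₂ y))) y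
    - 𝒢.nab IG IN D (lieB IN V W) (fun y => eA y (n₁ y, n₂ y)) y = _
  have hc := h.frame.smooth_coeff
  have hθ := h.contMDiff_theta hV
  have hθ' := h.contMDiff_theta hW
  have cb := h.contMDiff_bilin hc hθ h₁
  have cb' := h.contMDiff_bilin hc hθ' h₁
  have lV := contMDiff_dirDeriv hV h₁
  have lW := contMDiff_dirDeriv hW h₁
  have dm {φ : N → EM} (hφ : ContMDiff IN 𝓘(ℝ, EM) ∞ φ) : MDifferentiableAt IN 𝓘(ℝ, EM) φ y :=
    hφ.mdifferentiableAt (by simp)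
  rw [h.nab_eq (hV.lieB hW) h₁ h₂, h.nab_eq hV h₁ h₂, h.nab_eq hW h₁ h₂,
    h.nab_eq hV (contMDiff_add' cb' lW) (contMDiff_dirDeriv hW h₂),
    h.nab_eq hW (contMDiff_add' cb lV) (contMDiff_dirDeriv hV h₂)]
  simp only [h.theta_lieB hV hW]
  rw [dirDeriv_lieB (h₁ y) (hV y) (hW y) (hV.dirDeriv (h₁ y)) (hW.dirDeriv (h₁ y)),
    dirDeriv_lieB (h₂ y) (hV y) (hW y) (hV.dirDeriv (h₂ y)) (hW.dirDeriv (h₂ y))]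
  simp only [← map_sub, Prod.mk_sub_mk]
  have jac := h.frame.jacobi (h.theta y (V y)) (h.theta y (W y)) (n₁ y) (pr y)
  refine congrArg (eA y) (Prod.ext ?_ ?_)
  · dsimp only
    rw [dirDeriv_add (dm cb') (dm lW), dirDeriv_add (dm cb) (dm lV),
      h.dirDeriv_bilin hc hθ h₁, h.dirDeriv_bilin hc hθ' h₁]
    simp only [map_add, map_sub, add_apply, sub_apply]
    rw [h.frame.frameDeriv_skew (h.theta y (W y)), h.frame.skew _ (n₁ y) (c _ _ _),
      h.frame.skew _ (n₁ y) (h.theta y (V y)), map_neg] at jac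
    refine sub_eq_zero.1 (Eq.trans ?_ jac)
    abel
  · dsimp only
    abel

variable {z : M → EM →L[ℝ] EM →L[ℝ] EM} (hz : ContMDiff IM 𝓘(ℝ, EM →L[ℝ] EM →L[ℝ] EM) ∞ z)
  {ζ : Bilin IG IN 𝒢}
  (hζ : ∀ (y : N) (v w : EN), (ζ y v w : EG) = eA y (z (pr y) (h.theta y v) (h.theta y w), 0))

section
include hζ

theorem evalForm_eq (V W : N → EN) :
    𝒢.evalForm IG IN ζ V W
      = fun y => eA y (z (pr y) (h.theta y (V y)) (h.theta y (W y)), (0 : EH)) :=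
  funext fun y => hζ y (V y) (W y)

include hz

/-- Since the basic connection differentiates `M`-coefficients along the anchor of the section, the
product rule leaves only the derivative of `z` itself; it is taken in the direction `n₁` because
`theta` of the anchor is `n₁`. -/
theorem basicForm_frame {V W : N → EN} {n₁ : N → EM} {n₂ : N → EH}
    (hV : SmoothField IN V) (hW : SmoothField IN W) (h₁ : ContMDiff IN 𝓘(ℝ, EM) ∞ n₁)
    (h₂ : ContMDiff IN 𝓘(ℝ, EH) ∞ n₂) (y : N) :
    𝒢.basicForm IG IN D ζ (fun y => eA y (n₁ y, n₂ y)) V W y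
      = eA y (frameDeriv IM e z (pr y) (n₁ y) (h.theta y (V y)) (h.theta y (W y)), 0) := by
  let ν : N → EG := fun y => eA y (n₁ y, n₂ y)
  let μ : N → EG := fun y => eA y (z (pr y) (h.theta y (V y)) (h.theta y (W y)), (0 : EH))
  have hμ : 𝒢.evalForm IG IN ζ V W = μ := h.evalForm_eq hζ V W
  let V' : N → EN := 𝒢.anc IG IN (𝒢.nab IG IN D V ν) + lieB IN (𝒢.anc IG IN ν) V
  let W' : N → EN := 𝒢.anc IG IN (𝒢.nab IG IN D W ν) + lieB IN (𝒢.anc IG IN ν) W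
  have e1 : 𝒢.basicForm IG IN D ζ ν V W y
      = 𝒢.nab IG IN D (𝒢.anc IG IN μ) ν y + 𝒢.brk IG ν μ y
        - eA y (z (pr y) (h.theta y (V' y)) (h.theta y (W y)), 0)
        - eA y (z (pr y) (h.theta y (V y)) (h.theta y (W' y)), 0) := by
    rw [← hζ, ← hζ, ← hμ]
    rfl
  have hθ := h.contMDiff_theta hV
  have hθ' := h.contMDiff_theta hW
  have cz := h.contMDiff_bilin hz hθ hθ'
  refine e1.trans ?_
  simp only [V', W', ν, μ]
  rw [h.theta_basicT hV h₁ h₂, h.theta_basicT hW h₁ h₂, h.anc_eq,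
    h.nab_eq (h.smoothField_rho cz contMDiff_const) h₁ h₂, h.brk_eq h₁ h₂ cz contMDiff_const]
  simp only [← map_sub, ← map_add, Prod.mk_sub_mk, Prod.mk_add_mk]
  refine congrArg (eA y) (Prod.ext ?_ ?_)
  · dsimp only
    rw [h.theta_rho, h.dirDeriv_bilin hz hθ hθ', h.theta_rho, h.frame.skew _ (n₁ y)]
    abel
  · dsimp only
    rw [dirDeriv_const, map_zero]
    abel

/-- The expression is tensorial: derivatives of the coefficients of the vector fields coming from
the connection cancel, by the alternation of `z`, with those coming from the Lie brackets. -/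
theorem extDeriv_frame (hza : ∀ x v, z x v v = 0) {V₁ V₂ V₃ : N → EN} (h₁ : SmoothField IN V₁) (h₂ : SmoothField IN V₂)
    (h₃ : SmoothField IN V₃) (y : N) {v₁ v₂ v₃ : EM} (e₁ : h.theta y (V₁ y) = v₁)
    (e₂ : h.theta y (V₂ y) = v₂) (e₃ : h.theta y (V₃ y) = v₃) :
    𝒢.extDeriv IG IN D ζ V₁ V₂ V₃ y
      = eA y (frameDeriv IM e z (pr y) v₁ v₂ v₃ - frameDeriv IM e z (pr y) v₂ v₁ v₃
        + frameDeriv IM e z (pr y) v₃ v₁ v₂ + c (pr y) v₁ (z (pr y) v₂ v₃)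
        - c (pr y) v₂ (z (pr y) v₁ v₃) + c (pr y) v₃ (z (pr y) v₁ v₂)
        - z (pr y) (c (pr y) v₁ v₂) v₃ + z (pr y) (c (pr y) v₁ v₃) v₂
        - z (pr y) (c (pr y) v₂ v₃) v₁, 0) := by
  have hθ₁ := h.contMDiff_theta h₁
  have hθ₂ := h.contMDiff_theta h₂
  have hθ₃ := h.contMDiff_theta h₃
  have e0 : 𝒢.extDeriv IG IN D ζ V₁ V₂ V₃ y
      = 𝒢.nab IG IN D V₁ (𝒢.evalForm IG IN ζ V₂ V₃) y
        - 𝒢.nab IG IN D V₂ (𝒢.evalForm IG IN ζ V₁ V₃) y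
        + 𝒢.nab IG IN D V₃ (𝒢.evalForm IG IN ζ V₁ V₂) y
        - eA y (z (pr y) (h.theta y (lieB IN V₁ V₂ y)) (h.theta y (V₃ y)), 0)
        + eA y (z (pr y) (h.theta y (lieB IN V₁ V₃ y)) (h.theta y (V₂ y)), 0)
        - eA y (z (pr y) (h.theta y (lieB IN V₂ V₃ y)) (h.theta y (V₁ y)), 0) := by
    rw [← hζ, ← hζ, ← hζ]
    rfl
  have zs (x : M) (v w : EM) : z x v w = - z x w v := by
    have h0 := hza x (v + w)
    rw [map_add, map_add, add_apply, add_apply, hza, hza, zero_add, add_zero] at h0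
    exact eq_neg_of_add_eq_zero_right h0
  refine e0.trans ?_
  rw [h.evalForm_eq hζ, h.evalForm_eq hζ, h.evalForm_eq hζ,
    h.nab_eq h₁ (h.contMDiff_bilin hz hθ₂ hθ₃) contMDiff_const,
    h.nab_eq h₂ (h.contMDiff_bilin hz hθ₁ hθ₃) contMDiff_const,
    h.nab_eq h₃ (h.contMDiff_bilin hz hθ₁ hθ₂) contMDiff_const,
    h.theta_lieB h₁ h₂, h.theta_lieB h₁ h₃, h.theta_lieB h₂ h₃]
  simp only [← map_sub, ← map_add, Prod.mk_sub_mk, Prod.mk_add_mk]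
  refine congrArg (eA y) (Prod.ext ?_ ?_)
  · dsimp only
    rw [h.dirDeriv_bilin hz hθ₂ hθ₃, h.dirDeriv_bilin hz hθ₁ hθ₃, h.dirDeriv_bilin hz hθ₁ hθ₂]
    simp only [e₁, e₂, e₃, map_add, map_sub, add_apply, sub_apply]
    rw [zs _ v₁ (dirDeriv _ _ _ _), zs _ v₁ (dirDeriv _ _ _ _), zs _ v₂ (dirDeriv _ _ _ _)]
    abel
  · dsimp only
    simp only [dirDeriv_const]
    abel

end

include hζ in
-- A value of the form has no `EH`-part, and `theta` of its anchor is its `M`-coefficient; so the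
-- nested terms are iterates of `z`.
theorem cyclic_evalForm (V₁ V₂ V₃ : N → EN) (y : N) :
    (𝒢.evalForm IG IN ζ V₁ (𝒢.anchor IG IN (𝒢.evalForm IG IN ζ V₂ V₃)) y
      + 𝒢.evalForm IG IN ζ V₂ (𝒢.anchor IG IN (𝒢.evalForm IG IN ζ V₃ V₁)) y
      + 𝒢.evalForm IG IN ζ V₃ (𝒢.anchor IG IN (𝒢.evalForm IG IN ζ V₁ V₂)) y : EG)
      = eA y (z (pr y) (h.theta y (V₁ y)) (z (pr y) (h.theta y (V₂ y)) (h.theta y (V₃ y)))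
        + z (pr y) (h.theta y (V₂ y)) (z (pr y) (h.theta y (V₃ y)) (h.theta y (V₁ y)))
        + z (pr y) (h.theta y (V₃ y)) (z (pr y) (h.theta y (V₁ y)) (h.theta y (V₂ y))), 0) := by
  have h1 (U V W : N → EN) : (𝒢.evalForm IG IN ζ U (𝒢.anchor IG IN (𝒢.evalForm IG IN ζ V W)) y : EG)
      = eA y (z (pr y) (h.theta y (U y)) (z (pr y) (h.theta y (V y)) (h.theta y (W y))), 0) := by
    rw [h.evalForm_eq hζ V W]
    refine (hζ y (U y) (𝒢.anc IG IN (fun y =>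
      eA y (z (pr y) (h.theta y (V y)) (h.theta y (W y)), (0 : EH))) y)).trans ?_
    rw [h.anc_eq, h.theta_rho]
  refine (congrArg₂ (fun a b : EG => a + b) (congrArg₂ (fun a b : EG => a + b) (h1 _ _ _)
    (h1 _ _ _)) (h1 _ _ _)).trans ?_
  rw [← map_add, ← map_add, Prod.mk_add_mk, Prod.mk_add_mk, add_zero, add_zero]

/-- The frame `eA` spans the vertical vectors at the units and is injective, so that coefficients
exist and are smooth by `SmoothAlongAt.coeff`, applied along the unit map. -/
theorem exists_section {ν : ∀ y : N, TangentSpace IG (𝒢.unit y)} (hν : 𝒢.IsSection IG IN ν) :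
    ∃ (n₁ : N → EM) (n₂ : N → EH), ContMDiff IN 𝓘(ℝ, EM) ∞ n₁ ∧ ContMDiff IN 𝓘(ℝ, EH) ∞ n₂ ∧
      ν = fun y => eA y (n₁ y, n₂ y) := by
  choose n hn using fun y => h.exists_eA y (ν y) (hν.vertical y)
  have hs : ContMDiff IN 𝓘(ℝ, EM × EH) ∞ n := fun y =>
    SmoothAlongAt.coeff (f := 𝒢.unit) (I := IG) (b := eA) (fun v => h.smooth_eA v y)
      (h.injective_eA y) (SmoothAlongAt.congr (w := ν) (hν.smooth y) rfl (funext hn))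
  exact ⟨fun y => (n y).1, fun y => (n y).2,
    fun y => (ContinuousLinearMap.fst ℝ EM EH).contMDiff.contMDiffAt.comp y (hs y),
    fun y => (ContinuousLinearMap.snd ℝ EM EH).contMDiff.contMDiffAt.comp y (hs y),
    funext fun y => (hn y).symm⟩

theorem isSection_eA {n₁ : N → EM} {n₂ : N → EH} (h₁ : ContMDiff IN 𝓘(ℝ, EM) ∞ n₁)
    (h₂ : ContMDiff IN 𝓘(ℝ, EH) ∞ n₂) : 𝒢.IsSection IG IN (fun y => eA y (n₁ y, n₂ y)) where
  smooth := h.smoothAlong_eA h₁ h₂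
  vertical y := h.vertical_eA y _

theorem isAdjustment (hD : 𝒢.IsCartanConnection IG IN D) : 𝒢.IsAdjustment IG IN D where
  cartan := hD
  basicCurvature_eq_zero := by
    intro ν μ V hν hμ hV y
    obtain ⟨n₁, n₂, h₁, h₂, rfl⟩ := h.exists_section hν
    obtain ⟨m₁, m₂, h₁', h₂', rfl⟩ := h.exists_section hμ
    exact h.basicCurvature_frame hV h₁ h₂ h₁' h₂' y

/-- In the frame the curvature is minus the derivative of `c`; constant coefficients suffice to
evaluate it on all arguments. -/
theorem isFlat_iff : 𝒢.IsFlat IG IN D ↔ ∀ y, frameDeriv IM e c (pr y) = 0 := by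
  constructor
  · intro hf y
    ext n v w
    have h1 := hf (fun y => eB y (v, 0)) (fun y => eB y (w, 0)) _ (h.smooth_eB _) (h.smooth_eB _)
      (h.isSection_eA (contMDiff_const (c := n)) (contMDiff_const (c := (0 : EH)))) y
    have h2 := (h.curvature_frame (h.smooth_eB (v, 0)) (h.smooth_eB (w, 0))
      (contMDiff_const (c := n)) (contMDiff_const (c := (0 : EH))) y).symm.trans h1
    have h3 := congrArg Prod.fst (h.injective_eA y (h2.trans (map_zero _).symm))
    simp only [h.theta_eB, Prod.fst_zero, neg_eq_zero] at h3
    exact h3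
  · intro h0 V W ν hV hW hν y
    obtain ⟨n₁, n₂, h₁, h₂, rfl⟩ := h.exists_section hν
    refine (h.curvature_frame hV hW h₁ h₂ y).trans ?_
    rw [h0]
    simp only [LinearMap.zero_apply, zero_apply, neg_zero]
    exact map_zero (eA y)

theorem isStrictCovariantAdjustment (hD : 𝒢.IsCartanConnection IG IN D)
    (hp : IsStrictPrimitive IM e c z)
    (hζ : ∀ (y : N) (v w : EN), (ζ y v w : EG) = eA y (z (pr y) (h.theta y v) (h.theta y w), 0)) :
    𝒢.IsStrictCovariantAdjustment IG IN D ζ where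
  toIsAdjustment := h.isAdjustment hD
  twoForm :=
    { alternating := fun y v => by
        refine (hζ y v v).trans ?_
        rw [hp.alternating]
        exact map_zero (eA y)
      smooth := fun V W hV hW => by
        have h1 := h.isSection_eA (h.contMDiff_bilin hp.smooth (h.contMDiff_theta hV)
          (h.contMDiff_theta hW)) (contMDiff_const (c := (0 : EH)))
        exact Eq.mpr (congrArg (𝒢.IsSection IG IN) (h.evalForm_eq hζ V W)) h1 }
  primitive := by
    intro V W ν hV hW hν y
    obtain ⟨n₁, n₂, h₁, h₂, rfl⟩ := h.exists_section hν
    refine (congrArg₂ (fun a b : EG => a + b) (h.curvature_frame hV hW h₁ h₂ y)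
      (h.basicForm_frame hp.smooth hζ hV hW h₁ h₂ y)).trans ?_
    rw [hp.frameDeriv_eq, ← map_add, Prod.mk_add_mk, neg_add_cancel, add_zero]
    exact map_zero (eA y)
  strict := by
    intro V₁ V₂ V₃ h₁ h₂ h₃ y
    refine (h.extDeriv_frame hp.smooth hζ hp.alternating h₁ h₂ h₃ y rfl rfl rfl).trans ?_
    rw [hp.cyclic]
    exact (h.cyclic_evalForm hζ V₁ V₂ V₃ y).symm

/-- Each equation is evaluated on fields and sections with constant coefficients, and the
coefficients are compared by injectivity of `eA`. Surjectivity of `pr` ensures that every point of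
`M` is reached. -/
theorem isStrictPrimitive_of_isStrictCovariantAdjustment (hpr : Function.Surjective pr)
    (hz : ContMDiff IM 𝓘(ℝ, EM →L[ℝ] EM →L[ℝ] EM) ∞ z)
    (hζ : ∀ (y : N) (v w : EN), (ζ y v w : EG) = eA y (z (pr y) (h.theta y v) (h.theta y w), 0))
    (hs : 𝒢.IsStrictCovariantAdjustment IG IN D ζ) : IsStrictPrimitive IM e c z := by
  have halt : ∀ x v, z x v v = 0 := by
    intro x v
    obtain ⟨y, rfl⟩ := hpr x
    have h1 := (hζ y (eB y (v, 0)) (eB y (v, 0))).symm.trans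
      ((hs.twoForm.alternating y (eB y (v, 0))).trans (map_zero (eA y)).symm)
    rw [h.theta_eB] at h1
    exact congrArg Prod.fst (h.injective_eA y h1)
  refine ⟨hz, halt, fun x => ?_, fun x v₁ v₂ v₃ => ?_⟩
  · obtain ⟨y, rfl⟩ := hpr x
    ext n v w
    have c₁ := contMDiff_const (I := IN) (M := N) (I' := 𝓘(ℝ, EM)) (n := ∞) (c := n)
    have c₂ := contMDiff_const (I := IN) (M := N) (I' := 𝓘(ℝ, EH)) (n := ∞) (c := (0 : EH))
    have h1 := (congrArg₂ (fun a b : EG => a + b)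
      (h.curvature_frame (h.smooth_eB (v, 0)) (h.smooth_eB (w, 0)) c₁ c₂ y)
      (h.basicForm_frame hz hζ (h.smooth_eB (v, 0)) (h.smooth_eB (w, 0)) c₁ c₂ y)).symm.trans
      (hs.primitive _ _ _ (h.smooth_eB (v, 0)) (h.smooth_eB (w, 0)) (h.isSection_eA c₁ c₂) y)
    rw [← map_add, Prod.mk_add_mk] at h1
    have h2 := congrArg Prod.fst (h.injective_eA y (h1.trans (map_zero _).symm))
    simp only [h.theta_eB, Prod.fst_zero] at h2
    exact (neg_add_eq_zero.1 h2).symm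
  · obtain ⟨y, rfl⟩ := hpr x
    have hb (v : EM) := h.smooth_eB (v, 0)
    have h1 := (h.extDeriv_frame hz hζ halt (hb v₁) (hb v₂) (hb v₃) y (h.theta_eB _ _)
      (h.theta_eB _ _) (h.theta_eB _ _)).symm.trans
      ((hs.strict _ _ _ (hb v₁) (hb v₂) (hb v₃) y).trans (h.cyclic_evalForm hζ _ _ _ y))
    simp only [h.theta_eB] at h1
    exact congrArg Prod.fst (h.injective_eA y h1)

/-- The coefficients of a form are smooth. -/
theorem exists_form_coeff [Subsingleton EH] [Subsingleton F] {s : M → N}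
    (hs : ContMDiff IM IN ∞ s) (hsp : ∀ y, s (pr y) = y)
    (hζ : 𝒢.IsTwoForm IG IN ζ) :
    ∃ z : M → EM →L[ℝ] EM →L[ℝ] EM, ContMDiff IM 𝓘(ℝ, EM →L[ℝ] EM →L[ℝ] EM) ∞ z ∧
      ∀ (y : N) (v w : EN), (ζ y v w : EG) = eA y (z (pr y) (h.theta y v) (h.theta y w), 0) := by
  -- Since `F` and `EH` are trivial, the form is determined by its values on frame fields with
  -- constant coefficients, and each such value has only an `M`-coefficient `q`. Bilinearity of `q`
  -- follows from that of `ζ` because `eA` is injective.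
  have hex (v w : EM) : ∃ q : N → EM, ContMDiff IN 𝓘(ℝ, EM) ∞ q ∧
      ∀ y, (ζ y (eB y (v, 0)) (eB y (w, 0)) : EG) = eA y (q y, 0) := by
    obtain ⟨n₁, n₂, h₁, h₂, h3⟩ := h.exists_section
      (hζ.smooth (fun y => eB y (v, 0)) (fun y => eB y (w, 0)) (h.smooth_eB _) (h.smooth_eB _))
    exact ⟨n₁, h₁, fun y => (congrFun h3 y).trans (by rw [Subsingleton.elim (n₂ y) 0])⟩
  choose q hq hqζ using hex
  have hinj (y : N) {a b : EM} (hab : eA y (a, 0) = eA y (b, 0)) : a = b :=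
    congrArg Prod.fst (h.injective_eA y hab)
  have eadd (y : N) (a b : EM) : eA y (a + b, 0) = eA y (a, 0) + eA y (b, 0) := by
    rw [← map_add, Prod.mk_add_mk, add_zero]
  have esmul (y : N) (r : ℝ) (a : EM) : eA y (r • a, 0) = r • eA y (a, 0) := by
    rw [← map_smul, Prod.smul_mk, smul_zero]
  have badd (y : N) (a b : EM) : eB y (a + b, 0) = eB y (a, 0) + eB y (b, 0) := by
    rw [← map_add, Prod.mk_add_mk, add_zero]
  have bsmul (y : N) (r : ℝ) (a : EM) : eB y (r • a, 0) = r • eB y (a, 0) := by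
    rw [← map_smul, Prod.smul_mk, smul_zero]
  let z₀ : N → EM →ₗ[ℝ] EM →ₗ[ℝ] EM := fun y => LinearMap.mk₂ ℝ (fun v w => q v w y)
    (fun v v' w => hinj y (by
      rw [eadd, ← hqζ, ← hqζ, ← hqζ, badd]
      exact LinearMap.map_add₂ (ζ y) _ _ _))
    (fun r v w => hinj y (by
      rw [esmul, ← hqζ, ← hqζ, bsmul]
      exact LinearMap.map_smul₂ (ζ y) _ _ _))
    (fun v w w' => hinj y (by
      rw [eadd, ← hqζ, ← hqζ, ← hqζ, badd]
      exact map_add (ζ y _) _ _))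
    (fun r v w => hinj y (by
      rw [esmul, ← hqζ, ← hqζ, bsmul]
      exact map_smul (ζ y _) _ _))
  let z : M → EM →L[ℝ] EM →L[ℝ] EM := fun x => LinearMap.toContinuousLinearMap
    ((LinearMap.toContinuousLinearMap : (EM →ₗ[ℝ] EM) ≃ₗ[ℝ] (EM →L[ℝ] EM)).toLinearMap ∘ₗ z₀ (s x))
  -- Smoothness of an operator-valued function is tested on fixed vectors, where it is that of `q v
  -- w`; the map `s`, which inverts `pr`, moves the base point from `M` to `N`.
  refine ⟨z, fun x => contMDiffAt_clm_of_apply fun v => contMDiffAt_clm_of_apply fun w =>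
    ((hq v w).comp hs) x, fun y v w => ?_⟩
  have hθ (v : EN) : eB y (h.theta y v, 0) = v := by
    have h1 : (h.theta y v, 0) = h.coeffB y v := Prod.ext rfl (Subsingleton.elim _ _)
    rw [h1, h.eB_coeffB]
  have h2 := hqζ (h.theta y v) (h.theta y w) y
  rw [hθ, hθ] at h2
  refine h2.trans ?_
  change _ = eA y (q (h.theta y v) (h.theta y w) (s (pr y)), 0)
  rw [hsp]

end

end IsFramed
end Gpd

/-! ### Brackets of product fields and push-forward along diffeomorphisms -/

section ProductFields

variable {E H M E' H' M' : Type*} [NormedAddCommGroup E] [NormedSpace ℝ E] [CompleteSpace E]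
  [TopologicalSpace H] {I : ModelWithCorners ℝ E H} [TopologicalSpace M] [ChartedSpace H M]
  [NormedAddCommGroup E'] [NormedSpace ℝ E'] [TopologicalSpace H'] {I' : ModelWithCorners ℝ E' H'}
  [TopologicalSpace M'] [ChartedSpace H' M'] [CompleteSpace E']
  [IsManifold I ∞ M] [IsManifold I' ∞ M'] [I.Boundaryless] [I'.Boundaryless]

omit [CompleteSpace E] [CompleteSpace E'] [I.Boundaryless] [I'.Boundaryless] in
theorem SmoothField.prodMap {V : M → E} {W : M' → E'} (hV : SmoothField I V)
    (hW : SmoothField I' W) :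
    SmoothField (I.prod I') (fun z : M × M' => ((V z.1, W z.2) : E × E')) := fun z =>
  ((hV z.1).comp (g := Prod.fst) contMDiffAt_fst).prodMk ((hW z.2).comp contMDiffAt_snd)

omit [CompleteSpace E] [I.Boundaryless] in
theorem SmoothField.zero : SmoothField I (fun _ : M => (0 : E)) := fun _ =>
  SmoothAlongAt.zero contMDiffAt_id

omit [CompleteSpace E] in
theorem SmoothField.const (v : E) : SmoothField 𝓘(ℝ, E) (fun _ : E => v) := fun _ =>
  smoothAlongAt_space_iff.2 ⟨contMDiffAt_id, contMDiffAt_const⟩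

/-- Each projection relates the product fields to the fields on its factor. -/
theorem lieB_prod {V V' : M → E} {W W' : M' → E'} (hV : SmoothField I V)
    (hW : SmoothField I' W) (hV' : SmoothField I V') (hW' : SmoothField I' W') (z : M × M') :
    lieB (I.prod I') (fun z : M × M' => ((V z.1, W z.2) : E × E')) (fun z => (V' z.1, W' z.2)) z
      = (lieB I V V' z.1, lieB I' W W' z.2) := by
  have h1 := lieB_related (f := Prod.fst) contMDiff_fst (hV.prodMap hW) (hV'.prodMap hW') hV hV'
    (fun x => der_fst x _) (fun x => der_fst x _) z
  have h2 := lieB_related (f := Prod.snd) contMDiff_snd (hV.prodMap hW) (hV'.prodMap hW') hW hW'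
    (fun x => der_snd x _) (fun x => der_snd x _) z
  rw [der_fst] at h1
  rw [der_snd] at h2
  exact Prod.ext h1 h2

omit [CompleteSpace E] in
theorem lieB_const (v w : E) (x : E) :
    lieB 𝓘(ℝ, E) (fun _ : E => v) (fun _ => w) x = 0 := by
  have h1 : lieB 𝓘(ℝ, E) (fun _ : E => v) (fun _ => w)
      = mlieBracketWithin 𝓘(ℝ, E) (fun _ : E => v) (fun _ => w) Set.univ :=
    mlieBracketWithin_univ.symm
  have h2 : mlieBracketWithin 𝓘(ℝ, E) (fun _ : E => v) (fun _ => w) Set.univ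
      = lieBracketWithin ℝ (fun _ : E => v) (fun _ => w) Set.univ :=
    mlieBracketWithin_eq_lieBracketWithin
  refine (congrFun (h1.trans (h2.trans lieBracketWithin_univ)) x).trans ?_
  simp [lieBracket]

end ProductFields

section Diffeo

variable {E H M E' H' M' : Type*} [NormedAddCommGroup E] [NormedSpace ℝ E] [CompleteSpace E]
  [TopologicalSpace H] {I : ModelWithCorners ℝ E H} [TopologicalSpace M] [ChartedSpace H M]
  [NormedAddCommGroup E'] [NormedSpace ℝ E'] [TopologicalSpace H'] {I' : ModelWithCorners ℝ E' H'}
  [TopologicalSpace M'] [ChartedSpace H' M'] [CompleteSpace E']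
  [IsManifold I ∞ M] [IsManifold I' ∞ M'] [I.Boundaryless] [I'.Boundaryless]
  (Ψ : Diffeomorph I I' M M' ∞)

omit [CompleteSpace E] [CompleteSpace E'] [IsManifold I ∞ M] [IsManifold I' ∞ M'] [I.Boundaryless]
  [I'.Boundaryless]

theorem Diffeomorph.mdiff (a : M) : MDifferentiableAt I I' Ψ a :=
  Ψ.contMDiff.mdifferentiableAt (by simp)

theorem Diffeomorph.mdiff_symm (g : M') : MDifferentiableAt I' I Ψ.symm g :=
  Ψ.symm.contMDiff.mdifferentiableAt (by simp)

theorem Diffeomorph.der_symm_der (a : M) (w : E) : der I' I Ψ.symm (Ψ a) (der I I' Ψ a w) = w :=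
  der_leftInverse (Ψ.mdiff a) (Ψ.mdiff_symm _) Ψ.symm_apply_apply w

theorem Diffeomorph.der_der_symm (g : M') (w : E') :
    der I I' Ψ (Ψ.symm g) (der I' I Ψ.symm g w) = w :=
  der_leftInverse (Ψ.mdiff_symm g) (Ψ.mdiff _) Ψ.apply_symm_apply w

theorem Diffeomorph.der_der_symm' (a : M) (w : E') :
    der I I' Ψ a (der I' I Ψ.symm (Ψ a) w) = w := by
  have h := Ψ.der_der_symm (Ψ a) w
  rwa [Ψ.symm_apply_apply] at h

theorem Diffeomorph.der_bijective (a : M) : Function.Bijective (der I I' Ψ a) :=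
  ⟨fun v w h => by rw [← Ψ.der_symm_der a v, h, Ψ.der_symm_der],
    fun w => ⟨_, Ψ.der_der_symm' a w⟩⟩

variable [IsManifold I ∞ M] [IsManifold I' ∞ M']

theorem Diffeomorph.smoothField_push {V : M → E} (hV : SmoothField I V) :
    SmoothField I' (fun g => der I I' Ψ (Ψ.symm g) (V (Ψ.symm g))) := fun g =>
  (((hV (Ψ.symm g)).comp (g := Ψ.symm) (IX := I') Ψ.symm.contMDiff.contMDiffAt).map
    Ψ.contMDiff.contMDiffAt).congr (funext fun y => (Ψ.apply_symm_apply y).symm) rfl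

theorem Diffeomorph.lieB_push [CompleteSpace E] [CompleteSpace E'] [I.Boundaryless]
    [I'.Boundaryless] {V W : M → E} (hV : SmoothField I V) (hW : SmoothField I W) (g : M') :
    lieB I' (fun g => der I I' Ψ (Ψ.symm g) (V (Ψ.symm g)))
        (fun g => der I I' Ψ (Ψ.symm g) (W (Ψ.symm g))) g
      = der I I' Ψ (Ψ.symm g) (lieB I V W (Ψ.symm g)) := by
  have h := lieB_related (f := Ψ) Ψ.contMDiff hV hW (Ψ.smoothField_push hV)
    (Ψ.smoothField_push hW) (fun a => by rw [Ψ.symm_apply_apply])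
    (fun a => by rw [Ψ.symm_apply_apply]) (Ψ.symm g)
  rw [Ψ.apply_symm_apply] at h
  exact h.symm

end Diffeo

/-! ### The model: pair groupoid times the action groupoid of a vector space -/

namespace Gpd

section Model

variable {EG HG EN HN EM HM EH HH F G N M H : Type*}
  [NormedAddCommGroup EG] [NormedSpace ℝ EG] [FiniteDimensional ℝ EG] [TopologicalSpace HG]
  [NormedAddCommGroup EN] [NormedSpace ℝ EN] [FiniteDimensional ℝ EN] [TopologicalSpace HN]
  [NormedAddCommGroup EM] [NormedSpace ℝ EM] [FiniteDimensional ℝ EM] [TopologicalSpace HM]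
  [NormedAddCommGroup EH] [NormedSpace ℝ EH] [FiniteDimensional ℝ EH] [TopologicalSpace HH]
  [NormedAddCommGroup F] [NormedSpace ℝ F] [FiniteDimensional ℝ F]
  {IG : ModelWithCorners ℝ EG HG} {IN : ModelWithCorners ℝ EN HN} {IM : ModelWithCorners ℝ EM HM}
  {IH : ModelWithCorners ℝ EH HH}
  [TopologicalSpace G] [ChartedSpace HG G] [IsManifold IG ∞ G]
  [TopologicalSpace N] [ChartedSpace HN N] [IsManifold IN ∞ N]
  [TopologicalSpace M] [ChartedSpace HM M] [IsManifold IM ∞ M]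
  [TopologicalSpace H] [ChartedSpace HH H] [Group H] [LieGroup IH ∞ H] [MulAction H F]
  [IG.Boundaryless] [IN.Boundaryless] [IM.Boundaryless] [IH.Boundaryless]

variable (F IM IH) in
/-- The model of the manifold `(H × M × M) × F`. -/
abbrev arrowModel : ModelWithCorners ℝ ((EH × EM × EM) × F)
    (ModelProd (ModelProd HH (ModelProd HM HM)) F) :=
  (IH.prod (IM.prod IM)).prod 𝓘(ℝ, F)

/-- `𝒢` is isomorphic, by diffeomorphisms `Ψ` and `ψ`, to the product of the pair groupoid of `M`
and the action groupoid of an action of `H` on a vector space `F`. -/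
structure IsModel (𝒢 : Gpd G N) (Ψ : Diffeomorph (arrowModel F IM IH) IG ((H × M × M) × F) G ∞)
    (ψ : Diffeomorph (IM.prod 𝓘(ℝ, F)) IN (M × F) N ∞) : Prop where
  smooth_smul : ContMDiff (IH.prod 𝓘(ℝ, F)) 𝓘(ℝ, F) ∞ (fun x : H × F => x.1 • x.2)
  src : ∀ h m₂ m₁ f, 𝒢.src (Ψ ((h, m₂, m₁), f)) = ψ (m₁, h⁻¹ • f)
  tgt : ∀ h m₂ m₁ f, 𝒢.tgt (Ψ ((h, m₂, m₁), f)) = ψ (m₂, f)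
  unit : ∀ m f, 𝒢.unit (ψ (m, f)) = Ψ ((1, m, m), f)
  inv : ∀ h m₂ m₁ f, 𝒢.inv (Ψ ((h, m₂, m₁), f)) = Ψ ((h⁻¹, m₁, m₂), h⁻¹ • f)
  mul : ∀ h h' m₂ m₁ m₀ f, 𝒢.mulExt (Ψ ((h, m₂, m₁), f), Ψ ((h', m₁, m₀), h⁻¹ • f))
    = Ψ ((h * h', m₂, m₀), f)

/-- The frame of left-invariant vector fields. -/
def leftFrame (Ψ : Diffeomorph (arrowModel F IM IH) IG ((H × M × M) × F) G ∞)
    (e : M → EM →ₗ[ℝ] EM) (g : G) : EM × EH →ₗ[ℝ] EG :=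
  (der (arrowModel F IM IH) IG Ψ (Ψ.symm g)).toLinearMap ∘ₗ
    ((((invFrame IH (Ψ.symm g).1.1) ∘ₗ LinearMap.snd ℝ EM EH).prod
      ((0 : EM × EH →ₗ[ℝ] EM).prod ((e (Ψ.symm g).1.2.2) ∘ₗ LinearMap.fst ℝ EM EH))).prod 0)

/-- The frame of horizontal vector fields. -/
def horFrame (Ψ : Diffeomorph (arrowModel F IM IH) IG ((H × M × M) × F) G ∞)
    (e : M → EM →ₗ[ℝ] EM) (g : G) : EM × F →ₗ[ℝ] EG :=
  (der (arrowModel F IM IH) IG Ψ (Ψ.symm g)).toLinearMap ∘ₗ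
    (((0 : EM × F →ₗ[ℝ] EH).prod ((e (Ψ.symm g).1.2.1 ∘ₗ LinearMap.fst ℝ EM F).prod
      (e (Ψ.symm g).1.2.2 ∘ₗ LinearMap.fst ℝ EM F))).prod (LinearMap.snd ℝ EM F))

/-- The frame of the base. -/
def baseFrame (ψ : Diffeomorph (IM.prod 𝓘(ℝ, F)) IN (M × F) N ∞) (e : M → EM →ₗ[ℝ] EM) (y : N) :
    EM × F →ₗ[ℝ] EN :=
  (der (IM.prod 𝓘(ℝ, F)) IN ψ (ψ.symm y)).toLinearMap ∘ₗ
    ((e (ψ.symm y).1 ∘ₗ LinearMap.fst ℝ EM F).prod (LinearMap.snd ℝ EM F))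

/-- The horizontal distribution. -/
def modelDistribution (Ψ : Diffeomorph (arrowModel F IM IH) IG ((H × M × M) × F) G ∞)
    (e : M → EM →ₗ[ℝ] EM) (g : G) : Submodule ℝ (TangentSpace IG g) :=
  (LinearMap.range (horFrame Ψ e g) : Submodule ℝ EG)

variable {𝒢 : Gpd G N} {Ψ : Diffeomorph (arrowModel F IM IH) IG ((H × M × M) × F) G ∞}
    {ψ : Diffeomorph (IM.prod 𝓘(ℝ, F)) IN (M × F) N ∞} {e : M → EM →ₗ[ℝ] EM}
    {c : M → EM →L[ℝ] EM →L[ℝ] EM}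

set_option linter.unusedSectionVars false

theorem leftFrame_apply (h : H) (m₂ m₁ : M) (f : F) (x : EM) (η : EH) :
    leftFrame Ψ e (Ψ ((h, m₂, m₁), f)) (x, η)
      = der (arrowModel F IM IH) IG Ψ ((h, m₂, m₁), f) ((invFrame IH h η, 0, e m₁ x), 0) := by
  simp only [leftFrame, Ψ.symm_apply_apply]
  rfl

theorem horFrame_apply (h : H) (m₂ m₁ : M) (f : F) (v : EM) (u : F) :
    horFrame Ψ e (Ψ ((h, m₂, m₁), f)) (v, u)
      = der (arrowModel F IM IH) IG Ψ ((h, m₂, m₁), f) ((0, e m₂ v, e m₁ v), u) := by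
  simp only [horFrame, Ψ.symm_apply_apply]
  rfl

theorem baseFrame_apply (m : M) (f : F) (v : EM) (u : F) :
    baseFrame ψ e (ψ (m, f)) (v, u) = der (IM.prod 𝓘(ℝ, F)) IN ψ (m, f) (e m v, u) := by
  simp only [baseFrame, ψ.symm_apply_apply]
  rfl

section Derivatives

variable {EZ HZ Z : Type*} [NormedAddCommGroup EZ] [NormedSpace ℝ EZ] [TopologicalSpace HZ]
  {IZ : ModelWithCorners ℝ EZ HZ} [TopologicalSpace Z] [ChartedSpace HZ Z]
  {a : Z → H} {b b' : Z → M} {f : Z → F} {z : Z}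

theorem mdifferentiableAt_tuple (ha : MDifferentiableAt IZ IH a z) (hb : MDifferentiableAt IZ IM b z)
    (hb' : MDifferentiableAt IZ IM b' z) (hf : MDifferentiableAt IZ 𝓘(ℝ, F) f z) :
    MDifferentiableAt IZ IG (fun z => Ψ ((a z, b z, b' z), f z)) z :=
  (Ψ.mdiff _).comp z ((ha.prodMk (hb.prodMk hb')).prodMk hf)

theorem der_tuple (ha : MDifferentiableAt IZ IH a z) (hb : MDifferentiableAt IZ IM b z)
    (hb' : MDifferentiableAt IZ IM b' z) (hf : MDifferentiableAt IZ 𝓘(ℝ, F) f z) (w : EZ) :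
    der IZ IG (fun z => Ψ ((a z, b z, b' z), f z)) z w
      = der (arrowModel F IM IH) IG Ψ ((a z, b z, b' z), f z)
        ((der IZ IH a z w, der IZ IM b z w, der IZ IM b' z w), der IZ 𝓘(ℝ, F) f z w) := by
  rw [der_comp (Ψ.mdiff _) ((ha.prodMk (hb.prodMk hb')).prodMk hf),
    der_prodMk (ha.prodMk (hb.prodMk hb')) hf, der_prodMk ha (hb.prodMk hb'), der_prodMk hb hb']

theorem der_base_tuple (hb : MDifferentiableAt IZ IM b z)
    (hf : MDifferentiableAt IZ 𝓘(ℝ, F) f z) (w : EZ) :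
    der IZ IN (fun z => ψ (b z, f z)) z w
      = der (IM.prod 𝓘(ℝ, F)) IN ψ (b z, f z) (der IZ IM b z w, der IZ 𝓘(ℝ, F) f z w) := by
  rw [der_comp (ψ.mdiff _) (hb.prodMk hf), der_prodMk hb hf]

end Derivatives

end Model

end Gpd

/-! ### Derivatives of components, and derivatives within subsets at prescribed points -/

section

variable {E H M E' H' M' EX HX X : Type*} [NormedAddCommGroup E] [NormedSpace ℝ E]
  [TopologicalSpace H] {I : ModelWithCorners ℝ E H} [TopologicalSpace M] [ChartedSpace H M]
  [NormedAddCommGroup E'] [NormedSpace ℝ E'] [TopologicalSpace H'] {I' : ModelWithCorners ℝ E' H'}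
  [TopologicalSpace M'] [ChartedSpace H' M']
  [NormedAddCommGroup EX] [NormedSpace ℝ EX] [TopologicalSpace HX]
  {IX : ModelWithCorners ℝ EX HX} [TopologicalSpace X] [ChartedSpace HX X]

theorem der_comp_fst {f : X → M × M'} {x : X} (hf : MDifferentiableAt IX (I.prod I') f x) (w : EX) :
    der IX I (fun y => (f y).1) x w = (der IX (I.prod I') f x w).1 := by
  rw [der_comp (g := Prod.fst) mdifferentiableAt_fst hf, der_fst]

theorem der_comp_snd {f : X → M × M'} {x : X} (hf : MDifferentiableAt IX (I.prod I') f x) (w : EX) :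
    der IX I' (fun y => (f y).2) x w = (der IX (I.prod I') f x w).2 := by
  rw [der_comp (g := Prod.snd) mdifferentiableAt_snd hf, der_snd]

theorem Diffeomorph.exists_apply_eq (Ψ : Diffeomorph I I' M M' ∞) (g : M') : ∃ a, Ψ a = g :=
  ⟨_, Ψ.apply_symm_apply g⟩

/-- The base point and the tangent vector enter through equations, because in applications they
agree with the values of `φ` and of its differential only after rewriting. -/
theorem mfderivWithin_of_mapsTo' {f : M → M'} {s : Set M} {φ : X → M} {x : X} {p : M}
    (hp : φ x = p) (hf : MDifferentiableWithinAt I I' f s p) (hφ : MDifferentiableAt IX I φ x)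
    (hs : ∀ y, φ y ∈ s) (w : EX) {v : E} (hv : der IX I φ x w = v) :
    (mfderivWithin I I' f s p : E →L[ℝ] E') v = der IX I' (fun y => f (φ y)) x w := by
  subst hp hv
  exact mfderivWithin_of_mapsTo hf hφ hs w

end

/-! ### Structure maps of the model and their differentials -/

namespace Gpd

section Model

variable {EG HG EN HN EM HM EH HH F G N M H : Type*}
  [NormedAddCommGroup EG] [NormedSpace ℝ EG] [FiniteDimensional ℝ EG] [TopologicalSpace HG]
  [NormedAddCommGroup EN] [NormedSpace ℝ EN] [FiniteDimensional ℝ EN] [TopologicalSpace HN]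
  [NormedAddCommGroup EM] [NormedSpace ℝ EM] [FiniteDimensional ℝ EM] [TopologicalSpace HM]
  [NormedAddCommGroup EH] [NormedSpace ℝ EH] [FiniteDimensional ℝ EH] [TopologicalSpace HH]
  [NormedAddCommGroup F] [NormedSpace ℝ F] [FiniteDimensional ℝ F]
  {IG : ModelWithCorners ℝ EG HG} {IN : ModelWithCorners ℝ EN HN} {IM : ModelWithCorners ℝ EM HM}
  {IH : ModelWithCorners ℝ EH HH}
  [TopologicalSpace G] [ChartedSpace HG G] [IsManifold IG ∞ G]
  [TopologicalSpace N] [ChartedSpace HN N] [IsManifold IN ∞ N]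
  [TopologicalSpace M] [ChartedSpace HM M] [IsManifold IM ∞ M]
  [TopologicalSpace H] [ChartedSpace HH H] [Group H] [LieGroup IH ∞ H] [MulAction H F]
  [IG.Boundaryless] [IN.Boundaryless] [IM.Boundaryless] [IH.Boundaryless]

variable {𝒢 : Gpd G N} {Ψ : Diffeomorph (arrowModel F IM IH) IG ((H × M × M) × F) G ∞}
    {ψ : Diffeomorph (IM.prod 𝓘(ℝ, F)) IN (M × F) N ∞} {e : M → EM →ₗ[ℝ] EM}
    {c : M → EM →L[ℝ] EM →L[ℝ] EM}

set_option linter.unusedSectionVars false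

section Projections

theorem contMDiff_group : ContMDiff (arrowModel F IM IH) IH ∞ (fun a : (H × M × M) × F => a.1.1) :=
  contMDiff_fst.comp contMDiff_fst

theorem contMDiff_left :
    ContMDiff (arrowModel F IM IH) IM ∞ (fun a : (H × M × M) × F => a.1.2.1) :=
  contMDiff_fst.comp (contMDiff_snd.comp contMDiff_fst)

theorem contMDiff_right :
    ContMDiff (arrowModel F IM IH) IM ∞ (fun a : (H × M × M) × F => a.1.2.2) :=
  contMDiff_snd.comp (contMDiff_snd.comp contMDiff_fst)

theorem contMDiff_vec :
    ContMDiff (arrowModel F IM IH) 𝓘(ℝ, F) ∞ (fun a : (H × M × M) × F => a.2) :=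
  contMDiff_snd

variable (a : (H × M × M) × F) (w : (EH × EM × EM) × F)

theorem der_group : der (arrowModel F IM IH) IH (fun a : (H × M × M) × F => a.1.1) a w = w.1.1 := by
  rw [der_comp_fst (I := IH) (I' := IM.prod IM) (f := Prod.fst) mdifferentiableAt_fst, der_fst]

theorem der_left :
    der (arrowModel F IM IH) IM (fun a : (H × M × M) × F => a.1.2.1) a w = w.1.2.1 := by
  rw [der_comp_fst (I := IM) (I' := IM) (f := fun a : (H × M × M) × F => a.1.2)
      ((contMDiff_snd.comp contMDiff_fst).mdifferentiableAt (n := ∞) (by simp)),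
    der_comp_snd (I := IH) (I' := IM.prod IM) (f := Prod.fst) mdifferentiableAt_fst, der_fst]

theorem der_right :
    der (arrowModel F IM IH) IM (fun a : (H × M × M) × F => a.1.2.2) a w = w.1.2.2 := by
  rw [der_comp_snd (I := IM) (I' := IM) (f := fun a : (H × M × M) × F => a.1.2)
      ((contMDiff_snd.comp contMDiff_fst).mdifferentiableAt (n := ∞) (by simp)),
    der_comp_snd (I := IH) (I' := IM.prod IM) (f := Prod.fst) mdifferentiableAt_fst, der_fst]

theorem der_vec :
    der (arrowModel F IM IH) 𝓘(ℝ, F) (fun a : (H × M × M) × F => a.2) a w = w.2 :=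
  der_snd a w

end Projections

namespace IsModel

variable (hM : IsModel 𝒢 Ψ ψ)

include hM

theorem contMDiff_invAct :
    ContMDiff (IH.prod 𝓘(ℝ, F)) 𝓘(ℝ, F) ∞ (fun p : H × F => p.1⁻¹ • p.2) :=
  hM.smooth_smul.comp (((contMDiff_inv IH ∞).comp contMDiff_fst).prodMk contMDiff_snd)

theorem src_apply (a : (H × M × M) × F) : 𝒢.src (Ψ a) = ψ (a.1.2.2, a.1.1⁻¹ • a.2) :=
  hM.src _ _ _ _

theorem tgt_apply (a : (H × M × M) × F) : 𝒢.tgt (Ψ a) = ψ (a.1.2.1, a.2) := hM.tgt _ _ _ _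

theorem inv_apply (a : (H × M × M) × F) :
    𝒢.inv (Ψ a) = Ψ ((a.1.1⁻¹, a.1.2.2, a.1.2.1), a.1.1⁻¹ • a.2) := hM.inv _ _ _ _

theorem contMDiff_act_arrow : ContMDiff (arrowModel F IM IH) 𝓘(ℝ, F) ∞
    (fun a : (H × M × M) × F => a.1.1⁻¹ • a.2) :=
  hM.contMDiff_invAct.comp (contMDiff_group.prodMk contMDiff_vec)

theorem contMDiff_src_comp : ContMDiff (arrowModel F IM IH) IN ∞ (fun a => 𝒢.src (Ψ a)) := by
  simp only [hM.src_apply]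
  exact ψ.contMDiff.comp (contMDiff_right.prodMk hM.contMDiff_act_arrow)

theorem contMDiff_tgt_comp : ContMDiff (arrowModel F IM IH) IN ∞ (fun a => 𝒢.tgt (Ψ a)) := by
  simp only [hM.tgt_apply]
  exact ψ.contMDiff.comp (contMDiff_left.prodMk contMDiff_vec)

theorem contMDiff_inv_comp : ContMDiff (arrowModel F IM IH) IG ∞ (fun a => 𝒢.inv (Ψ a)) := by
  simp only [hM.inv_apply]
  exact Ψ.contMDiff.comp ((((contMDiff_inv IH ∞).comp contMDiff_group).prodMk
    (contMDiff_right.prodMk contMDiff_left)).prodMk hM.contMDiff_act_arrow)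

omit hM in
theorem contMDiff_of_comp {E' H' M' : Type*} [NormedAddCommGroup E'] [NormedSpace ℝ E']
    [TopologicalSpace H'] {I' : ModelWithCorners ℝ E' H'} [TopologicalSpace M'] [ChartedSpace H' M']
    {φ : G → M'} (h : ContMDiff (arrowModel F IM IH) I' ∞ (fun a => φ (Ψ a))) :
    ContMDiff IG I' ∞ φ := by
  have h1 := h.comp Ψ.symm.contMDiff
  have h2 : (fun a => φ (Ψ a)) ∘ Ψ.symm = φ := funext fun g => congrArg φ (Ψ.apply_symm_apply g)
  rwa [h2] at h1

omit hM in
theorem contMDiff_of_comp_base {E' H' M' : Type*} [NormedAddCommGroup E'] [NormedSpace ℝ E']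
    [TopologicalSpace H'] {I' : ModelWithCorners ℝ E' H'} [TopologicalSpace M'] [ChartedSpace H' M']
    {φ : N → M'} (h : ContMDiff (IM.prod 𝓘(ℝ, F)) I' ∞ (fun b => φ (ψ b))) :
    ContMDiff IN I' ∞ φ := by
  have h1 := h.comp ψ.symm.contMDiff
  have h2 : (fun b => φ (ψ b)) ∘ ψ.symm = φ := funext fun g => congrArg φ (ψ.apply_symm_apply g)
  rwa [h2] at h1

theorem contMDiff_src : ContMDiff IG IN ∞ 𝒢.src := contMDiff_of_comp hM.contMDiff_src_comp

theorem contMDiff_tgt : ContMDiff IG IN ∞ 𝒢.tgt := contMDiff_of_comp hM.contMDiff_tgt_comp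

theorem contMDiff_unit : ContMDiff IN IG ∞ 𝒢.unit := by
  refine contMDiff_of_comp_base (ψ := ψ) ?_
  have h : (fun b => 𝒢.unit (ψ b)) = fun b => Ψ ((1, b.1, b.1), b.2) :=
    funext fun b => hM.unit b.1 b.2
  rw [h]
  exact Ψ.contMDiff.comp ((contMDiff_const.prodMk (contMDiff_fst.prodMk contMDiff_fst)).prodMk
    contMDiff_snd)

/-- On composable pairs the composition is given by a formula that is smooth on all of `G × G`; the
vector in `F` is taken from the first arrow, as it is part of the target. -/
theorem mulExt_eq {x : G × G} (hx : x ∈ 𝒢.composable) :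
    𝒢.mulExt x = Ψ (((Ψ.symm x.1).1.1 * (Ψ.symm x.2).1.1, (Ψ.symm x.1).1.2.1,
      (Ψ.symm x.2).1.2.2), (Ψ.symm x.1).2) := by
  obtain ⟨g, k⟩ := x
  obtain ⟨⟨⟨h, m₂, m₁⟩, f⟩, rfl⟩ := Ψ.exists_apply_eq g
  obtain ⟨⟨⟨h', m₁', m₀⟩, f'⟩, rfl⟩ := Ψ.exists_apply_eq k
  have hx' : 𝒢.src (Ψ ((h, m₂, m₁), f)) = 𝒢.tgt (Ψ ((h', m₁', m₀), f')) := hx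
  rw [hM.src, hM.tgt] at hx'
  obtain ⟨rfl, rfl⟩ := Prod.mk.inj (ψ.injective hx')
  rw [hM.mul, Ψ.symm_apply_apply, Ψ.symm_apply_apply]

theorem isLieGroupoid : 𝒢.IsLieGroupoid IG IN where
  smooth_src := hM.contMDiff_src
  smooth_tgt := hM.contMDiff_tgt
  smooth_unit := hM.contMDiff_unit
  smooth_inv := contMDiff_of_comp hM.contMDiff_inv_comp
  submersion_src := by
    intro g
    obtain ⟨⟨⟨h, m₂, m₁⟩, f⟩, rfl⟩ := Ψ.exists_apply_eq g
    -- A section of the source through the given arrow: `h` and `m₂` are kept, and the vector is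
    -- multiplied by `h` to undo the action in the source. Surjectivity of the differential follows.
    have hσ : ContMDiff IN IG ∞
        (fun y => Ψ ((h, m₂, (ψ.symm y).1), h • (ψ.symm y).2)) :=
      Ψ.contMDiff.comp ((contMDiff_const.prodMk (contMDiff_const.prodMk
        (contMDiff_fst.comp ψ.symm.contMDiff))).prodMk (hM.smooth_smul.comp
          (contMDiff_const.prodMk (contMDiff_snd.comp ψ.symm.contMDiff))))
    refine der_surjective_of_rightInverse (I := IG) (I' := IN) (f := 𝒢.src)
      (hM.contMDiff_src.mdifferentiableAt (by simp))
      (hσ.mdifferentiableAt (by simp)) (fun y => ?_) ?_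
    · rw [hM.src, inv_smul_smul]
      exact ψ.apply_symm_apply y
    · rw [hM.src, ψ.symm_apply_apply, smul_inv_smul]
  submersion_tgt := by
    intro g
    obtain ⟨⟨⟨h, m₂, m₁⟩, f⟩, rfl⟩ := Ψ.exists_apply_eq g
    have hσ : ContMDiff IN IG ∞ (fun y => Ψ ((h, (ψ.symm y).1, m₁), (ψ.symm y).2)) :=
      Ψ.contMDiff.comp ((contMDiff_const.prodMk ((contMDiff_fst.comp ψ.symm.contMDiff).prodMk
        contMDiff_const)).prodMk (contMDiff_snd.comp ψ.symm.contMDiff))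
    refine der_surjective_of_rightInverse (I := IG) (I' := IN) (f := 𝒢.tgt)
      (hM.contMDiff_tgt.mdifferentiableAt (by simp))
      (hσ.mdifferentiableAt (by simp)) (fun y => ?_) ?_
    · rw [hM.tgt]
      exact ψ.apply_symm_apply y
    · rw [hM.tgt, ψ.symm_apply_apply]
  smooth_mul := by
    have h1 : ContMDiff (IG.prod IG) (arrowModel F IM IH) ∞ (fun x : G × G => Ψ.symm x.1) :=
      Ψ.symm.contMDiff.comp contMDiff_fst
    have h2 : ContMDiff (IG.prod IG) (arrowModel F IM IH) ∞ (fun x : G × G => Ψ.symm x.2) :=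
      Ψ.symm.contMDiff.comp contMDiff_snd
    refine ContMDiffOn.congr (ContMDiff.contMDiffOn (Ψ.contMDiff.comp
      ((((contMDiff_mul IH ∞).comp ((contMDiff_group.comp h1).prodMk
        (contMDiff_group.comp h2))).prodMk ((contMDiff_left.comp h1).prodMk
          (contMDiff_right.comp h2))).prodMk (contMDiff_vec.comp h1)))) fun x hx => hM.mulExt_eq hx

theorem der_tgt (h : H) (m₂ m₁ : M) (f : F) (w : (EH × EM × EM) × F) :
    der IG IN 𝒢.tgt (Ψ ((h, m₂, m₁), f)) (der (arrowModel F IM IH) IG Ψ ((h, m₂, m₁), f) w)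
      = der (IM.prod 𝓘(ℝ, F)) IN ψ (m₂, f) (w.1.2.1, w.2) := by
  rw [← der_comp (hM.contMDiff_tgt.mdifferentiableAt (by simp)) (Ψ.mdiff _)]
  simp only [hM.tgt_apply]
  rw [der_base_tuple (contMDiff_left.mdifferentiableAt (by simp))
    (contMDiff_vec.mdifferentiableAt (by simp)), der_left, der_vec]

theorem der_act_arrow (a : (H × M × M) × F) (w : (EH × EM × EM) × F) :
    der (arrowModel F IM IH) 𝓘(ℝ, F) (fun a : (H × M × M) × F => a.1.1⁻¹ • a.2) a w
      = der (IH.prod 𝓘(ℝ, F)) 𝓘(ℝ, F) (fun p : H × F => p.1⁻¹ • p.2) (a.1.1, a.2) (w.1.1, w.2) := by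
  rw [der_comp (g := fun p : H × F => p.1⁻¹ • p.2) (f := fun a : (H × M × M) × F => (a.1.1, a.2))
      (hM.contMDiff_invAct.mdifferentiableAt (by simp))
      ((contMDiff_group.prodMk contMDiff_vec).mdifferentiableAt (n := ∞) (by simp)),
    der_prodMk (contMDiff_group.mdifferentiableAt (by simp))
    (contMDiff_vec.mdifferentiableAt (by simp)), der_group, der_vec]

theorem der_src (h : H) (m₂ m₁ : M) (f : F) (w : (EH × EM × EM) × F) :
    der IG IN 𝒢.src (Ψ ((h, m₂, m₁), f)) (der (arrowModel F IM IH) IG Ψ ((h, m₂, m₁), f) w)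
      = der (IM.prod 𝓘(ℝ, F)) IN ψ (m₁, h⁻¹ • f) (w.1.2.2,
        der (IH.prod 𝓘(ℝ, F)) 𝓘(ℝ, F) (fun p : H × F => p.1⁻¹ • p.2) (h, f) (w.1.1, w.2)) := by
  rw [← der_comp (hM.contMDiff_src.mdifferentiableAt (by simp)) (Ψ.mdiff _)]
  simp only [hM.src_apply]
  rw [der_base_tuple (contMDiff_right.mdifferentiableAt (by simp))
    (hM.contMDiff_act_arrow.mdifferentiableAt (by simp)), der_right, hM.der_act_arrow]

theorem der_unit (m : M) (f : F) (v : EM) (u : F) :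
    der IN IG 𝒢.unit (ψ (m, f)) (der (IM.prod 𝓘(ℝ, F)) IN ψ (m, f) (v, u))
      = der (arrowModel F IM IH) IG Ψ ((1, m, m), f) ((0, v, v), u) := by
  rw [← der_comp (hM.contMDiff_unit.mdifferentiableAt (by simp)) (ψ.mdiff _)]
  have h : (fun b => 𝒢.unit (ψ b)) = fun b => Ψ ((1, b.1, b.1), b.2) :=
    funext fun b => hM.unit b.1 b.2
  rw [h, der_tuple (a := fun _ => (1 : H)) mdifferentiableAt_const
    (b := Prod.fst) mdifferentiableAt_fst (b' := Prod.fst) mdifferentiableAt_fst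
    (f := Prod.snd) mdifferentiableAt_snd, der_const, der_fst, der_snd]

end IsModel

end Model

end Gpd

/-! ### Left-invariant fields, horizontal lifts and the Cartan connection of the model -/

namespace Gpd

section Model

variable {EG HG EN HN EM HM EH HH F G N M H : Type*}
  [NormedAddCommGroup EG] [NormedSpace ℝ EG] [FiniteDimensional ℝ EG] [TopologicalSpace HG]
  [NormedAddCommGroup EN] [NormedSpace ℝ EN] [FiniteDimensional ℝ EN] [TopologicalSpace HN]
  [NormedAddCommGroup EM] [NormedSpace ℝ EM] [FiniteDimensional ℝ EM] [TopologicalSpace HM]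
  [NormedAddCommGroup EH] [NormedSpace ℝ EH] [FiniteDimensional ℝ EH] [TopologicalSpace HH]
  [NormedAddCommGroup F] [NormedSpace ℝ F] [FiniteDimensional ℝ F]
  {IG : ModelWithCorners ℝ EG HG} {IN : ModelWithCorners ℝ EN HN} {IM : ModelWithCorners ℝ EM HM}
  {IH : ModelWithCorners ℝ EH HH}
  [TopologicalSpace G] [ChartedSpace HG G] [IsManifold IG ∞ G]
  [TopologicalSpace N] [ChartedSpace HN N] [IsManifold IN ∞ N]
  [TopologicalSpace M] [ChartedSpace HM M] [IsManifold IM ∞ M]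
  [TopologicalSpace H] [ChartedSpace HH H] [Group H] [LieGroup IH ∞ H] [MulAction H F]
  [IG.Boundaryless] [IN.Boundaryless] [IM.Boundaryless] [IH.Boundaryless]

variable {𝒢 : Gpd G N} {Ψ : Diffeomorph (arrowModel F IM IH) IG ((H × M × M) × F) G ∞}
    {ψ : Diffeomorph (IM.prod 𝓘(ℝ, F)) IN (M × F) N ∞} {e : M → EM →ₗ[ℝ] EM}
    {c : M → EM →L[ℝ] EM →L[ℝ] EM}

set_option linter.unusedSectionVars false

theorem baseFrame_bijective (he : ∀ x, Function.Bijective (e x)) (y : N) :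
    Function.Bijective (baseFrame ψ e y) := by
  refine (ψ.der_bijective _).comp (g := der (IM.prod 𝓘(ℝ, F)) IN ψ (ψ.symm y)) ?_
  exact (he _).prodMap Function.bijective_id

namespace IsModel

variable (hM : IsModel 𝒢 Ψ ψ)

include hM

theorem leftFrame_unit (m : M) (f : F) (x : EM) (η : EH) :
    leftFrame Ψ e (𝒢.unit (ψ (m, f))) (x, η)
      = der (arrowModel F IM IH) IG Ψ ((1, m, m), f) ((η, 0, e m x), 0) := by
  rw [hM.unit, leftFrame_apply, invFrame_one]

theorem leftFrame_unit_injective (he : ∀ x, Function.Bijective (e x)) (y : N) :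
    Function.Injective (leftFrame Ψ e (𝒢.unit y)) := by
  obtain ⟨⟨m, f⟩, rfl⟩ := ψ.exists_apply_eq y
  rintro ⟨x, η⟩ ⟨x', η'⟩ hn
  rw [hM.leftFrame_unit, hM.leftFrame_unit] at hn
  have h1 := (Ψ.der_bijective _).1 hn
  simp only [Prod.mk.injEq, true_and, and_true] at h1
  rw [h1.1, (he m).1 h1.2]

theorem der_tgt_leftFrame (y : N) (n : EM × EH) :
    der IG IN 𝒢.tgt (𝒢.unit y) (leftFrame Ψ e (𝒢.unit y) n) = 0 := by
  obtain ⟨⟨m, f⟩, rfl⟩ := ψ.exists_apply_eq y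
  obtain ⟨x, η⟩ := n
  rw [hM.leftFrame_unit, hM.unit, hM.der_tgt]
  exact map_zero _

/-- The differential of the target reads off the components along `m₂` and `F`. Where they vanish,
the free components are those along `H` and `m₁`, and `e m` parametrizes the latter. -/
theorem exists_leftFrame (he : ∀ x, Function.Bijective (e x)) (y : N) (w : EG)
    (hw : der IG IN 𝒢.tgt (𝒢.unit y) w = 0) : ∃ n, leftFrame Ψ e (𝒢.unit y) n = w := by
  obtain ⟨⟨m, f⟩, rfl⟩ := ψ.exists_apply_eq y
  rw [hM.unit] at hw
  obtain ⟨⟨⟨η, x₂, x₁⟩, u⟩, rfl⟩ := (Ψ.der_bijective ((1, m, m), f)).2 w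
  rw [hM.der_tgt] at hw
  have h1 := (ψ.der_bijective _).1 (hw.trans (map_zero _).symm)
  obtain ⟨rfl, rfl⟩ := Prod.mk.inj h1
  obtain ⟨x, rfl⟩ := (he m).2 x₁
  exact ⟨(x, η), hM.leftFrame_unit m f x η⟩

theorem der_src_leftFrame (y : N) (x : EM) (η : EH) :
    der IG IN 𝒢.src (𝒢.unit y) (leftFrame Ψ e (𝒢.unit y) (x, η))
      = baseFrame ψ e y (x, der (IH.prod 𝓘(ℝ, F)) 𝓘(ℝ, F) (fun p : H × F => p.1⁻¹ • p.2)
        (1, (ψ.symm y).2) (η, 0)) := by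
  obtain ⟨⟨m, f⟩, rfl⟩ := ψ.exists_apply_eq y
  rw [hM.leftFrame_unit, hM.unit, hM.der_src, ψ.symm_apply_apply, baseFrame_apply, inv_one,
    one_smul]

theorem der_tgt_horFrame (g : G) (v : EM × F) :
    der IG IN 𝒢.tgt g (horFrame Ψ e g v) = baseFrame ψ e (𝒢.tgt g) v := by
  obtain ⟨⟨⟨h, m₂, m₁⟩, f⟩, rfl⟩ := Ψ.exists_apply_eq g
  obtain ⟨v, u⟩ := v
  rw [horFrame_apply, hM.der_tgt, hM.tgt, baseFrame_apply]

theorem horFrame_unit (y : N) (v : EM × F) :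
    horFrame Ψ e (𝒢.unit y) v = der IN IG 𝒢.unit y (baseFrame ψ e y v) := by
  obtain ⟨⟨m, f⟩, rfl⟩ := ψ.exists_apply_eq y
  obtain ⟨v, u⟩ := v
  rw [hM.unit, horFrame_apply, baseFrame_apply, hM.der_unit]

/-- The fibre of the target over the source of the arrow is parametrized by `H × M`, and in this
parametrization left translation multiplies the group element by `h` and replaces the target by that
of the arrow. The differential of this map is the left-invariant frame. -/
theorem leftInv_eq (n : EM × EH) (g : G) :
    (𝒢.leftInv IG (fun y => leftFrame Ψ e (𝒢.unit y) n) g : EG) = leftFrame Ψ e g n := by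
  obtain ⟨⟨⟨h, m₂, m₁⟩, f⟩, rfl⟩ := Ψ.exists_apply_eq g
  obtain ⟨x, η⟩ := n
  have hfst : MDifferentiableAt (IH.prod IM) IH (fun z : H × M => z.1) (1, m₁) :=
    mdifferentiableAt_fst
  have hsnd : MDifferentiableAt (IH.prod IM) IM (fun z : H × M => z.2) (1, m₁) :=
    mdifferentiableAt_snd
  have hmul : MDifferentiableAt (IH.prod IM) IH (fun z : H × M => h * z.1) (1, m₁) :=
    (mdifferentiableAt_mul_left' (I := IH) h (1 : H)).comp (1, m₁) hfst
  have hf : MDifferentiableWithinAt IG IG (fun k => 𝒢.mulExt (Ψ ((h, m₂, m₁), f), k))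
      {k | 𝒢.tgt k = 𝒢.src (Ψ ((h, m₂, m₁), f))} (𝒢.unit (𝒢.src (Ψ ((h, m₂, m₁), f)))) := by
    have h1 : ContMDiffOn IG IG ∞ (fun k => 𝒢.mulExt (Ψ ((h, m₂, m₁), f), k))
        {k | 𝒢.tgt k = 𝒢.src (Ψ ((h, m₂, m₁), f))} :=
      hM.isLieGroupoid.smooth_mul.comp (contMDiff_const.prodMk contMDiff_id).contMDiffOn
        fun k hk => Eq.symm hk
    exact (h1 _ (𝒢.tgt_unit _)).mdifferentiableWithinAt (by simp)
  refine (mfderivWithin_of_mapsTo' (φ := fun z : H × M => Ψ ((z.1, m₁, z.2), h⁻¹ • f))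
    (x := (1, m₁)) (w := (η, e m₁ x)) ?_ hf
    (mdifferentiableAt_tuple hfst mdifferentiableAt_const hsnd mdifferentiableAt_const)
    (fun z => ?_) ?_).trans ?_
  · rw [hM.src, hM.unit]
  · change 𝒢.tgt _ = 𝒢.src _
    rw [hM.tgt, hM.src]
  · rw [der_tuple hfst mdifferentiableAt_const hsnd mdifferentiableAt_const, der_const, der_const,
      der_comp_fst (f := fun z : H × M => z) mdifferentiableAt_id,
      der_comp_snd (f := fun z : H × M => z) mdifferentiableAt_id, der_id, hM.src]
    exact (hM.leftFrame_unit _ _ _ _).symm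
  · simp only [hM.mul]
    rw [der_tuple hmul mdifferentiableAt_const hsnd mdifferentiableAt_const, der_const, der_const,
      der_comp (g := fun k : H => h * k) (f := fun z : H × M => z.1)
        (mdifferentiableAt_mul_left' (I := IH) h (1 : H)) hfst,
      der_comp_fst (f := fun z : H × M => z) mdifferentiableAt_id,
      der_comp_snd (f := fun z : H × M => z) mdifferentiableAt_id, der_id, leftFrame_apply]
    simp only [mul_one]
    rfl

/-- The lift chosen by `hor` is unique: the differential of the target sends the horizontal frame to
the frame of the base, which is injective. -/
theorem hor_eq (he : ∀ x, Function.Bijective (e x)) (v : EM × F) (g : G) :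
    (𝒢.hor IG IN (modelDistribution Ψ e) (fun y => baseFrame ψ e y v) g : EG)
      = horFrame Ψ e g v := by
  have hex : ∃ w ∈ modelDistribution Ψ e g,
      mfderiv IG IN 𝒢.tgt g w = baseFrame ψ e (𝒢.tgt g) v :=
    ⟨horFrame Ψ e g v, ⟨v, rfl⟩, hM.der_tgt_horFrame g v⟩
  refine (dif_pos hex).trans ?_
  obtain ⟨⟨v', hv'⟩, h2⟩ := hex.choose_spec
  refine hv'.symm.trans (congrArg _ ((baseFrame_bijective (ψ := ψ) he (𝒢.tgt g)).1 ?_))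
  refine (hM.der_tgt_horFrame g v').symm.trans (Eq.trans ?_ h2)
  exact congrArg (der IG IN 𝒢.tgt g) hv'

/-- A horizontal motion keeps the group element constant, moves both points of `M` with the same
coefficients, and moves the vector in `F` arbitrarily. Units, inverses and products of such motions
are of the same kind. -/
theorem isCartanConnection (he : ∀ x, Function.Bijective (e x))
    (hs : ∀ v, SmoothField IG (fun g => horFrame Ψ e g v)) :
    𝒢.IsCartanConnection IG IN (modelDistribution Ψ e) where
  smooth := by
    rintro g _ ⟨v, rfl⟩
    exact ⟨Set.univ, isOpen_univ, trivial, fun g => horFrame Ψ e g v,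
      fun g _ => (hs v g).contMDiffWithinAt, rfl, fun g _ => ⟨v, rfl⟩⟩
  compl := by
    intro g
    have hd := hM.der_tgt_horFrame (e := e) g
    have hb := baseFrame_bijective (ψ := ψ) he (𝒢.tgt g)
    refine IsCompl.of_le ?_ ?_
    · rintro w ⟨⟨v, rfl⟩, hw⟩
      have h1 : baseFrame ψ e (𝒢.tgt g) v = 0 := (hd v).symm.trans hw
      have h2 : v = 0 := hb.1 (h1.trans (map_zero _).symm)
      subst h2
      exact map_zero (horFrame Ψ e g)
    · have key (w : EG) : ∃ v, der IG IN 𝒢.tgt g (w - horFrame Ψ e g v) = 0 := by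
        obtain ⟨v, hv⟩ := hb.2 (der IG IN 𝒢.tgt g w)
        exact ⟨v, by rw [map_sub, hd, hv, sub_self]⟩
      have key' (v w : EG) : v + (w - v) = w := add_sub_cancel v w
      intro w _
      obtain ⟨v, hv⟩ := key w
      exact Submodule.mem_sup.2 ⟨_, ⟨v, rfl⟩, _, hv, key' _ _⟩
  unit_mem := by
    intro y v
    obtain ⟨v', rfl⟩ := (baseFrame_bijective (ψ := ψ) he y).2 v
    exact ⟨v', hM.horFrame_unit y v'⟩
  inv_mem := by
    rintro g _ ⟨⟨v, u⟩, rfl⟩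
    obtain ⟨⟨⟨h, m₂, m₁⟩, f⟩, rfl⟩ := Ψ.exists_apply_eq g
    -- The target of the inverse is the source of the arrow. So the `F`-coefficient of the inverse
    -- motion is the velocity of `h⁻¹ • f`, while `v` is unchanged.
    refine ⟨(v, der (arrowModel F IM IH) 𝓘(ℝ, F) (fun a : (H × M × M) × F => a.1.1⁻¹ • a.2)
      ((h, m₂, m₁), f) ((0, e m₂ v, e m₁ v), u)), ?_⟩
    change _ = der IG IG 𝒢.inv (Ψ ((h, m₂, m₁), f)) (horFrame Ψ e (Ψ ((h, m₂, m₁), f)) (v, u))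
    have hinv : MDifferentiableAt (arrowModel F IM IH) IH (fun a : (H × M × M) × F => a.1.1⁻¹)
      ((h, m₂, m₁), f) := ((contMDiff_inv IH ∞).comp contMDiff_group).mdifferentiableAt (by simp)
    rw [hM.inv, horFrame_apply, horFrame_apply,
      ← der_comp (hM.isLieGroupoid.smooth_inv.mdifferentiableAt (by simp)) (Ψ.mdiff _)]
    simp only [hM.inv_apply]
    rw [der_tuple hinv (contMDiff_right.mdifferentiableAt (by simp))
      (contMDiff_left.mdifferentiableAt (by simp))
      (hM.contMDiff_act_arrow.mdifferentiableAt (by simp)), der_right, der_left,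
      der_comp (g := fun k : H => k⁻¹) ((contMDiff_inv IH ∞).mdifferentiableAt (by simp))
      (contMDiff_group.mdifferentiableAt (by simp)), der_group, map_zero]
  mul_mem := by
    rintro g k hgk _ ⟨⟨v, u⟩, rfl⟩ _ ⟨⟨v', u'⟩, rfl⟩ hc
    obtain ⟨⟨⟨h, m₂, m₁⟩, f⟩, rfl⟩ := Ψ.exists_apply_eq g
    obtain ⟨⟨⟨h', m₁', m₀⟩, f'⟩, rfl⟩ := Ψ.exists_apply_eq k
    rw [hM.src, hM.tgt] at hgk
    obtain ⟨rfl, rfl⟩ := Prod.mk.inj (ψ.injective hgk)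
    have hc' : der IG IN 𝒢.src (Ψ ((h, m₂, m₁), f)) (horFrame Ψ e (Ψ ((h, m₂, m₁), f)) (v, u))
        = der IG IN 𝒢.tgt (Ψ ((h', m₁, m₀), h⁻¹ • f))
          (horFrame Ψ e (Ψ ((h', m₁, m₀), h⁻¹ • f)) (v', u')) := hc
    rw [horFrame_apply, horFrame_apply, hM.der_src, hM.der_tgt] at hc'
    -- Composability of the tangent vectors forces the same `v` on both arrows, and makes `u'` the
    -- velocity of `h⁻¹ • f`.
    obtain ⟨hv, hu⟩ := Prod.mk.inj ((ψ.der_bijective _).1 hc')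
    obtain rfl := (he m₁).1 hv
    -- The relevant composable pairs are parametrized by the first arrow and the source point of the
    -- second one, with the group element `h'` of the second arrow fixed, which suffices because it
    -- does not move in a horizontal motion. The vector `w₀` below is the velocity of the given pair
    -- in these parameters. The product has the target of the first arrow, hence the coefficients
    -- `(v, u)`.
    let a : (H × M × M) × F := ((h, m₂, m₁), f)
    let IZ := (arrowModel F IM IH).prod IM
    have d1 : ContMDiff IZ (arrowModel F IM IH) ∞
      (fun z : ((H × M × M) × F) × M => z.1) := contMDiff_fst
    have d2 : ContMDiff IZ IM ∞ (fun z : ((H × M × M) × F) × M => z.2) := contMDiff_snd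
    have d3 : ContMDiff IZ IM ∞ (fun z : ((H × M × M) × F) × M => z.1.1.2.1) :=
      contMDiff_left.comp d1
    have d4 : ContMDiff IZ IM ∞ (fun z : ((H × M × M) × F) × M => z.1.1.2.2) :=
      contMDiff_right.comp d1
    have d5 : ContMDiff IZ 𝓘(ℝ, F) ∞ (fun z : ((H × M × M) × F) × M => z.1.1.1⁻¹ • z.1.2) :=
      hM.contMDiff_act_arrow.comp d1
    have d6 : ContMDiff IZ IH ∞ (fun z : ((H × M × M) × F) × M => z.1.1.1 * h') :=
      (contMDiff_mul_right (I := IH) (n := ∞)).comp (contMDiff_group.comp d1)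
    have d7 : ContMDiff IZ 𝓘(ℝ, F) ∞ (fun z : ((H × M × M) × F) × M => z.1.2) :=
      contMDiff_vec.comp d1
    have hd {φ : ((H × M × M) × F) × M → G} (hφ : ContMDiff IZ IG ∞ φ) :
      MDifferentiableAt IZ IG φ (a, m₀) := hφ.mdifferentiableAt (by simp)
    have p1 : ContMDiff IZ IG ∞ (fun z : ((H × M × M) × F) × M => Ψ z.1) := Ψ.contMDiff.comp d1
    have p2 : ContMDiff IZ IG ∞ (fun z : ((H × M × M) × F) × M =>
        Ψ ((h', z.1.1.2.2, z.2), z.1.1.1⁻¹ • z.1.2)) :=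
      Ψ.contMDiff.comp ((contMDiff_const.prodMk (d4.prodMk d2)).prodMk d5)
    have e1 (w : (EH × EM × EM) × F) (v : EM) :
        der IZ (arrowModel F IM IH) (fun z : ((H × M × M) × F) × M => z.1) (a, m₀) (w, v) = w :=
      der_fst (a, m₀) (w, v)
    have e2 (w : (EH × EM × EM) × F) (v : EM) :
        der IZ IM (fun z : ((H × M × M) × F) × M => z.2) (a, m₀) (w, v) = v :=
      der_snd (a, m₀) (w, v)
    let w₀ : ((EH × EM × EM) × F) × EM := (((0, e m₂ v, e m₁ v), u), e m₀ v)
    refine ⟨(v, u), ?_⟩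
    have hcomp : (Ψ a, Ψ ((h', m₁, m₀), h⁻¹ • f)) ∈ 𝒢.composable := by
      change 𝒢.src _ = 𝒢.tgt _
      rw [hM.src, hM.tgt]
    refine Eq.trans ?_ (mfderivWithin_of_mapsTo' (I := IG.prod IG) (x := (a, m₀)) (w := w₀)
      (φ := fun z : ((H × M × M) × F) × M =>
        (Ψ z.1, Ψ ((h', z.1.1.2.2, z.2), z.1.1.1⁻¹ • z.1.2))) rfl
      ((hM.isLieGroupoid.smooth_mul _ hcomp).mdifferentiableWithinAt (by simp))
      ((hd p1).prodMk (hd p2)) (fun z => ?_) ?_).symm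
    · rw [hM.mul, horFrame_apply]
      have e3 : (fun z : ((H × M × M) × F) × M =>
          𝒢.mulExt (Ψ z.1, Ψ ((h', z.1.1.2.2, z.2), z.1.1.1⁻¹ • z.1.2)))
          = fun z => Ψ ((z.1.1.1 * h', z.1.1.2.1, z.2), z.1.2) :=
        funext fun z => hM.mul _ _ _ _ _ _
      rw [e3, der_tuple (d6.mdifferentiableAt (by simp)) (d3.mdifferentiableAt (by simp))
        (d2.mdifferentiableAt (by simp)) (d7.mdifferentiableAt (by simp)), e2,
        der_comp (g := fun a : (H × M × M) × F => a.1.2.1)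
          (contMDiff_left.mdifferentiableAt (by simp)) (d1.mdifferentiableAt (by simp)), der_left,
        der_comp (g := fun a : (H × M × M) × F => a.2)
          (contMDiff_vec.mdifferentiableAt (by simp)) (d1.mdifferentiableAt (by simp)), der_vec,
        der_comp (g := fun k : H => k * h') (f := fun z : ((H × M × M) × F) × M => z.1.1.1)
          (mdifferentiableAt_mul_right' _ _)
          ((contMDiff_group.comp d1).mdifferentiableAt (n := ∞) (by simp)),
        der_comp (g := fun a : (H × M × M) × F => a.1.1)
          (contMDiff_group.mdifferentiableAt (by simp)) (d1.mdifferentiableAt (by simp)), der_group,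
        e1, map_zero]
    · change 𝒢.src _ = 𝒢.tgt _
      rw [hM.src_apply, hM.tgt]
    · rw [der_prodMk (hd p1) (hd p2)]
      refine Prod.ext ?_ ?_
      · dsimp only
        rw [der_comp (Ψ.mdiff _) (d1.mdifferentiableAt (by simp)), e1]
        exact (horFrame_apply _ _ _ _ _ _).symm
      · dsimp only
        rw [der_tuple mdifferentiableAt_const (d4.mdifferentiableAt (by simp))
          (d2.mdifferentiableAt (by simp)) (d5.mdifferentiableAt (by simp)), der_const, e2,
          der_comp (g := fun a : (H × M × M) × F => a.1.2.2)
            (contMDiff_right.mdifferentiableAt (by simp)) (d1.mdifferentiableAt (by simp)),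
          der_right,
          der_comp (g := fun a : (H × M × M) × F => a.1.1⁻¹ • a.2)
            (hM.contMDiff_act_arrow.mdifferentiableAt (by simp)) (d1.mdifferentiableAt (by simp)),
          hM.der_act_arrow, e1]
        refine Eq.trans ?_ (horFrame_apply _ _ _ _ _ _).symm
        exact congrArg (fun t : F => der (arrowModel F IM IH) IG Ψ ((h', m₁, m₀), h⁻¹ • f)
          ((0, e m₁ v, e m₀ v), t)) hu

end IsModel

end Model

end Gpd

/-! ### Smoothness and brackets of the frames of the model -/

namespace Gpd

section Model

variable {EG HG EN HN EM HM EH HH F G N M H : Type*}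
  [NormedAddCommGroup EG] [NormedSpace ℝ EG] [FiniteDimensional ℝ EG] [TopologicalSpace HG]
  [NormedAddCommGroup EN] [NormedSpace ℝ EN] [FiniteDimensional ℝ EN] [TopologicalSpace HN]
  [NormedAddCommGroup EM] [NormedSpace ℝ EM] [FiniteDimensional ℝ EM] [TopologicalSpace HM]
  [NormedAddCommGroup EH] [NormedSpace ℝ EH] [FiniteDimensional ℝ EH] [TopologicalSpace HH]
  [NormedAddCommGroup F] [NormedSpace ℝ F] [FiniteDimensional ℝ F]
  {IG : ModelWithCorners ℝ EG HG} {IN : ModelWithCorners ℝ EN HN} {IM : ModelWithCorners ℝ EM HM}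
  {IH : ModelWithCorners ℝ EH HH}
  [TopologicalSpace G] [ChartedSpace HG G] [IsManifold IG ∞ G]
  [TopologicalSpace N] [ChartedSpace HN N] [IsManifold IN ∞ N]
  [TopologicalSpace M] [ChartedSpace HM M] [IsManifold IM ∞ M]
  [TopologicalSpace H] [ChartedSpace HH H] [Group H] [LieGroup IH ∞ H] [MulAction H F]
  [IG.Boundaryless] [IN.Boundaryless] [IM.Boundaryless] [IH.Boundaryless]

variable {𝒢 : Gpd G N} {Ψ : Diffeomorph (arrowModel F IM IH) IG ((H × M × M) × F) G ∞}
    {ψ : Diffeomorph (IM.prod 𝓘(ℝ, F)) IN (M × F) N ∞} {e : M → EM →ₗ[ℝ] EM}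
    {c : M → EM →L[ℝ] EM →L[ℝ] EM}

set_option linter.unusedSectionVars false

section Smoothness

variable (hf : IsFrame IM e c)

include hf

theorem IsFrame.smooth_baseField (v : EM × F) :
    SmoothField (IM.prod 𝓘(ℝ, F)) (fun z : M × F => ((e z.1 v.1, v.2) : EM × F)) :=
  (hf.smooth v.1).prodMap (SmoothField.const v.2)

theorem IsFrame.smooth_leftField (n : EM × EH) :
    SmoothField (arrowModel F IM IH) (fun a : (H × M × M) × F =>
      (((invFrame IH a.1.1 n.2, 0, e a.1.2.2 n.1), 0) : (EH × EM × EM) × F)) :=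
  SmoothField.prodMap (V := fun b : H × M × M => (invFrame IH b.1 n.2, (0 : EM), e b.2.2 n.1))
    (SmoothField.prodMap (W := fun b : M × M => ((0 : EM), e b.2 n.1)) (smoothField_invFrame n.2)
      (SmoothField.prodMap SmoothField.zero (hf.smooth n.1))) SmoothField.zero

theorem IsFrame.smooth_horField (v : EM × F) :
    SmoothField (arrowModel F IM IH) (fun a : (H × M × M) × F =>
      (((0, e a.1.2.1 v.1, e a.1.2.2 v.1), v.2) : (EH × EM × EM) × F)) :=
  SmoothField.prodMap (V := fun b : H × M × M => ((0 : EH), e b.2.1 v.1, e b.2.2 v.1))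
    (SmoothField.prodMap (W := fun b : M × M => (e b.1 v.1, e b.2 v.1)) SmoothField.zero
      (SmoothField.prodMap (hf.smooth v.1) (hf.smooth v.1))) (SmoothField.const v.2)

theorem smooth_baseFrame (v : EM × F) : SmoothField IN (fun y => baseFrame ψ e y v) :=
  ψ.smoothField_push (IsFrame.smooth_baseField hf v)

theorem smooth_leftFrame (n : EM × EH) : SmoothField IG (fun g => leftFrame Ψ e g n) :=
  Ψ.smoothField_push (IsFrame.smooth_leftField hf n)

theorem smooth_horFrame (v : EM × F) : SmoothField IG (fun g => horFrame Ψ e g v) :=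
  Ψ.smoothField_push (IsFrame.smooth_horField hf v)

theorem lieB_baseFrame (v w : EM × F) (y : N) :
    lieB IN (fun y => baseFrame ψ e y v) (fun y => baseFrame ψ e y w) y
      = baseFrame ψ e y (c (ψ.symm y).1 v.1 w.1, 0) := by
  have := FiniteDimensional.complete ℝ EN
  have := FiniteDimensional.complete ℝ EM
  have := FiniteDimensional.complete ℝ F
  refine (ψ.lieB_push (IsFrame.smooth_baseField hf v) (IsFrame.smooth_baseField hf w) y).trans
    (congrArg (fun t : EM × F => der (IM.prod 𝓘(ℝ, F)) IN ψ (ψ.symm y) t) ?_)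
  rw [lieB_prod (hf.smooth v.1) (SmoothField.const v.2) (hf.smooth w.1) (SmoothField.const w.2),
    hf.lieB_eq, lieB_const]
  rfl

theorem lieB_leftFrame {k : EH →L[ℝ] EH →L[ℝ] EH}
    (hk : ∀ (η θ : EH) (h : H), lieB IH (fun h : H => invFrame IH h η) (fun h => invFrame IH h θ) h
      = invFrame IH h (k η θ)) (n m : EM × EH) (g : G) :
    lieB IG (fun g => leftFrame Ψ e g n) (fun g => leftFrame Ψ e g m) g
      = leftFrame Ψ e g (c (Ψ.symm g).1.2.2 n.1 m.1, k n.2 m.2) := by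
  have := FiniteDimensional.complete ℝ EG
  have := FiniteDimensional.complete ℝ EM
  have := FiniteDimensional.complete ℝ EH
  have := FiniteDimensional.complete ℝ F
  refine (Ψ.lieB_push (IsFrame.smooth_leftField hf n) (IsFrame.smooth_leftField hf m) g).trans
    (congrArg (fun t : (EH × EM × EM) × F => der (arrowModel F IM IH) IG Ψ (Ψ.symm g) t) ?_)
  have s0 (n : EM × EH) : SmoothField (IM.prod IM) (fun b : M × M => ((0 : EM), e b.2 n.1)) :=
    SmoothField.prodMap SmoothField.zero (hf.smooth n.1)
  have s1 (n : EM × EH) : SmoothField (IH.prod (IM.prod IM))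
      (fun b : H × M × M => (invFrame IH b.1 n.2, (0 : EM), e b.2.2 n.1)) :=
    SmoothField.prodMap (W := fun b : M × M => ((0 : EM), e b.2 n.1)) (smoothField_invFrame n.2)
      (s0 n)
  refine (lieB_prod (s1 n) SmoothField.zero (s1 m) SmoothField.zero _).trans ?_
  rw [lieB_prod (smoothField_invFrame n.2) (s0 n) (smoothField_invFrame m.2) (s0 m),
    lieB_prod SmoothField.zero (hf.smooth n.1) SmoothField.zero (hf.smooth m.1), hf.lieB_eq, hk,
    lieB_zero_left, lieB_zero_left]
  rfl

/-- The horizontal field has no component along `H`, and the left-invariant one has none along the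
target point or along `F`. Only the factor of the source point sees both fields, and there the
bracket is that of the frame `e`. -/
theorem lieB_horFrame_leftFrame (v : EM × F) (n : EM × EH) (g : G) :
    lieB IG (fun g => horFrame Ψ e g v) (fun g => leftFrame Ψ e g n) g
      = leftFrame Ψ e g (c (Ψ.symm g).1.2.2 v.1 n.1, 0) := by
  have := FiniteDimensional.complete ℝ EG
  have := FiniteDimensional.complete ℝ EM
  have := FiniteDimensional.complete ℝ EH
  have := FiniteDimensional.complete ℝ F
  refine (Ψ.lieB_push (IsFrame.smooth_horField hf v) (IsFrame.smooth_leftField hf n) g).trans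
    (congrArg (fun t : (EH × EM × EM) × F => der (arrowModel F IM IH) IG Ψ (Ψ.symm g) t) ?_)
  have s0 : SmoothField (IM.prod IM) (fun b : M × M => ((0 : EM), e b.2 n.1)) :=
    SmoothField.prodMap SmoothField.zero (hf.smooth n.1)
  have s1 : SmoothField (IH.prod (IM.prod IM))
      (fun b : H × M × M => (invFrame IH b.1 n.2, (0 : EM), e b.2.2 n.1)) :=
    SmoothField.prodMap (W := fun b : M × M => ((0 : EM), e b.2 n.1)) (smoothField_invFrame n.2) s0
  have t0 : SmoothField (IM.prod IM) (fun b : M × M => (e b.1 v.1, e b.2 v.1)) :=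
    SmoothField.prodMap (hf.smooth v.1) (hf.smooth v.1)
  have t1 : SmoothField (IH.prod (IM.prod IM))
      (fun b : H × M × M => ((0 : EH), e b.2.1 v.1, e b.2.2 v.1)) :=
    SmoothField.prodMap (W := fun b : M × M => (e b.1 v.1, e b.2 v.1)) SmoothField.zero t0
  refine (lieB_prod t1 (SmoothField.const v.2) s1 SmoothField.zero _).trans ?_
  rw [lieB_prod SmoothField.zero t0 (smoothField_invFrame n.2) s0,
    lieB_prod (hf.smooth v.1) (hf.smooth v.1) SmoothField.zero (hf.smooth n.1), hf.lieB_eq,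
    lieB_zero_left, lieB_zero_right, lieB_zero_right]
  exact congrArg (fun t : EH => (((t, 0, e (Ψ.symm g).1.2.2 (c (Ψ.symm g).1.2.2 v.1 n.1)), 0) :
    (EH × EM × EM) × F)) (map_zero (invFrame IH (Ψ.symm g).1.1)).symm

end Smoothness

/-- The derivative at the unit of the map `h ↦ h⁻¹ • f`, at the point of `F` under `y`. -/
def isotropyAnchor (IH : ModelWithCorners ℝ EH HH) (H : Type*) [TopologicalSpace H]
    [ChartedSpace HH H] [Group H] [MulAction H F]
    (ψ : Diffeomorph (IM.prod 𝓘(ℝ, F)) IN (M × F) N ∞) (y : N) : EH →ₗ[ℝ] F :=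
  (der (IH.prod 𝓘(ℝ, F)) 𝓘(ℝ, F) (fun p : H × F => p.1⁻¹ • p.2) (1, (ψ.symm y).2)).toLinearMap ∘ₗ
    LinearMap.inl ℝ EH F

/-- The bridge from the model to the calculus in coefficients. On general arrows the structure
functions occur at the source point; at a unit this is the point of `M` under the base point. -/
theorem IsModel.isFramed (hM : IsModel 𝒢 Ψ ψ) (hf : IsFrame IM e c) {k : EH →L[ℝ] EH →L[ℝ] EH}
    (hk : ∀ (η θ : EH) (h : H), lieB IH (fun h : H => invFrame IH h η) (fun h => invFrame IH h θ) h
      = invFrame IH h (k η θ)) :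
    IsFramed IG IN IM 𝒢 (modelDistribution Ψ e) e c k (fun y => (ψ.symm y).1) (baseFrame ψ e)
      (fun y => leftFrame Ψ e (𝒢.unit y)) (isotropyAnchor IH H ψ) (horFrame Ψ e)
      (leftFrame Ψ e) where
  lie := hM.isLieGroupoid
  frame := hf
  smooth_pr := contMDiff_fst.comp ψ.symm.contMDiff
  der_pr y v := by
    obtain ⟨⟨m, f⟩, rfl⟩ := ψ.exists_apply_eq y
    obtain ⟨v, u⟩ := v
    rw [baseFrame_apply, der_comp (g := fun z : M × F => z.1) mdifferentiableAt_fst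
      (ψ.mdiff_symm _), ψ.der_symm_der, ψ.symm_apply_apply]
    exact der_fst _ _
  smooth_eB := smooth_baseFrame hf
  bijective_eB := baseFrame_bijective hf.bijective
  smooth_eA n y := (smooth_leftFrame hf n (𝒢.unit y)).comp (g := 𝒢.unit) (IX := IN)
    (hM.contMDiff_unit y)
  injective_eA := hM.leftFrame_unit_injective hf.bijective
  vertical_eA := hM.der_tgt_leftFrame
  exists_eA := hM.exists_leftFrame hf.bijective
  anchor_eA y n := hM.der_src_leftFrame y n.1 n.2
  lieB_eB v w y := lieB_baseFrame hf v w y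
  smooth_HB := smooth_horFrame hf
  smooth_LA := smooth_leftFrame hf
  hor_eq := hM.hor_eq hf.bijective
  leftInv_eq := hM.leftInv_eq
  HB_unit := hM.horFrame_unit
  LA_unit _ _ := rfl
  lieB_LA n m y := by
    rw [lieB_leftFrame hf hk]
    obtain ⟨⟨m, f⟩, rfl⟩ := ψ.exists_apply_eq y
    rw [hM.unit, Ψ.symm_apply_apply, ψ.symm_apply_apply]
  lieB_HB_LA v n y := by
    rw [lieB_horFrame_leftFrame hf]
    obtain ⟨⟨m, f⟩, rfl⟩ := ψ.exists_apply_eq y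
    rw [hM.unit, Ψ.symm_apply_apply, ψ.symm_apply_apply]

end Model

end Gpd

/-! ### Existence of structure functions -/

section

variable {E H M F EX HX X : Type*} [NormedAddCommGroup E] [NormedSpace ℝ E] [FiniteDimensional ℝ E]
  [TopologicalSpace H] {I : ModelWithCorners ℝ E H} [TopologicalSpace M] [ChartedSpace H M]
  [IsManifold I ∞ M] [NormedAddCommGroup EX] [NormedSpace ℝ EX] [TopologicalSpace HX]
  {IX : ModelWithCorners ℝ EX HX} [TopologicalSpace X] [ChartedSpace HX X]

/-- The structure functions of a frame. -/
theorem exists_isFrame [I.Boundaryless] {e : M → E →ₗ[ℝ] E}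
    (hs : ∀ v, SmoothField I (fun x => e x v)) (hb : ∀ x, Function.Bijective (e x)) :
    ∃ c, IsFrame I e c := by
  have := FiniteDimensional.complete ℝ E
  let L (v w : E) : M → E := lieB I (fun y => e y v) (fun y => e y w)
  let ε (x : M) : E ≃ₗ[ℝ] E := LinearEquiv.ofBijective (e x) (hb x)
  have hswap (v w : E) (x : M) : L v w x = - L w v x := lieB_swap _ _ _
  have hadd (v w w' : E) (x : M) : L v (w + w') x = L v w x + L v w' x := by
    refine Eq.trans ?_ (lieB_add_right (hs w) (hs w') x)
    simp only [L, map_add]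
  have hsmul (r : ℝ) (v w : E) (x : M) : L v (r • w) x = r • L v w x := by
    refine Eq.trans ?_ (lieB_smul_right r (hs w) x)
    simp only [L, map_smul]
  -- The bracket of two frame fields is expressed in the frame point by point; smoothness of the
  -- result is that of the coefficients of a smooth field.
  let K (x : M) : E →ₗ[ℝ] E →ₗ[ℝ] E := (LinearMap.mk₂ ℝ (fun v w => L v w x)
    (fun v v' w => by rw [hswap, hadd, hswap w v, hswap w v']; abel)
    (fun r v w => by rw [hswap, hsmul, hswap w v]; simp) (fun v w w' => hadd v w w' x)
    (fun r v w => hsmul r v w x)).compr₂ (ε x).symm.toLinearMap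
  let c : M → E →L[ℝ] E →L[ℝ] E := fun x => LinearMap.toContinuousLinearMap
    ((LinearMap.toContinuousLinearMap : (E →ₗ[ℝ] E) ≃ₗ[ℝ] (E →L[ℝ] E)).toLinearMap ∘ₗ K x)
  have hc (v w : E) (x : M) : L v w x = e x (c x v w) := ((ε x).apply_symm_apply _).symm
  refine ⟨c, hs, hb, fun x => contMDiffAt_clm_of_apply fun v => contMDiffAt_clm_of_apply fun w =>
    ?_, hc⟩
  exact SmoothAlongAt.coeff (b := e) (fun v => hs v x) (hb x).1
    ((((hs v).lieB (hs w)) x).congr rfl (funext fun y => (hc v w y).symm))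

omit [FiniteDimensional ℝ E] in
theorem SmoothAlongAt.sum {ι : Type*} {s : Finset ι} {r : ι → ℝ} {f : X → M} {w : ι → X → E}
    {x₀ : X} (hf : ContMDiffAt IX I ∞ f x₀) (h : ∀ i ∈ s, SmoothAlongAt I IX f (w i) x₀) :
    SmoothAlongAt I IX f (fun x => ∑ i ∈ s, r i • w i x) x₀ := by
  refine smoothAlongAt_iff.2 ⟨hf, ?_⟩
  simp only [map_sum, map_smul]
  refine contMDiffAt_finsetSum fun i hi => ?_
  exact ((r i) • ContinuousLinearMap.id ℝ E).contMDiff.contMDiffAt.comp x₀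
    (smoothAlongAt_iff.1 (h i hi)).2

theorem SmoothAlongAt.contMDiffAt_of_const {p : M} {φ : X → E} {x₀ : X}
    (h : SmoothAlongAt I IX (fun _ => p) φ x₀) : ContMDiffAt IX 𝓘(ℝ, E) ∞ φ x₀ :=
  SmoothAlongAt.coeff (b := fun _ => LinearMap.id) (fun v => SmoothAlongAt.const p v x₀)
    Function.injective_id h

end

/-! ### Cartan connections of the pair groupoid are parallelisms -/

namespace Gpd

section Pair

variable {E H M : Type*} [NormedAddCommGroup E] [NormedSpace ℝ E] [FiniteDimensional ℝ E]
  [TopologicalSpace H] {I : ModelWithCorners ℝ E H} [TopologicalSpace M] [ChartedSpace H M]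
  [IsManifold I ∞ M] {D : ∀ g : M × M, Submodule ℝ (TangentSpace (I.prod I) g)}

set_option linter.unusedSectionVars false

/-- Composable pairs are parametrized by triples of points, on which the composition forgets the
middle one. -/
theorem tangentMul_pair (x y z : M) (a b b' d : E) (h : b = b') :
    ((pair M).tangentMul (I.prod I) (x, y) (y, z) (a, b) (b', d) : E × E) = (a, d) := by
  subst h
  have hφ : MDifferentiableAt (I.prod (I.prod I)) ((I.prod I).prod (I.prod I))
      (fun p : M × M × M => ((p.1, p.2.1), (p.2.1, p.2.2))) (x, y, z) :=
    ContMDiffAt.mdifferentiableAt (n := ∞) ((contMDiffAt_fst.prodMk (contMDiffAt_fst.comp _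
      contMDiffAt_snd)).prodMk contMDiffAt_snd) (by simp)
  have he : Set.EqOn (pair M).mulExt (fun q : (M × M) × M × M => (q.1.1, q.2.2))
      (pair M).composable := fun q hq => dif_pos hq
  have hs : ContMDiffOn ((I.prod I).prod (I.prod I)) (I.prod I) ∞ (pair M).mulExt
      (pair M).composable :=
    ((contMDiff_fst.comp contMDiff_fst).prodMk
      (contMDiff_snd.comp contMDiff_snd)).contMDiffOn.congr he
  have hd1 : MDifferentiableAt (I.prod (I.prod I)) I (fun p : M × M × M => p.1) (x, y, z) :=
    mdifferentiableAt_fst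
  have hd2 : MDifferentiableAt (I.prod (I.prod I)) (I.prod I) (fun p : M × M × M => p.2) (x, y, z) :=
    mdifferentiableAt_snd
  have hd3 : MDifferentiableAt (I.prod (I.prod I)) I (fun p : M × M × M => p.2.1) (x, y, z) :=
    mdifferentiableAt_fst.comp (x, y, z) hd2
  have hd4 : MDifferentiableAt (I.prod (I.prod I)) I (fun p : M × M × M => p.2.2) (x, y, z) :=
    mdifferentiableAt_snd.comp (x, y, z) hd2
  have e1 : der (I.prod (I.prod I)) ((I.prod I).prod (I.prod I))
      (fun p : M × M × M => ((p.1, p.2.1), (p.2.1, p.2.2))) (x, y, z) (a, b, d)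
      = ((a, b), (b, d)) := by
    rw [der_prodMk (hd1.prodMk hd3) hd2, der_prodMk hd1 hd3, der_fst, der_snd,
      der_comp_fst hd2, der_snd]
  have h1 := mfderivWithin_of_mapsTo' (f := (pair M).mulExt) (I' := I.prod I) (w := (a, b, d))
    (φ := fun p : M × M × M => ((p.1, p.2.1), (p.2.1, p.2.2))) rfl
    ((hs ((x, y), (y, z)) rfl).mdifferentiableWithinAt (by simp)) hφ (fun _ => rfl) e1
  refine h1.trans ?_
  have e2 : (fun p : M × M × M => (pair M).mulExt ((p.1, p.2.1), (p.2.1, p.2.2)))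
      = fun p => (p.1, p.2.2) := funext fun p => dif_pos rfl
  rw [e2, der_prodMk hd1 hd4, der_fst, der_comp_snd hd2, der_snd]

namespace IsCartanConnection

variable (hD : (pair M).IsCartanConnection (I.prod I) I D)

include hD

/-- The target is the first projection, so a complement of the kernel of its differential is a graph
over the first factor. -/
theorem pair_existsUnique (g : M × M) (v : E) : ∃! w : E, ((v, w) : E × E) ∈ D g := by
  let K : Submodule ℝ (E × E) := LinearMap.ker (der (I.prod I) I (pair M).tgt g).toLinearMap
  let D' : Submodule ℝ (E × E) := D g
  have hc : IsCompl D' K := hD.compl g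
  have hk (u : E × E) : u ∈ K ↔ u.1 = 0 := by
    have h1 : der (I.prod I) I (pair M).tgt g u = u.1 := der_fst g u
    rw [← h1]
    exact LinearMap.mem_ker
  have htop : ((v, 0) : E × E) ∈ D' ⊔ K := by rw [hc.sup_eq_top]; trivial
  obtain ⟨⟨a, w⟩, ha, ⟨b, b'⟩, hb, hab⟩ := Submodule.mem_sup.1 htop
  obtain rfl : b = 0 := (hk _).1 hb
  obtain rfl : a = v := (add_zero a).symm.trans (congrArg Prod.fst hab)
  refine ⟨w, ha, fun w' hw => ?_⟩
  have h3 := (Submodule.disjoint_def.1 hc.disjoint) _ (D'.sub_mem hw ha) ((hk _).2 (sub_self a))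
  exact sub_eq_zero.1 (congrArg Prod.snd h3)

theorem pair_inv {x y : M} {v w : E} (h : ((v, w) : E × E) ∈ D (x, y)) :
    ((w, v) : E × E) ∈ D (y, x) := by
  have h1 := hD.inv_mem (x, y) (v, w) h
  have h2 : der (I.prod I) (I.prod I) (fun g : M × M => (g.2, g.1)) (x, y) (v, w) = (w, v) := by
    rw [der_prodMk (mdifferentiableAt_snd) mdifferentiableAt_fst, der_fst, der_snd]
  rw [← h2]
  exact h1

theorem pair_mul {x y z : M} {u v w : E} (h : ((u, v) : E × E) ∈ D (x, y))
    (h' : ((v, w) : E × E) ∈ D (y, z)) : ((u, w) : E × E) ∈ D (x, z) := by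
  have h1 := hD.mul_mem (x, y) (y, z) rfl (u, v) h (v, w) h'
    ((der_snd (I := I) (I' := I) (x, y) (u, v)).trans
      (der_fst (I := I) (I' := I) (y, z) (v, w)).symm)
  have h2 : (pair M).mulExt ((x, y), (y, z)) = (x, z) := dif_pos rfl
  have h3 := tangentMul_pair (I := I) x y z u v v w rfl
  have h4 : ((pair M).tangentMul (I.prod I) (x, y) (y, z) (u, v) (v, w) : E × E)
    ∈ (D ((pair M).mulExt ((x, y), (y, z))) : Submodule ℝ (E × E)) := h1
  rw [h3] at h4
  -- The product arrow equals `(x, z)` only propositionally, so the membership has to be moved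
  -- between the two fibres of `D`.
  have h5 : ∀ g g' : M × M, g = g' → ∀ t : E × E, t ∈ (D g : Submodule ℝ (E × E)) →
    t ∈ (D g' : Submodule ℝ (E × E)) := by rintro g _ rfl t ht; exact ht
  exact h5 _ _ h2 _ h4

/-- Near `x₁`, choose local fields `X i` in `D` through a basis of the graph and restrict them to
the slice of points `(x₀, x)`. With `Φ` the matrix of their first components and `Γ` that of their
second ones, `e = Γ ∘ Φ⁻¹` wherever `Φ` is invertible. This holds near `x₁`, since `Φ x₁` is the
identity. -/
theorem pair_smooth (x₀ : M) {e : M → E →ₗ[ℝ] E}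
    (he : ∀ x v, ((v, e x v) : E × E) ∈ D (x₀, x)) (v : E) : SmoothField I (fun x => e x v) := by
  intro x₁
  have := FiniteDimensional.complete ℝ E
  have huniq {x : M} {v w : E} (h : ((v, w) : E × E) ∈ D (x₀, x)) : e x v = w :=
    (hD.pair_existsUnique _ _).unique (he x v) h
  let b := Module.finBasis ℝ E
  have hX (i) : ∃ X : M × M → E × E, SmoothAlongAt (I.prod I) (I.prod I) (fun g => g) X (x₀, x₁) ∧
      X (x₀, x₁) = (b i, e x₁ (b i)) ∧ ∀ᶠ g in 𝓝 (x₀, x₁), X g ∈ (D g : Submodule ℝ (E × E)) := by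
    obtain ⟨U, hU, hxU, X, hX, h1, h2⟩ := hD.smooth (x₀, x₁) _ (he x₁ (b i))
    exact ⟨X, hX.contMDiffAt (hU.mem_nhds hxU), h1,
      Filter.eventually_of_mem (hU.mem_nhds hxU) h2⟩
  choose X hXs hX1 hXD using hX
  have hι : ContMDiffAt I (I.prod I) ∞ (fun x : M => (x₀, x)) x₁ :=
    contMDiffAt_const.prodMk contMDiffAt_id
  have hs (i) := (hXs i).comp (g := fun x : M => (x₀, x)) (IX := I) hι
  let Φ (x : M) : E →L[ℝ] E :=
    LinearMap.toContinuousLinearMap (b.constr ℝ (fun i => (X i (x₀, x)).1))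
  let Γ (x : M) : E →ₗ[ℝ] E := b.constr ℝ (fun i => (X i (x₀, x)).2)
  have hfst (i) : ContMDiffAt I 𝓘(ℝ, E) ∞ (fun x => (X i (x₀, x)).1) x₁ :=
    SmoothAlongAt.contMDiffAt_of_const (p := x₀) (I := I)
      (((hs i).map (g := Prod.fst) contMDiffAt_fst).congr rfl
        (funext fun x => (der_fst (I := I) (I' := I) (x₀, x) _).symm))
  have hsnd (i) : SmoothAlongAt I I (fun x => x) (fun x => (X i (x₀, x)).2) x₁ :=
    ((hs i).map (g := Prod.snd) contMDiffAt_snd).congr rfl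
      (funext fun x => (der_snd (I := I) (I' := I) (x₀, x) _).symm)
  have hΦ : ContMDiffAt I 𝓘(ℝ, E →L[ℝ] E) ∞ Φ x₁ := by
    refine contMDiffAt_clm_of_apply fun u => ?_
    simp only [Φ, LinearMap.coe_toContinuousLinearMap', Module.Basis.constr_apply_fintype]
    exact contMDiffAt_finsetSum fun i _ =>
      ((b.equivFun u i) • ContinuousLinearMap.id ℝ E).contMDiff.contMDiffAt.comp (I' := 𝓘(ℝ, E)) x₁
        (hfst i)
  have hΓ (u : E) : SmoothAlongAt I I (fun x => x) (fun x => Γ x u) x₁ := by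
    simp only [Γ, Module.Basis.constr_apply_fintype]
    exact SmoothAlongAt.sum contMDiffAt_id fun i _ => hsnd i
  have hΦ1 : Φ x₁ = ContinuousLinearEquiv.refl ℝ E := by
    ext u
    change b.constr ℝ (fun i => (X i (x₀, x₁)).1) u = u
    simp only [hX1]
    exact congrArg (fun L : E →ₗ[ℝ] E => L u) (b.ext (f₁ := b.constr ℝ fun i => b i)
      (f₂ := LinearMap.id) fun i => b.constr_basis _ _ _)
  have hinv : ContMDiffAt I 𝓘(ℝ, E) ∞ (fun x => (Φ x).inverse v) x₁ := by
    refine ContMDiffAt.clm_apply (g := fun x => (Φ x).inverse) ?_ contMDiffAt_const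
    refine ContMDiffAt.comp (g := ContinuousLinearMap.inverse) (f := Φ)
      (I' := 𝓘(ℝ, E →L[ℝ] E)) x₁ ?_ hΦ
    rw [hΦ1]
    exact (contDiffAt_map_inverse (ContinuousLinearEquiv.refl ℝ E)).contMDiffAt
  refine ContMDiffAt.congr_of_eventuallyEq (SmoothAlongAt.frame hΓ hinv) ?_
  have hev1 : ∀ᶠ x in 𝓝 x₁, Φ x ∈ Set.range ((↑) : (E ≃L[ℝ] E) → E →L[ℝ] E) := by
    refine hΦ.continuousAt.eventually ?_
    rw [hΦ1]
    exact ContinuousLinearEquiv.nhds _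
  have hev2 : ∀ᶠ x in 𝓝 x₁, ∀ i, X i (x₀, x) ∈ (D (x₀, x) : Submodule ℝ (E × E)) :=
    eventually_all.2 fun i => hι.continuousAt.eventually (hXD i)
  filter_upwards [hev1, hev2] with x h1 h2
  obtain ⟨A, hA⟩ := h1
  have hcomp : e x ∘ₗ (Φ x).toLinearMap = Γ x := by
    refine b.ext fun i => ?_
    have h3 : (Φ x).toLinearMap (b i) = (X i (x₀, x)).1 := b.constr_basis _ _ _
    have h4 : Γ x (b i) = (X i (x₀, x)).2 := b.constr_basis _ _ _
    rw [LinearMap.comp_apply, h3, h4]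
    exact huniq (h2 i)
  have h5 : Φ x ((Φ x).inverse v) = v := by
    rw [← hA, ContinuousLinearMap.inverse_equiv]
    exact A.apply_symm_apply v
  have h6 : e x v = Γ x ((Φ x).inverse v) := by
    rw [← hcomp]
    exact congrArg (e x) h5.symm
  exact congrArg (fun t : E => (⟨x, t⟩ : TangentBundle I M)) h6

/-- A Cartan connection on the pair groupoid is given by a frame of the manifold. -/
theorem exists_frame [I.Boundaryless] : ∃ e c, IsFrame I e c ∧
    ∀ (g : M × M) (w : E × E), w ∈ (D g : Submodule ℝ (E × E)) ↔ ∃ v, (e g.1 v, e g.2 v) = w := by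
  -- The frame is built by transport from a base point; if there is none, all conditions are
  -- vacuous.
  rcases isEmpty_or_nonempty M with hM | ⟨⟨x₀⟩⟩
  · refine ⟨fun _ => LinearMap.id, fun _ => 0, ⟨fun v x => isEmptyElim x,
      fun x => isEmptyElim x, fun x => isEmptyElim x, fun v w x => isEmptyElim x⟩,
      fun g => isEmptyElim g.1⟩
  choose f hf using fun x v => (hD.pair_existsUnique (x₀, x) v).exists
  have huniq {x y : M} {v w w' : E} (h : ((v, w) : E × E) ∈ D (x, y))
      (h' : ((v, w') : E × E) ∈ D (x, y)) : w = w' := (hD.pair_existsUnique _ _).unique h h'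
  let e (x : M) : E →ₗ[ℝ] E :=
    { toFun := f x
      map_add' := fun v w => huniq (hf x _) ((D (x₀, x)).add_mem (hf x v) (hf x w))
      -- Linearity holds because the graph is a subspace and the second component is determined by
      -- the first.
      map_smul' := fun r v => huniq (hf x _) ((D (x₀, x)).smul_mem r (hf x v)) }
  have he (x : M) (v : E) : ((v, e x v) : E × E) ∈ D (x₀, x) := hf x v
  have hb (x : M) : Function.Bijective (e x) := by
    constructor
    · intro v w hvw
      have h1 := hD.pair_inv (he x v)
      rw [hvw] at h1
      exact huniq h1 (hD.pair_inv (he x w))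
    · intro w
      obtain ⟨v, hv, -⟩ := hD.pair_existsUnique (x, x₀) w
      exact ⟨v, huniq (he x v) (hD.pair_inv hv)⟩
  obtain ⟨c, hc⟩ := exists_isFrame (hD.pair_smooth x₀ he) hb
  refine ⟨e, c, hc, fun g w => ⟨fun hw => ?_, ?_⟩⟩
  · obtain ⟨v, hv⟩ := (hb g.1).2 w.1
    refine ⟨v, Prod.ext hv ?_⟩
    -- The transport between two points is the inverse of the one from `x₀` to the first, followed
    -- by the one from `x₀` to the second.
    have h1 := hD.pair_mul (hD.pair_inv (he g.1 v)) (he g.2 v)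
    rw [hv] at h1
    exact huniq h1 hw
  · rintro ⟨v, rfl⟩
    exact hD.pair_mul (hD.pair_inv (he g.1 v)) (he g.2 v)

end IsCartanConnection

end Pair

end Gpd

/-! ### The pair groupoid and its product with `H` as models with trivial factors -/

section Unit

variable {E H M : Type*} [NormedAddCommGroup E] [NormedSpace ℝ E]
  [TopologicalSpace H] (I : ModelWithCorners ℝ E H) (M) [TopologicalSpace M] [ChartedSpace H M]

/-- The diffeomorphism `M × Unit ≃ M`. -/
def Diffeomorph.prodUnit : Diffeomorph (I.prod 𝓘(ℝ, Unit)) I (M × Unit) M ∞ where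
  toEquiv := Equiv.prodPUnit M
  contMDiff_toFun := contMDiff_fst
  contMDiff_invFun := contMDiff_id.prodMk contMDiff_const

/-- The diffeomorphism `Unit × M ≃ M`. -/
def Diffeomorph.unitProd : Diffeomorph (𝓘(ℝ, Unit).prod I) I (Unit × M) M ∞ where
  toEquiv := Equiv.punitProd M
  contMDiff_toFun := contMDiff_snd
  contMDiff_invFun := contMDiff_const.prodMk contMDiff_id

instance : LieGroup 𝓘(ℝ, Unit) ∞ Unit where
  contMDiff_mul := contMDiff_const (c := ())
  contMDiff_inv := contMDiff_const (c := ())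

end Unit

namespace Gpd

section UnitModels

variable {EM HM M EH HH H : Type*} [NormedAddCommGroup EM] [NormedSpace ℝ EM]
  [FiniteDimensional ℝ EM] [TopologicalSpace HM] {I : ModelWithCorners ℝ EM HM}
  [TopologicalSpace M] [ChartedSpace HM M] [IsManifold I ∞ M] [I.Boundaryless]
  [NormedAddCommGroup EH] [NormedSpace ℝ EH] [FiniteDimensional ℝ EH] [TopologicalSpace HH]
  {IH : ModelWithCorners ℝ EH HH} [TopologicalSpace H] [ChartedSpace HH H] [Group H]
  [LieGroup IH ∞ H] [IH.Boundaryless] {e : M → EM →ₗ[ℝ] EM}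

set_option linter.unusedSectionVars false

variable (IH I H M) in
/-- The arrows of `H × Pair(M)` as a model. -/
def groupProdPairDiffeo :
    Diffeomorph (arrowModel Unit I IH) (IH.prod (I.prod I)) ((H × M × M) × Unit) (H × M × M) ∞ :=
  Diffeomorph.prodUnit (IH.prod (I.prod I)) (H × M × M)

variable (I M) in
/-- The arrows of `Pair(M)` as a model. -/
def pairDiffeo : Diffeomorph (arrowModel Unit I 𝓘(ℝ, Unit)) (I.prod I) ((Unit × M × M) × Unit)
    (M × M) ∞ :=
  (Diffeomorph.prodUnit (𝓘(ℝ, Unit).prod (I.prod I)) (Unit × M × M)).trans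
    (Diffeomorph.unitProd (I.prod I) (M × M))

theorem isModel_groupProdPair :
    IsModel (groupProdPair H M) (groupProdPairDiffeo M H I IH) (Diffeomorph.prodUnit I M) where
  smooth_smul := contMDiff_const (c := ())
  src _ _ _ _ := rfl
  tgt _ _ _ _ := rfl
  unit _ _ := rfl
  inv _ _ _ _ := rfl
  mul _ _ _ _ _ _ := dif_pos rfl

theorem isModel_pair : IsModel (pair M) (pairDiffeo M I) (Diffeomorph.prodUnit I M) where
  smooth_smul := contMDiff_const (c := ())
  src _ _ _ _ := rfl
  tgt _ _ _ _ := rfl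
  unit _ _ := rfl
  inv _ _ _ _ := rfl
  mul _ _ _ _ _ _ := dif_pos rfl

theorem der_groupProdPairDiffeo (a : (H × M × M) × Unit) (w : (EH × EM × EM) × Unit) :
    der (arrowModel Unit I IH) (IH.prod (I.prod I)) (groupProdPairDiffeo M H I IH) a w = w.1 :=
  der_fst a w

theorem der_pairDiffeo (a : (Unit × M × M) × Unit) (w : (Unit × EM × EM) × Unit) :
    der (arrowModel Unit I 𝓘(ℝ, Unit)) (I.prod I) (pairDiffeo M I) a w = w.1.2 :=
  (der_comp_snd (f := Prod.fst) mdifferentiableAt_fst w).trans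
    (congrArg Prod.snd (der_fst a w))

theorem mem_pairDistribution {g : M × M} {w : EM × EM} :
    w ∈ (modelDistribution (pairDiffeo M I) e g : Submodule ℝ (EM × EM))
      ↔ ∃ v, (e g.1 v, e g.2 v) = w := by
  obtain ⟨⟨⟨h, m₂, m₁⟩, f⟩, rfl⟩ := (pairDiffeo M I).exists_apply_eq g
  constructor
  · rintro ⟨v, rfl⟩
    exact ⟨v.1, ((horFrame_apply h m₂ m₁ f v.1 v.2).trans (der_pairDiffeo _ _)).symm⟩
  · rintro ⟨v, rfl⟩
    exact ⟨(v, ()), (horFrame_apply h m₂ m₁ f v ()).trans (der_pairDiffeo _ _)⟩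

theorem mem_groupProdPairDistribution {g : H × M × M} {w : EH × EM × EM} :
    w ∈ (modelDistribution (groupProdPairDiffeo M H I IH) e g : Submodule ℝ (EH × EM × EM))
      ↔ ∃ v, (0, e g.2.1 v, e g.2.2 v) = w := by
  obtain ⟨⟨⟨h, m₂, m₁⟩, f⟩, rfl⟩ := (groupProdPairDiffeo M H I IH).exists_apply_eq g
  constructor
  · rintro ⟨v, rfl⟩
    exact ⟨v.1, ((horFrame_apply h m₂ m₁ f v.1 v.2).trans (der_groupProdPairDiffeo _ _)).symm⟩
  · rintro ⟨v, rfl⟩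
    exact ⟨(v, ()), (horFrame_apply h m₂ m₁ f v ()).trans (der_groupProdPairDiffeo _ _)⟩

theorem leftFrame_pair_unit (m : M) (n : EM × Unit) :
    leftFrame (pairDiffeo M I) e ((pair M).unit m) n = (0, e m n.1) :=
  (isModel_pair.leftFrame_unit m () n.1 n.2).trans (der_pairDiffeo _ _)

theorem leftFrame_groupProdPair_unit (m : M) (n : EM × EH) :
    leftFrame (groupProdPairDiffeo M H I IH) e ((groupProdPair H M).unit m) n = (n.2, 0, e m n.1) :=
  (isModel_groupProdPair.leftFrame_unit m () n.1 n.2).trans (der_groupProdPairDiffeo _ _)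

theorem baseFrame_prodUnit (m : M) (v : EM × Unit) :
    baseFrame (Diffeomorph.prodUnit I M) e m v = e m v.1 :=
  (baseFrame_apply (ψ := Diffeomorph.prodUnit I M) m () v.1 v.2).trans (der_fst _ _)

end UnitModels

/-! ### Identification of the given distributions with those of the models -/

section Distributions

set_option linter.unusedSectionVars false

variable {EM EH M H : Type*} [NormedAddCommGroup EM] [NormedSpace ℝ EM] [FiniteDimensional ℝ EM]
  [NormedAddCommGroup EH] [NormedSpace ℝ EH] [FiniteDimensional ℝ EH]
  [TopologicalSpace M] [ChartedSpace EM M] [IsManifold 𝓘(ℝ, EM) ∞ M] [TopologicalSpace H]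
  [ChartedSpace EH H] [Group H] [LieGroup 𝓘(ℝ, EH) ∞ H] {e : M → EM →ₗ[ℝ] EM}
  {D : ∀ g : M × M, Submodule ℝ (TangentSpace (𝓘(ℝ, EM).prod 𝓘(ℝ, EM)) g)}
  (hD : ∀ (g : M × M) (w : EM × EM), w ∈ (D g : Submodule ℝ (EM × EM))
    ↔ ∃ v, (e g.1 v, e g.2 v) = w)

include hD

theorem eq_modelDistribution_pair : D = modelDistribution (pairDiffeo M 𝓘(ℝ, EM)) e :=
  funext fun g => Submodule.ext fun w => (hD g w).trans mem_pairDistribution.symm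

theorem mem_canonicalDistribution (g : H × M × M) (w : EH × EM × EM) :
    w ∈ (canonicalDistribution EH H D g : Submodule ℝ (EH × EM × EM))
      ↔ ∃ v, (0, e g.2.1 v, e g.2.2 v) = w := by
  obtain ⟨a, b⟩ := w
  constructor
  · rintro ⟨h1, h2⟩
    obtain ⟨v, rfl⟩ := (hD g.2 b).1 h2
    exact ⟨v, Prod.ext (show (0 : EH) = a from ((Submodule.mem_bot ℝ).1 h1).symm) rfl⟩
  · rintro ⟨v, hv⟩
    obtain ⟨rfl, rfl⟩ := Prod.mk.inj hv
    exact ⟨(Submodule.mem_bot ℝ).2 rfl, (hD g.2 _).2 ⟨v, rfl⟩⟩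

theorem canonicalDistribution_eq_modelDistribution : canonicalDistribution EH H D
      = modelDistribution (groupProdPairDiffeo M H 𝓘(ℝ, EM) 𝓘(ℝ, EH)) e :=
  funext fun g => Submodule.ext fun w =>
    (mem_canonicalDistribution hD g w).trans mem_groupProdPairDistribution.symm

end Distributions

end Gpd

/-! ### Forms with given coefficients, and restriction of the model to the zero section -/

namespace Gpd

section Model

variable {EG HG EN HN EM HM EH HH F G N M H : Type*}
  [NormedAddCommGroup EG] [NormedSpace ℝ EG] [FiniteDimensional ℝ EG] [TopologicalSpace HG]
  [NormedAddCommGroup EN] [NormedSpace ℝ EN] [FiniteDimensional ℝ EN] [TopologicalSpace HN]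
  [NormedAddCommGroup EM] [NormedSpace ℝ EM] [FiniteDimensional ℝ EM] [TopologicalSpace HM]
  [NormedAddCommGroup EH] [NormedSpace ℝ EH] [FiniteDimensional ℝ EH] [TopologicalSpace HH]
  [NormedAddCommGroup F] [NormedSpace ℝ F] [FiniteDimensional ℝ F]
  {IG : ModelWithCorners ℝ EG HG} {IN : ModelWithCorners ℝ EN HN} {IM : ModelWithCorners ℝ EM HM}
  {IH : ModelWithCorners ℝ EH HH}
  [TopologicalSpace G] [ChartedSpace HG G] [IsManifold IG ∞ G]
  [TopologicalSpace N] [ChartedSpace HN N] [IsManifold IN ∞ N]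
  [TopologicalSpace M] [ChartedSpace HM M] [IsManifold IM ∞ M]
  [TopologicalSpace H] [ChartedSpace HH H] [Group H] [LieGroup IH ∞ H] [MulAction H F]
  [IG.Boundaryless] [IN.Boundaryless] [IM.Boundaryless] [IH.Boundaryless]

variable {𝒢 : Gpd G N} {Ψ : Diffeomorph (arrowModel F IM IH) IG ((H × M × M) × F) G ∞}
    {ψ : Diffeomorph (IM.prod 𝓘(ℝ, F)) IN (M × F) N ∞} {e : M → EM →ₗ[ℝ] EM}
    {c : M → EM →L[ℝ] EM →L[ℝ] EM}

set_option linter.unusedSectionVars false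

section Form

variable {D : ∀ g : G, Submodule ℝ (TangentSpace IG g)} {k : EH →L[ℝ] EH →L[ℝ] EH}
    {pr : N → M} {eB : N → EM × F →ₗ[ℝ] EN} {eA : N → EM × EH →ₗ[ℝ] EG}
    {τ : N → EH →ₗ[ℝ] F} {HB : G → EM × F →ₗ[ℝ] EG} {LA : G → EM × EH →ₗ[ℝ] EG}

/-- The form with coefficients `z`. -/
def IsFramed.form (h : IsFramed IG IN IM 𝒢 D e c k pr eB eA τ HB LA)
    (z : M → EM →L[ℝ] EM →L[ℝ] EM) : Bilin IG IN 𝒢 := fun y =>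
  (LinearMap.mk₂ ℝ (fun v w : EN => eA y (z (pr y) (h.theta y v) (h.theta y w), 0))
    (fun v v' w => by rw [← map_add, Prod.mk_add_mk, map_add, map_add, add_apply, add_zero])
    (fun r v w => by rw [← map_smul, Prod.smul_mk, map_smul, map_smul, smul_apply, smul_zero])
    (fun v w w' => by rw [← map_add, Prod.mk_add_mk, map_add, map_add, add_zero])
    (fun r v w => by rw [← map_smul, Prod.smul_mk, map_smul, map_smul, smul_zero]) :
    EN →ₗ[ℝ] EN →ₗ[ℝ] EG)

theorem IsFramed.form_apply (h : IsFramed IG IN IM 𝒢 D e c k pr eB eA τ HB LA)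
    (z : M → EM →L[ℝ] EM →L[ℝ] EM) (y : N) (v w : EN) :
    (h.form z y v w : EG) = eA y (z (pr y) (h.theta y v) (h.theta y w), 0) := rfl

end Form

namespace IsModel

variable (hM : IsModel 𝒢 Ψ ψ)

include hM

theorem der_zeroSection (a : H × M × M) (w : EH × EM × EM) :
    der (IH.prod (IM.prod IM)) IG (fun a => Ψ (a, 0)) a w
      = der (arrowModel F IM IH) IG Ψ (a, 0) (w, 0) := by
  have h1 : MDifferentiableAt (IH.prod (IM.prod IM)) (IH.prod (IM.prod IM))
    (fun a : H × M × M => a) a := mdifferentiableAt_id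
  rw [der_comp (f := fun a : H × M × M => (a, (0 : F))) (Ψ.mdiff _)
    (h1.prodMk mdifferentiableAt_const), der_prodMk h1 mdifferentiableAt_const, der_const, der_id]

theorem der_zeroSection_base (m : M) (w : EM) :
    der IM IN (fun m => ψ (m, 0)) m w = der (IM.prod 𝓘(ℝ, F)) IN ψ (m, 0) (w, 0) := by
  have h1 : MDifferentiableAt IM IM (fun m : M => m) m := mdifferentiableAt_id
  rw [der_base_tuple h1 mdifferentiableAt_const, der_const, der_id]

/-- The restriction of a model to the zero section. -/
theorem isIsoOntoRestriction (h0 : ∀ h : H, h • (0 : F) = 0) :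
    IsIsoOntoRestriction (IH.prod (IM.prod IM)) IM IG IN (groupProdPair H M) 𝒢
      (fun a => Ψ (a, 0)) (fun m => ψ (m, 0)) where
  embedding_base :=
    { smooth := ψ.contMDiff.comp (contMDiff_id.prodMk contMDiff_const)
      isEmbedding := ψ.toHomeomorph.isEmbedding.comp (isEmbedding_prodMkLeft 0)
      immersion := fun m v w hvw => by
        have h1 := (hM.der_zeroSection_base m v).symm.trans
          (Eq.trans hvw (hM.der_zeroSection_base m w))
        exact congrArg Prod.fst ((ψ.der_bijective _).1 h1) }
  embedding :=
    { smooth := Ψ.contMDiff.comp (contMDiff_id.prodMk contMDiff_const)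
      isEmbedding := Ψ.toHomeomorph.isEmbedding.comp (isEmbedding_prodMkLeft 0)
      immersion := fun m v w hvw => by
        have h1 := (hM.der_zeroSection m v).symm.trans (Eq.trans hvw (hM.der_zeroSection m w))
        exact congrArg Prod.fst ((Ψ.der_bijective _).1 h1) }
  range_eq := by
    ext k
    obtain ⟨⟨⟨h, m₂, m₁⟩, f⟩, rfl⟩ := Ψ.exists_apply_eq k
    rw [Set.mem_ofPred_eq, hM.src, hM.tgt]
    constructor
    · rintro ⟨a, ha⟩
      obtain rfl : (0 : F) = f := congrArg Prod.snd (Ψ.injective ha)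
      exact ⟨⟨m₁, by rw [h0]⟩, ⟨m₂, rfl⟩⟩
    -- The vector in `F` is part of the target, so the condition on the target alone forces it to be
    -- zero.
    · rintro ⟨-, m, hm⟩
      obtain rfl : (0 : F) = f := congrArg Prod.snd (ψ.injective hm)
      exact ⟨_, rfl⟩
  src_map := fun ⟨h, m₂, m₁⟩ => by
    change 𝒢.src (Ψ ((h, m₂, m₁), 0)) = ψ (m₁, 0)
    rw [hM.src, h0]
  tgt_map := fun ⟨h, m₂, m₁⟩ => hM.tgt h m₂ m₁ 0
  unit_map m := (hM.unit m 0).symm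
  mul_map := fun ⟨h, m₂, m₁⟩ ⟨h', m₁', m₀⟩ hc hc' => by
    obtain rfl : m₁ = m₁' := hc
    have h1 := hM.mul h h' m₂ m₁ m₀ 0
    rw [h0] at h1
    exact h1.symm.trans (dif_pos hc')

/-- Vectors tangent to the zero section have no `F`-component, so a horizontal one is given by `v`
alone, which is the canonical distribution. The differential of the zero section sends the frame of
`M` to frame vectors with `F`-coefficient zero, and both forms have the same coefficients `z`. -/
theorem restrictsTo {D₀ : ∀ g : H × M × M, Submodule ℝ (TangentSpace (IH.prod (IM.prod IM)) g)}
    (hD₀ : ∀ (g : H × M × M) (w : EH × EM × EM), w ∈ (D₀ g : Submodule ℝ (EH × EM × EM))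
      ↔ ∃ v, (0, e g.2.1 v, e g.2.2 v) = w)
    {ζ₀ : Bilin (IH.prod (IM.prod IM)) IM (groupProdPair H M)} {z : M → EM →L[ℝ] EM →L[ℝ] EM}
    (hζ₀ : ∀ (m : M) (v w : EM),
      (ζ₀ m (e m v) (e m w) : EH × EM × EM) = (0, 0, e m (z m v w)))
    (he : ∀ x, Function.Bijective (e x))
    {ζ : Bilin IG IN 𝒢} (hζ : ∀ (y : N) (v w : EM × F),
      (ζ y (baseFrame ψ e y v) (baseFrame ψ e y w) : EG)
        = leftFrame Ψ e (𝒢.unit y) (z (ψ.symm y).1 v.1 w.1, 0)) :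
    RestrictsTo (IH.prod (IM.prod IM)) IM IG IN (groupProdPair H M) 𝒢
      (fun a => Ψ (a, 0)) (fun m => ψ (m, 0)) (modelDistribution Ψ e) ζ D₀ ζ₀ where
  distribution := fun ⟨h, m₂, m₁⟩ => by
    refine Submodule.ext fun w => Iff.trans ?_ (hD₀ (h, m₂, m₁) w).symm
    have h1 := hM.der_zeroSection (h, m₂, m₁) w
    constructor
    · rintro ⟨⟨v, u⟩, hv⟩
      have h2 := (horFrame_apply h m₂ m₁ 0 v u).symm.trans (Eq.trans hv h1)
      exact ⟨v, congrArg Prod.fst ((Ψ.der_bijective _).1 h2)⟩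
    · rintro ⟨v, rfl⟩
      exact ⟨(v, 0), (horFrame_apply h m₂ m₁ 0 v 0).trans h1.symm⟩
  form := fun m v w => by
    obtain ⟨v, rfl⟩ := (he m).2 v
    obtain ⟨w, rfl⟩ := (he m).2 w
    have h1 (v : EM) : der IM IN (fun m => ψ (m, 0)) m (e m v) = baseFrame ψ e (ψ (m, 0)) (v, 0) :=
      (hM.der_zeroSection_base m _).trans (baseFrame_apply m 0 v 0).symm
    have h2 := hζ (ψ (m, 0)) (v, 0) (w, 0)
    rw [← h1, ← h1, hM.leftFrame_unit, ψ.symm_apply_apply] at h2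
    refine Eq.trans h2 (Eq.trans ?_ (hM.der_zeroSection (1, m, m) (ζ₀ m (e m v) (e m w))).symm)
    exact congrArg (fun t : EH × EM × EM => der (arrowModel F IM IH) IG Ψ ((1, m, m), 0) (t, 0))
      (hζ₀ m v w).symm

end IsModel

end Model

end Gpd

/-! ### Smoothness of the inverses of the charts of a glued manifold -/

section Cover

variable {E H₀ N Q : Type*} [NormedAddCommGroup E] [NormedSpace ℝ E] [TopologicalSpace H₀]
  [TopologicalSpace N] [ChartedSpace H₀ N] [TopologicalSpace Q]

/-- Near `y`, the inverse of `c` is a chart of `N` followed by the inverse of the chart of `Q` made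
from it and `c`. -/
theorem contMDiffOn_symm_of_mem_cover (I : ModelWithCorners ℝ E H₀) [IsManifold I ∞ N]
    (C : Set (OpenPartialHomeomorph Q N)) (hC : ∀ q, ∃ c ∈ C, q ∈ c.source)
    (h : ∀ c ∈ C, ∀ c' ∈ C, ContMDiffOn I I ∞ (c.symm ≫ₕ c') (c.symm ≫ₕ c').source)
    (c : OpenPartialHomeomorph Q N) (hc : c ∈ C) :
    letI := coverChartedSpace H₀ C hC
    ContMDiffOn I I ∞ c.symm c.target := by
  let _ := coverChartedSpace H₀ C hC
  have := coverIsManifold I C hC h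
  intro y hy
  refine ContMDiffAt.contMDiffWithinAt ?_
  have hmem : (c ≫ₕ chartAt H₀ y) ∈ IsManifold.maximalAtlas I ∞ Q :=
    IsManifold.subset_maximalAtlas ⟨c, hc, _, chart_mem_atlas H₀ _, rfl⟩
  have h1 := contMDiffOn_symm_of_mem_maximalAtlas (I := I) (n := ∞) hmem
  have h2 := contMDiffOn_of_mem_maximalAtlas (I := I) (n := ∞)
    (IsManifold.chart_mem_maximalAtlas (I := I) (n := ∞) y)
  have h3 := h1.comp' h2
  have hs : (chartAt H₀ y).source ∩ chartAt H₀ y ⁻¹' (c ≫ₕ chartAt H₀ y).target ∈ 𝓝 y := by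
    refine Filter.inter_mem ((chartAt H₀ y).open_source.mem_nhds (mem_chart_source H₀ y)) ?_
    refine ((chartAt H₀ y).continuousAt (mem_chart_source H₀ y)).preimage_mem_nhds ?_
    exact (c ≫ₕ chartAt H₀ y).open_target.mem_nhds (by simp [hy])
  refine (h3.contMDiffAt hs).congr_of_eventuallyEq ?_
  filter_upwards [hs] with z hz
  simp [(chartAt H₀ y).left_inv hz.1]

end Cover

section Diffeo

variable {E H M E' H' M' : Type*} [NormedAddCommGroup E] [NormedSpace ℝ E]
  [TopologicalSpace H] {I : ModelWithCorners ℝ E H} [TopologicalSpace M] [ChartedSpace H M]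
  [NormedAddCommGroup E'] [NormedSpace ℝ E'] [TopologicalSpace H'] {I' : ModelWithCorners ℝ E' H'}
  [TopologicalSpace M'] [ChartedSpace H' M']

/-- A smooth local homeomorphism, with smooth inverse, that is defined everywhere and onto. -/
def OpenPartialHomeomorph.toDiffeomorph (c : OpenPartialHomeomorph M M')
    (hs : c.source = Set.univ) (ht : c.target = Set.univ) (h : ContMDiffOn I I' ∞ c c.source)
    (h' : ContMDiffOn I' I ∞ c.symm c.target) : Diffeomorph I I' M M' ∞ where
  toFun := c
  invFun := c.symm
  left_inv x := c.left_inv (by rw [hs]; trivial)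
  right_inv x := c.right_inv (by rw [ht]; trivial)
  contMDiff_toFun := contMDiffOn_univ.1 (by rwa [hs] at h)
  contMDiff_invFun := contMDiffOn_univ.1 (by rwa [ht] at h')

end Diffeo

/-! ### The action groupoid of a trivial bundle as a model -/

namespace PrincipalBundle

variable {EM EP EH EF M P H F : Type*}
  [NormedAddCommGroup EM] [NormedSpace ℝ EM] [NormedAddCommGroup EP] [NormedSpace ℝ EP]
  [NormedAddCommGroup EH] [NormedSpace ℝ EH] [NormedAddCommGroup EF] [NormedSpace ℝ EF]
  [TopologicalSpace M] [ChartedSpace EM M] [TopologicalSpace P] [ChartedSpace EP P]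
  [TopologicalSpace H] [ChartedSpace EH H] [Group H] [TopologicalSpace F] [ChartedSpace EF F]
  [IsManifold 𝓘(ℝ, EM) ∞ M] [IsManifold 𝓘(ℝ, EP) ∞ P] [IsManifold 𝓘(ℝ, EF) ∞ F]
  [LieGroup 𝓘(ℝ, EH) ∞ H]
  {B : PrincipalBundle EM EP EH M P H} (R : SmoothRightAction EH EF H F)
  {Φ : P ≃ₘ⟮𝓘(ℝ, EP), 𝓘(ℝ, EM).prod 𝓘(ℝ, EH)⟯ (M × H)}

namespace IsTrivialization

variable (hΦ : B.IsTrivialization Φ)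

set_option linter.unusedSectionVars false

include hΦ in
theorem isLocalTrivialization : IsLocalTrivialization (EM := EM) (EP := EP) (EH := EH) B.act B.proj
    Set.univ Φ.toHomeomorph.toOpenPartialHomeomorph where
  source_eq := rfl
  target_eq := Set.univ_prod_univ.symm
  smooth := Φ.contMDiff.contMDiffOn
  smooth_symm := Φ.symm.contMDiff.contMDiffOn
  fst_eq p _ := hΦ.fst_eq p
  equivariant p _ h := hΦ.equivariant p h

include hΦ in
theorem act_symm (m : M) (k h : H) : B.act (Φ.symm (m, k)) h = Φ.symm (m, k * h) := by
  apply Φ.injective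
  change Φ (B.act _ _) = Φ _
  rw [hΦ.equivariant, Φ.apply_symm_apply, Φ.apply_symm_apply]

/-- The global trivialization of the associated bundle. -/
def assocDiffeo : Diffeomorph (𝓘(ℝ, EM).prod 𝓘(ℝ, EF)) (𝓘(ℝ, EM).prod 𝓘(ℝ, EF))
    (B.Assoc R) (M × F) ∞ :=
  (B.assocTriv R hΦ.isLocalTrivialization).toDiffeomorph rfl Set.univ_prod_univ
    (contMDiffOn_of_mem_cover _ (B.assocCover R) (B.exists_mem_assocCover R)
      B.assocCover_transition _ ⟨_, _, hΦ.isLocalTrivialization, rfl⟩)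
    (contMDiffOn_symm_of_mem_cover _ (B.assocCover R) (B.exists_mem_assocCover R)
      B.assocCover_transition _ ⟨_, _, hΦ.isLocalTrivialization, rfl⟩)

/-- The global trivialization of the space of arrows of the action groupoid. -/
def arrowDiffeo : Diffeomorph ((𝓘(ℝ, EM).prod 𝓘(ℝ, EP)).prod 𝓘(ℝ, EF))
    ((𝓘(ℝ, EM).prod 𝓘(ℝ, EP)).prod 𝓘(ℝ, EF)) (Gpd.ActionArrows (B.atiyahAction R))
    (B.AtiyahArrows × F) ∞ :=
  (B.arrowTriv R hΦ.isLocalTrivialization).toDiffeomorph rfl rfl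
    (contMDiffOn_of_mem_cover _ (B.arrowCover R) (B.exists_mem_arrowCover R)
      (B.arrowCover_transition R) _ ⟨_, _, hΦ.isLocalTrivialization, rfl⟩)
    (contMDiffOn_symm_of_mem_cover _ (B.arrowCover R) (B.exists_mem_arrowCover R)
      (B.arrowCover_transition R) _ ⟨_, _, hΦ.isLocalTrivialization, rfl⟩)

variable (Φ) in
/-- The diffeomorphism `(h, m₂, m₁) ↦ (m₂, s(m₁) h⁻¹)`. -/
def framePairDiffeo : Diffeomorph (𝓘(ℝ, EH).prod (𝓘(ℝ, EM).prod 𝓘(ℝ, EM)))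
    (𝓘(ℝ, EM).prod 𝓘(ℝ, EP)) (H × M × M) (M × P) ∞ where
  toFun a := (a.2.1, Φ.symm (a.2.2, a.1⁻¹))
  invFun y := ((Φ y.2).2⁻¹, y.1, (Φ y.2).1)
  left_inv a := by simp
  right_inv y := by simp
  contMDiff_toFun := (contMDiff_fst.comp contMDiff_snd).prodMk (Φ.symm.contMDiff.comp
    ((contMDiff_snd.comp contMDiff_snd).prodMk ((contMDiff_inv 𝓘(ℝ, EH) ∞).comp contMDiff_fst)))
  contMDiff_invFun := ((contMDiff_inv 𝓘(ℝ, EH) ∞).comp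
    (contMDiff_snd.comp (Φ.contMDiff.comp contMDiff_snd))).prodMk
      (contMDiff_fst.prodMk (contMDiff_fst.comp (Φ.contMDiff.comp contMDiff_snd)))

/-- The diffeomorphism `((h, m₂, m₁), f) ↦ ([s(m₂), f], [s(m₂) h, s(m₁)])`. -/
def modelDiffeo : Diffeomorph ((𝓘(ℝ, EH).prod (𝓘(ℝ, EM).prod 𝓘(ℝ, EM))).prod 𝓘(ℝ, EF))
    ((𝓘(ℝ, EM).prod 𝓘(ℝ, EP)).prod 𝓘(ℝ, EF)) ((H × M × M) × F)
    (Gpd.ActionArrows (B.atiyahAction R)) ∞ :=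
  -- The trivialization of the Atiyah groupoid normalizes the first entry of a class to `s(m₂)`;
  -- accordingly the arrow is represented as `[s(m₂), s(m₁) h⁻¹]`, which equals `[s(m₂) h, s(m₁)]`.
  (((framePairDiffeo Φ).trans (hΦ.assocDiffeo B.toSmoothRightAction).symm).prodCongr
    (Diffeomorph.refl 𝓘(ℝ, EF) F ∞)).trans (hΦ.arrowDiffeo R).symm

theorem assocDiffeo_symm_apply (m : M) (f : F) :
    (hΦ.assocDiffeo R).symm (m, f) = B.cls R (Φ.symm (m, 1)) f := rfl

theorem modelDiffeo_arrow (h : H) (m₂ m₁ : M) (f : F) :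
    (hΦ.modelDiffeo R ((h, m₂, m₁), f)).arrow
      = B.pairCls (Φ.symm (m₂, 1)) (Φ.symm (m₁, h⁻¹)) := rfl

theorem modelDiffeo_obj (h : H) (m₂ m₁ : M) (f : F) :
    (hΦ.modelDiffeo R ((h, m₂, m₁), f)).obj = B.cls R (Φ.symm (m₂, 1)) f := by
  refine (B.arrowMk_obj R hΦ.isLocalTrivialization trivial).trans ?_
  exact congrArg (fun m => B.cls R (Φ.symm (m, 1)) f) (hΦ.proj_symm (m₂, 1))

include hΦ in
theorem pairCls_symm (m₂ m₁ : M) (k k' h : H) :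
    B.pairCls (Φ.symm (m₂, k)) (Φ.symm (m₁, k'))
      = B.pairCls (Φ.symm (m₂, k * h)) (Φ.symm (m₁, k' * h)) := by
  rw [← hΦ.act_symm, ← hΦ.act_symm]
  exact (B.cls_act (R := B.toSmoothRightAction) _ _ h).symm

end IsTrivialization

section Left

variable {EM EP EH F M P H : Type*}
  [NormedAddCommGroup EM] [NormedSpace ℝ EM] [NormedAddCommGroup EP] [NormedSpace ℝ EP]
  [NormedAddCommGroup EH] [NormedSpace ℝ EH] [NormedAddCommGroup F] [NormedSpace ℝ F]
  [TopologicalSpace M] [ChartedSpace EM M] [TopologicalSpace P] [ChartedSpace EP P]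
  [TopologicalSpace H] [ChartedSpace EH H] [Group H]
  [IsManifold 𝓘(ℝ, EM) ∞ M] [IsManifold 𝓘(ℝ, EP) ∞ P] [LieGroup 𝓘(ℝ, EH) ∞ H]
  {B : PrincipalBundle EM EP EH M P H}
  {Φ : P ≃ₘ⟮𝓘(ℝ, EP), 𝓘(ℝ, EM).prod 𝓘(ℝ, EH)⟯ (M × H)} (hΦ : B.IsTrivialization Φ)
  [MulAction H F] (hs : ContMDiff (𝓘(ℝ, EH).prod 𝓘(ℝ, F)) 𝓘(ℝ, F) ∞ (fun x : H × F => x.1 • x.2))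

include hΦ in
-- Acting by `h` on both entries moves the group element from the point of the bundle to the vector.
-- This is the origin of `h⁻¹ • f` in the source map of the model.
theorem IsTrivialization.cls_symm (m : M) (h : H) (f : F) :
    B.cls (SmoothRightAction.ofLeft hs) (Φ.symm (m, h⁻¹)) f
      = B.cls (SmoothRightAction.ofLeft hs) (Φ.symm (m, 1)) (h⁻¹ • f) := by
  have h1 := B.cls_act (R := SmoothRightAction.ofLeft hs) (Φ.symm (m, 1)) (h⁻¹ • f) h⁻¹
  have h2 : (SmoothRightAction.ofLeft hs).act (h⁻¹ • f) h⁻¹ = f := by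
    change h⁻¹⁻¹ • h⁻¹ • f = f
    rw [inv_inv, smul_inv_smul]
  rwa [hΦ.act_symm, one_mul, h2] at h1

theorem IsTrivialization.src_modelDiffeo (h : H) (m₂ m₁ : M) (f : F) :
    (B.actionGpd (SmoothRightAction.ofLeft hs)).src
        (hΦ.modelDiffeo (SmoothRightAction.ofLeft hs) ((h, m₂, m₁), f))
      = (hΦ.assocDiffeo (SmoothRightAction.ofLeft hs)).symm (m₁, h⁻¹ • f) := by
  rw [hΦ.assocDiffeo_symm_apply, ← hΦ.cls_symm]
  -- The object is generalized together with its compatibility proof, so that the equation for it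
  -- can be substituted.
  have h1 : ∀ (n : B.Assoc (SmoothRightAction.ofLeft hs)) (c : B.assocProj n
      = B.assocProj (B.pairCls (Φ.symm (m₂, 1)) (Φ.symm (m₁, h⁻¹)))),
      n = B.cls _ (Φ.symm (m₂, 1)) f →
      B.assocAct n (B.pairCls (Φ.symm (m₂, 1)) (Φ.symm (m₁, h⁻¹))) c
        = B.cls _ (Φ.symm (m₁, h⁻¹)) f := by
    rintro n c rfl
    exact B.assocAct_cls _ _ _ _
  exact h1 _ (hΦ.modelDiffeo (SmoothRightAction.ofLeft hs) ((h, m₂, m₁), f)).compat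
    (hΦ.modelDiffeo_obj _ h m₂ m₁ f)

/-- The action groupoid of a trivial principal bundle. -/
theorem IsTrivialization.isModel [FiniteDimensional ℝ EM] [FiniteDimensional ℝ EP]
    [FiniteDimensional ℝ EH] [FiniteDimensional ℝ F] :
    Gpd.IsModel (B.actionGpd (SmoothRightAction.ofLeft hs))
      (hΦ.modelDiffeo (SmoothRightAction.ofLeft hs))
      (hΦ.assocDiffeo (SmoothRightAction.ofLeft hs)).symm where
  smooth_smul := hs
  src := hΦ.src_modelDiffeo hs
  tgt h m₂ m₁ f := hΦ.modelDiffeo_obj _ h m₂ m₁ f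
  unit m f := by
    refine Gpd.ActionArrows.ext (hΦ.modelDiffeo_obj _ 1 m m f).symm ?_
    refine (B.atiyahUnit_proj _).trans ?_
    rw [hΦ.modelDiffeo_arrow, inv_one]
    rfl
  inv h m₂ m₁ f := by
    refine Gpd.ActionArrows.ext ?_ ?_
    · rw [hΦ.modelDiffeo_obj]
      exact hΦ.src_modelDiffeo hs h m₂ m₁ f
    · rw [hΦ.modelDiffeo_arrow, inv_inv]
      refine (hΦ.pairCls_symm m₁ m₂ h⁻¹ 1 h).trans ?_
      rw [inv_mul_cancel, one_mul]
  mul h h' m₂ m₁ m₀ f := by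
    have hc : (B.actionGpd (SmoothRightAction.ofLeft hs)).src
        (hΦ.modelDiffeo (SmoothRightAction.ofLeft hs) ((h, m₂, m₁), f))
        = (B.actionGpd (SmoothRightAction.ofLeft hs)).tgt
          (hΦ.modelDiffeo (SmoothRightAction.ofLeft hs) ((h', m₁, m₀), h⁻¹ • f)) :=
      (hΦ.src_modelDiffeo hs h m₂ m₁ f).trans (hΦ.modelDiffeo_obj _ h' m₁ m₀ (h⁻¹ • f)).symm
    refine (dif_pos hc).trans (Gpd.ActionArrows.ext ?_ ?_)
    · exact (hΦ.modelDiffeo_obj _ h m₂ m₁ f).trans (hΦ.modelDiffeo_obj _ _ m₂ m₀ f).symm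
    -- The second arrow is rewritten so as to start with the entry `s(m₁) h⁻¹` in which the first
    -- one ends. The composition then cancels it, and the last entry shows the group element `h *
    -- h'`.
    · have h1 : B.pairCls (Φ.symm (m₁, 1)) (Φ.symm (m₀, h'⁻¹))
          = B.pairCls (Φ.symm (m₁, h⁻¹)) (Φ.symm (m₀, (h * h')⁻¹)) := by
        rw [hΦ.pairCls_symm m₁ m₀ 1 _ h⁻¹, one_mul, mul_inv_rev]
      have h2 : ∀ (g : B.AtiyahArrows)
          (c : B.atiyahSrc (B.pairCls (Φ.symm (m₂, 1)) (Φ.symm (m₁, h⁻¹))) = B.assocProj g),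
          g = B.pairCls (Φ.symm (m₁, h⁻¹)) (Φ.symm (m₀, (h * h')⁻¹)) →
          B.atiyahMul (B.pairCls (Φ.symm (m₂, 1)) (Φ.symm (m₁, h⁻¹))) g c
            = B.pairCls (Φ.symm (m₂, 1)) (Φ.symm (m₀, (h * h')⁻¹)) := by
        rintro g c rfl
        exact B.atiyahMul_cls _ _ _ _
      have h3 : B.proj (Φ.symm (m₁, h⁻¹)) = B.proj (Φ.symm (m₁, 1)) := by
        rw [hΦ.proj_symm, hΦ.proj_symm]
      exact h2 (B.pairCls (Φ.symm (m₁, 1)) (Φ.symm (m₀, h'⁻¹))) h3 h1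

/-- The point of the bundle chosen over `m` differs from `s(m)` by a group element, which fixes 0.
-/
theorem IsTrivialization.fixedSection_eq (h0 : ∀ h : H, h • (0 : F) = 0) :
    B.fixedSection (SmoothRightAction.ofLeft hs) 0
      = fun m => (hΦ.assocDiffeo (SmoothRightAction.ofLeft hs)).symm (m, 0) := by
  funext m
  have h1 := (B.proj_surjective m).choose_spec
  obtain ⟨h, hh⟩ := B.exists_act (h1.trans (hΦ.proj_symm (m, 1)).symm)
  exact B.cls_eq_cls.2 ⟨h, hh.symm, (h0 h⁻¹).symm⟩

theorem IsTrivialization.splitting_eq (h0 : ∀ h : H, h • (0 : F) = 0) :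
    B.splitting (SmoothRightAction.ofLeft hs) 0 hΦ
      = fun a => hΦ.modelDiffeo (SmoothRightAction.ofLeft hs) (a, 0) := by
  funext ⟨h, m₂, m₁⟩
  refine Gpd.ActionArrows.ext ?_ ?_
  · rw [hΦ.modelDiffeo_obj]
    exact congrFun (hΦ.fixedSection_eq hs h0) m₂
  · rw [hΦ.modelDiffeo_arrow]
    change B.pairCls (B.act (Φ.symm (m₂, 1)) h) (Φ.symm (m₁, 1)) = _
    rw [hΦ.act_symm, one_mul, hΦ.pairCls_symm m₂ m₁ h 1 h⁻¹, mul_inv_cancel, one_mul]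

end Left

end PrincipalBundle

/-! ### Transfer of coefficients between the three groupoids -/

namespace Gpd

section Transfer

variable {EM EH M H : Type*} [NormedAddCommGroup EM] [NormedSpace ℝ EM] [FiniteDimensional ℝ EM]
  [NormedAddCommGroup EH] [NormedSpace ℝ EH] [FiniteDimensional ℝ EH]
  [TopologicalSpace M] [ChartedSpace EM M] [IsManifold 𝓘(ℝ, EM) ∞ M] [TopologicalSpace H]
  [ChartedSpace EH H] [Group H] [LieGroup 𝓘(ℝ, EH) ∞ H] {e : M → EM →ₗ[ℝ] EM}
  {c : M → EM →L[ℝ] EM →L[ℝ] EM}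
  {D : ∀ g : M × M, Submodule ℝ (TangentSpace (𝓘(ℝ, EM).prod 𝓘(ℝ, EM)) g)}

set_option linter.unusedSectionVars false

/-- The form is the one whose coefficients are the structure functions of the frame. -/
theorem exists_isStrictCovariantAdjustment_pair (hf : IsFrame 𝓘(ℝ, EM) e c)
    (hD : (pair M).IsCartanConnection (𝓘(ℝ, EM).prod 𝓘(ℝ, EM)) 𝓘(ℝ, EM) D)
    (hDe : ∀ (g : M × M) (w : EM × EM), w ∈ (D g : Submodule ℝ (EM × EM))
      ↔ ∃ v, (e g.1 v, e g.2 v) = w) :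
    ∃ ζ, (pair M).IsStrictCovariantAdjustment (𝓘(ℝ, EM).prod 𝓘(ℝ, EM)) 𝓘(ℝ, EM) D ζ := by
  obtain ⟨k, hk⟩ := exists_lieB_invFrame Unit 𝓘(ℝ, Unit)
  obtain rfl := eq_modelDistribution_pair hDe
  have h := isModel_pair.isFramed hf hk
  exact ⟨h.form c, h.isStrictCovariantAdjustment hD hf.isStrictPrimitive (h.form_apply c)⟩

/-- A strict covariant adjustment of the pair groupoid, in terms of coefficients. -/
theorem IsStrictCovariantAdjustment.exists_coeff (hf : IsFrame 𝓘(ℝ, EM) e c)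
    (hDe : ∀ (g : M × M) (w : EM × EM), w ∈ (D g : Submodule ℝ (EM × EM))
      ↔ ∃ v, (e g.1 v, e g.2 v) = w)
    {ζ : Bilin (𝓘(ℝ, EM).prod 𝓘(ℝ, EM)) 𝓘(ℝ, EM) (pair M)}
    (hζ : (pair M).IsStrictCovariantAdjustment (𝓘(ℝ, EM).prod 𝓘(ℝ, EM)) 𝓘(ℝ, EM) D ζ) :
    ∃ z, IsStrictPrimitive 𝓘(ℝ, EM) e c z ∧
      ∀ (m : M) (v w : EM), (ζ m (e m v) (e m w) : EM × EM) = (0, e m (z m v w)) := by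
  obtain ⟨k, hk⟩ := exists_lieB_invFrame Unit 𝓘(ℝ, Unit)
  obtain rfl := eq_modelDistribution_pair hDe
  have h := isModel_pair.isFramed hf hk
  obtain ⟨z, hz, hzζ⟩ := h.exists_form_coeff (s := fun m => m) contMDiff_id (fun _ => rfl)
    hζ.twoForm
  -- The equations for `z` follow from evaluating the given adjustment on the frame; they no longer
  -- refer to the pair groupoid.
  refine ⟨z, h.isStrictPrimitive_of_isStrictCovariantAdjustment Function.surjective_id hz hzζ hζ,
    fun m v w => ?_⟩
  have h1 (v : EM) : h.theta m (e m v) = v := by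
    rw [← baseFrame_prodUnit (I := 𝓘(ℝ, EM)) m (v, ())]
    exact h.theta_eB m (v, ())
  refine (hzζ m (e m v) (e m w)).trans ((leftFrame_pair_unit m _).trans ?_)
  rw [h1, h1]
  rfl

theorem isFlat_pair_iff (hf : IsFrame 𝓘(ℝ, EM) e c)
    (hDe : ∀ (g : M × M) (w : EM × EM), w ∈ (D g : Submodule ℝ (EM × EM))
      ↔ ∃ v, (e g.1 v, e g.2 v) = w) :
    (pair M).IsFlat (𝓘(ℝ, EM).prod 𝓘(ℝ, EM)) 𝓘(ℝ, EM) D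
      ↔ ∀ m, frameDeriv 𝓘(ℝ, EM) e c m = 0 := by
  obtain ⟨k, hk⟩ := exists_lieB_invFrame Unit 𝓘(ℝ, Unit)
  obtain rfl := eq_modelDistribution_pair hDe
  exact (isModel_pair.isFramed hf hk).isFlat_iff

theorem canonicalForm_eq {ζ : Bilin (𝓘(ℝ, EM).prod 𝓘(ℝ, EM)) 𝓘(ℝ, EM) (pair M)}
    {z : M → EM →L[ℝ] EM →L[ℝ] EM}
    (hz : ∀ (m : M) (v w : EM), (ζ m (e m v) (e m w) : EM × EM) = (0, e m (z m v w)))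
    (m : M) (v w : EM) :
    (canonicalForm EH H ζ m (e m v) (e m w) : EH × EM × EM) = (0, 0, e m (z m v w)) :=
  congrArg (fun t : EM × EM => ((0 : EH), t)) (hz m v w)

variable (EH H) in
-- The canonical form has the same coefficients `z` in the frame of the product groupoid, with Lie
-- algebra part zero, so the same equations apply.
theorem isStrictCovariantAdjustment_canonical (hf : IsFrame 𝓘(ℝ, EM) e c)
    (hDe : ∀ (g : M × M) (w : EM × EM), w ∈ (D g : Submodule ℝ (EM × EM))
      ↔ ∃ v, (e g.1 v, e g.2 v) = w)
    {ζ : Bilin (𝓘(ℝ, EM).prod 𝓘(ℝ, EM)) 𝓘(ℝ, EM) (pair M)} {z : M → EM →L[ℝ] EM →L[ℝ] EM}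
    (hp : IsStrictPrimitive 𝓘(ℝ, EM) e c z)
    (hz : ∀ (m : M) (v w : EM), (ζ m (e m v) (e m w) : EM × EM) = (0, e m (z m v w))) :
    (groupProdPair H M).IsStrictCovariantAdjustment (𝓘(ℝ, EH).prod (𝓘(ℝ, EM).prod 𝓘(ℝ, EM)))
      𝓘(ℝ, EM) (canonicalDistribution EH H D) (canonicalForm EH H ζ) := by
  obtain ⟨k, hk⟩ := exists_lieB_invFrame H 𝓘(ℝ, EH)
  rw [canonicalDistribution_eq_modelDistribution hDe]
  have h := isModel_groupProdPair.isFramed hf hk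
  refine h.isStrictCovariantAdjustment (isModel_groupProdPair.isCartanConnection hf.bijective
    (smooth_horFrame hf)) hp fun m v w => ?_
  obtain ⟨v, rfl⟩ := (hf.bijective m).2 v
  obtain ⟨w, rfl⟩ := (hf.bijective m).2 w
  have h1 (v : EM) : h.theta m (e m v) = v := by
    rw [← baseFrame_prodUnit (I := 𝓘(ℝ, EM)) m (v, ())]
    exact h.theta_eB m (v, ())
  rw [h1, h1]
  exact (canonicalForm_eq hz m v w).trans (leftFrame_groupProdPair_unit (I := 𝓘(ℝ, EM))
    (IH := 𝓘(ℝ, EH)) m ((z m v w, 0) : EM × EH)).symm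

variable (EH H) in
theorem isFlat_canonical_iff (hf : IsFrame 𝓘(ℝ, EM) e c)
    (hDe : ∀ (g : M × M) (w : EM × EM), w ∈ (D g : Submodule ℝ (EM × EM))
      ↔ ∃ v, (e g.1 v, e g.2 v) = w) :
    (groupProdPair H M).IsFlat (𝓘(ℝ, EH).prod (𝓘(ℝ, EM).prod 𝓘(ℝ, EM))) 𝓘(ℝ, EM)
      (canonicalDistribution EH H D) ↔ ∀ m, frameDeriv 𝓘(ℝ, EM) e c m = 0 := by
  obtain ⟨k, hk⟩ := exists_lieB_invFrame H 𝓘(ℝ, EH)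
  rw [canonicalDistribution_eq_modelDistribution hDe]
  exact (isModel_groupProdPair.isFramed hf hk).isFlat_iff

variable {EG HG EN HN F G N : Type*} [NormedAddCommGroup EG] [NormedSpace ℝ EG]
  [FiniteDimensional ℝ EG] [TopologicalSpace HG] [NormedAddCommGroup EN] [NormedSpace ℝ EN]
  [FiniteDimensional ℝ EN] [TopologicalSpace HN] [NormedAddCommGroup F] [NormedSpace ℝ F]
  [FiniteDimensional ℝ F] {IG : ModelWithCorners ℝ EG HG} {IN : ModelWithCorners ℝ EN HN}
  [TopologicalSpace G] [ChartedSpace HG G] [IsManifold IG ∞ G]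
  [TopologicalSpace N] [ChartedSpace HN N] [IsManifold IN ∞ N] [MulAction H F]
  [IG.Boundaryless] [IN.Boundaryless] {𝒢 : Gpd G N}
  {Ψ : Diffeomorph (arrowModel F 𝓘(ℝ, EM) 𝓘(ℝ, EH)) IG ((H × M × M) × F) G ∞}
  {ψ : Diffeomorph (𝓘(ℝ, EM).prod 𝓘(ℝ, F)) IN (M × F) N ∞}

/-- The extension of the canonical adjustment to a model. -/
theorem IsModel.exists_isStrictCovariantAdjustment (hM : IsModel 𝒢 Ψ ψ)
    (hf : IsFrame 𝓘(ℝ, EM) e c)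
    (hDe : ∀ (g : M × M) (w : EM × EM), w ∈ (D g : Submodule ℝ (EM × EM))
      ↔ ∃ v, (e g.1 v, e g.2 v) = w)
    {ζ : Bilin (𝓘(ℝ, EM).prod 𝓘(ℝ, EM)) 𝓘(ℝ, EM) (pair M)} {z : M → EM →L[ℝ] EM →L[ℝ] EM}
    (hp : IsStrictPrimitive 𝓘(ℝ, EM) e c z)
    (hz : ∀ (m : M) (v w : EM), (ζ m (e m v) (e m w) : EM × EM) = (0, e m (z m v w))) :
    ∃ DK ζK, 𝒢.IsStrictCovariantAdjustment IG IN DK ζK ∧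
      RestrictsTo (𝓘(ℝ, EH).prod (𝓘(ℝ, EM).prod 𝓘(ℝ, EM))) 𝓘(ℝ, EM) IG IN (groupProdPair H M) 𝒢
        (fun a => Ψ (a, 0)) (fun m => ψ (m, 0)) DK ζK (canonicalDistribution EH H D)
        (canonicalForm EH H ζ) ∧
      (𝒢.IsFlat IG IN DK ↔ ∀ m, frameDeriv 𝓘(ℝ, EM) e c m = 0) := by
  obtain ⟨k, hk⟩ := exists_lieB_invFrame H 𝓘(ℝ, EH)
  have h := hM.isFramed hf hk
  refine ⟨modelDistribution Ψ e, h.form z, h.isStrictCovariantAdjustment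
    (hM.isCartanConnection hf.bijective (smooth_horFrame hf)) hp (h.form_apply z),
    hM.restrictsTo (mem_canonicalDistribution hDe) (canonicalForm_eq hz) hf.bijective
      fun y v w => ?_, h.isFlat_iff.trans ⟨fun h0 m => ?_, fun h0 y => h0 _⟩⟩
  · rw [h.form_apply, h.theta_eB, h.theta_eB]
  -- Every point of `M` lies under a point of the zero section, so the condition over the base of
  -- `𝒢` is the one over `M`.
  · have h1 := h0 (ψ (m, 0))
    rwa [ψ.symm_apply_apply] at h1

end Transfer

end Gpd

end

theorem mainTheorem11 {EM EP EH M P H : Type*}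
    [NormedAddCommGroup EM] [NormedSpace ℝ EM] [FiniteDimensional ℝ EM]
    [NormedAddCommGroup EP] [NormedSpace ℝ EP] [FiniteDimensional ℝ EP]
    [NormedAddCommGroup EH] [NormedSpace ℝ EH] [FiniteDimensional ℝ EH]
    [TopologicalSpace M] [T2Space M] [SecondCountableTopology M]
    [ChartedSpace EM M] [IsManifold 𝓘(ℝ, EM) ∞ M]
    [TopologicalSpace P] [T2Space P] [SecondCountableTopology P]
    [ChartedSpace EP P] [IsManifold 𝓘(ℝ, EP) ∞ P]
    [TopologicalSpace H] [T2Space H] [SecondCountableTopology H]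
    [ChartedSpace EH H] [Group H] [LieGroup 𝓘(ℝ, EH) ∞ H]
    -- a trivial principal bundle, with a trivialization
    (B : PrincipalBundle EM EP EH M P H)
    (Φ : P ≃ₘ⟮𝓘(ℝ, EP), 𝓘(ℝ, EM).prod 𝓘(ℝ, EH)⟯ (M × H)) (hΦ : B.IsTrivialization Φ)
    -- a smooth left action on `ℝ^d` that fixes the origin
    (d : ℕ) [MulAction H (EuclideanSpace ℝ (Fin d))]
    (hsmul : ContMDiff (𝓘(ℝ, EH).prod 𝓘(ℝ, EuclideanSpace ℝ (Fin d)))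
      𝓘(ℝ, EuclideanSpace ℝ (Fin d)) ∞ (fun x : H × EuclideanSpace ℝ (Fin d) => x.1 • x.2))
    (hzero : ∀ h : H, h • (0 : EuclideanSpace ℝ (Fin d)) = 0)
    -- an adjustment on the pair groupoid
    (D : ∀ g : M × M, Submodule ℝ (TangentSpace (𝓘(ℝ, EM).prod 𝓘(ℝ, EM)) g))
    (hD : (Gpd.pair M).IsAdjustment (𝓘(ℝ, EM).prod 𝓘(ℝ, EM)) 𝓘(ℝ, EM) D) :
    let R := SmoothRightAction.ofLeft hsmul
    let IT := 𝓘(ℝ, EM).prod 𝓘(ℝ, EuclideanSpace ℝ (Fin d))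
    let IK := (𝓘(ℝ, EM).prod 𝓘(ℝ, EP)).prod 𝓘(ℝ, EuclideanSpace ℝ (Fin d))
    let IS := 𝓘(ℝ, EH).prod (𝓘(ℝ, EM).prod 𝓘(ℝ, EM))
    let 𝒦 := B.actionGpd R
    let ι := B.splitting R 0 hΦ
    let j := B.fixedSection R 0
    𝒦.IsLieGroupoid IK IT ∧
    Gpd.IsIsoOntoRestriction IS 𝓘(ℝ, EM) IK IT (Gpd.groupProdPair H M) 𝒦 ι j ∧
    (∃ ζ, (Gpd.pair M).IsStrictCovariantAdjustment
      (𝓘(ℝ, EM).prod 𝓘(ℝ, EM)) 𝓘(ℝ, EM) D ζ) ∧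
    ∀ ζ, (Gpd.pair M).IsStrictCovariantAdjustment
        (𝓘(ℝ, EM).prod 𝓘(ℝ, EM)) 𝓘(ℝ, EM) D ζ →
      (Gpd.groupProdPair H M).IsStrictCovariantAdjustment IS 𝓘(ℝ, EM)
        (Gpd.canonicalDistribution EH H D) (Gpd.canonicalForm EH H ζ) ∧
      ((Gpd.groupProdPair H M).IsFlat IS 𝓘(ℝ, EM) (Gpd.canonicalDistribution EH H D) ↔
        (Gpd.pair M).IsFlat (𝓘(ℝ, EM).prod 𝓘(ℝ, EM)) 𝓘(ℝ, EM) D) ∧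
      ∃ DK ζK, 𝒦.IsStrictCovariantAdjustment IK IT DK ζK ∧
        Gpd.RestrictsTo IS 𝓘(ℝ, EM) IK IT (Gpd.groupProdPair H M) 𝒦 ι j DK ζK
          (Gpd.canonicalDistribution EH H D) (Gpd.canonicalForm EH H ζ) ∧
        (𝒦.IsFlat IK IT DK ↔
          (Gpd.pair M).IsFlat (𝓘(ℝ, EM).prod 𝓘(ℝ, EM)) 𝓘(ℝ, EM) D) := by
  have hB := hΦ.isModel hsmul
  obtain ⟨e, c, hf, hDe⟩ := hD.cartan.exists_frame
  intro R IT IK IS 𝒦 ι j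
  have hj : j = fun m => (hΦ.assocDiffeo R).symm (m, 0) := hΦ.fixedSection_eq hsmul hzero
  have hι : ι = fun a => hΦ.modelDiffeo R (a, 0) := hΦ.splitting_eq hsmul hzero
  rw [hj, hι]
  refine ⟨hB.isLieGroupoid, hB.isIsoOntoRestriction hzero,
    Gpd.exists_isStrictCovariantAdjustment_pair hf hD.cartan hDe, fun ζ hζ => ?_⟩
  -- The coefficients of the given form on the pair groupoid serve for the other two groupoids as
  -- well, and flatness of each of the three connections amounts to the vanishing of the derivative
  -- of `c`.
  obtain ⟨z, hp, hz⟩ := hζ.exists_coeff hf hDe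
  have hflat := Gpd.isFlat_pair_iff hf hDe
  obtain ⟨DK, ζK, h1, h2, h3⟩ := hB.exists_isStrictCovariantAdjustment hf hDe hp hz
  exact ⟨Gpd.isStrictCovariantAdjustment_canonical EH H hf hDe hp hz,
    (Gpd.isFlat_canonical_iff EH H hf hDe).trans hflat.symm, DK, ζK, h1, h2,
    h3.trans hflat.symm⟩
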